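/- **Setting.** Let $\varepsilon_i$, $i\in\mathbb Z$, be i.i.d. random vectors in $\mathbb R^{\tilde d}$, let $\varepsilon_i^*$, $i\in\mathbb Z$, be an independent i.i.d. copy, and put $\mathcal G_i=(\varepsilon_i,\varepsilon_{i-1},\dots)$; for $j\ge 1$ let $\mathcal G_i^{*(i-j)}$ be $\mathcal G_i$ with $\varepsilon_{i-j}$ replaced by $\varepsilon_{i-j}^*$. Let $X_i=J_i(\mathcal G_i)\in\mathbb R^d$ with measurable $J_i$, $i\in\mathbb Z$, and $Z_i=(X_i,X_{i-1},\dots)$. Fix $n\ge1$. For measurable $f:(\mathbb R^d)^{\mathbb N_0}\times[0,1]\to\mathbb R$ and $\nu\in\{1,2\}$ put $\|f\|_{\nu,n}=\big(\frac1n\sum_{i=1}^n\|f(Z_i,\frac in)\|_\nu^\nu\big)^{1/\nu}\in[0,\infty]$. Let $(\Delta(k))_{k\ge0}$ be a decreasing, nonnegative, summable sequence, let $\mathbb D_n,\mathbb D_n^\infty\in(0,\infty)$, and $$V(f)=\|f\|_{2,n}+\sum_{k=1}^\infty\min\{\|f\|_{2,n},\mathbb D_n\Delta(k)\}.$$ Let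 $\mathcal F$ be a class of measurable functions $f:(\mathbb R^d)^{\mathbb N_0}\times[0,1]\to\mathbb R$, with real numbers $D_{f,n}(u)$ ($f\in\mathcal F$, $u\in[0,1]$); put $D_n^\infty(u)=\sup_{f\in\mathcal F}|D_{f,n}(u)|$ and suppose that $\sup_{f\in\mathcal F}\big(\frac1n\sum_{i=1}^n D_{f,n}(\frac in)^2\big)^{1/2}\le\mathbb D_n$ and $\big(\frac1n\sum_{i=1}^n D_n^\infty(\frac in)^2\big)^{1/2}\le\mathbb D_n^\infty$. For $i=1,\dots,n$ and measurable $f$ let $W_i(f)=w_i(f)(\mathcal G_i)$ and $W_i(f)^{*(i-j)}=w_i(f)(\mathcal G_i^{*(i-j)})$ with measurable $w_i(f)$. Assume (Assumption 4): 1. For every measurable $g$ for which $g(Z_i,\frac in)$ is integrable there is a null set outside of which $W_i(f_1+f_2)=W_i(f_1)+W_i(f_2)$ for all measurable $f_1,f_2$ with $|f_1|,|f_2|\le g$, and $|W_i(f)|\le W_i(h)$ for all measurable $f,h$ with $|f|\le h\le g$. 2. $\|W_i(f)\|_s\le\|f(Z_i,\frac in)\|_s$ for all measurable $f$ and all $s\in\{1,2,\dots\}\cup\{\infty\}$.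 3. For all $j\ge1$: $\big\|\sup_{f\in\mathcal F}|W_i(f)-W_i(f)^{*(i-j)}|\,\big\|_2\le D_n^\infty(\frac in)\Delta(j)$, and $\|W_i(f)-W_i(f)^{*(i-j)}\|_2\le|D_{f,n}(\frac in)|\Delta(j)$ for every $f\in\mathcal F$. Put $\mathbb G_n^W(f)=\frac1{\sqrt n}\sum_{i=1}^n(W_i(f)-\mathbb E W_i(f))$. Let $\mathbb N(\eta,\mathcal F,V)\in\mathbb N_0\cup\{\infty\}$ be the smallest number of brackets $\{f\in\mathcal F:l\le f\le u\}$ with $l,u\in\mathcal F$ and $V(u-l)\le\eta$ that cover $\mathcal F$, and $\mathbb H=\log\mathbb N$. Put $H(k)=1\vee\log k$ (with $H(0)=1$, $H(\infty)=\infty$), $\beta(q)=\sum_{j\ge q}\Delta(j)$, $q^*(x)=\min\{q\in\{1,2,\dots\}:\beta(q)\le qx\}$, $r(\delta)=\max\{r>0:q^*(r)r\le\delta\}$ and $$m(n,\delta,k)=r\Big(\frac{\delta}{\mathbb D_n}\Big)\frac{\mathbb D_n^\infty\, n^{1/2}}{H(k)^{1/2}}.$$ **Theorem.** There is a universal constant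 $\tilde c>0$ such that, in every such setting, the following holds. If $F$ is a measurable envelope of $\mathcal F$ (that is, $|f|\le F$ for all $f\in\mathcal F$) and $\sigma>0$ satisfies $\sup_{f\in\mathcal F}V(f)\le\sigma$, then $$\mathbb E\sup_{f\in\mathcal F}\big|\mathbb G_n^W(f)\big|\le\tilde c\Big[\Big(1+\frac{\mathbb D_n^\infty}{\mathbb D_n}+\frac{\mathbb D_n}{\mathbb D_n^\infty}\Big)\int_0^\sigma\sqrt{1\vee\mathbb H(\varepsilon,\mathcal F,V)}\,d\varepsilon+\sqrt n\,\Big\|F\,\mathbb 1_{\{F>\frac14 m(n,\sigma,\mathbb N(\frac\sigma2,\mathcal F,V))\}}\Big\|_{1,n}\Big].$$ Here $\mathbb E$ on the left is the outer expectation if the supremum is not measurable, and both sides may be $+\infty$. -/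

import Mathlib

open MeasureTheory ProbabilityTheory
open scoped ENNReal NNReal

noncomputable section

namespace EmpProc

/-- One-sided sequences `(z₀, z₁, z₂, …)` of vectors in `ℝ^m`, that is, `(ℝ^m)^{ℕ₀}`. -/
abbrev Past (m : ℕ) : Type := ℕ → Fin m → ℝ

/-- Real functions `f(z, u)` on `(ℝ^d)^{ℕ₀} × [0,1]`. -/
abbrev Fn (d : ℕ) : Type := Past d × unitInterval → ℝ

section ProcessDefs

variable {Ω : Type*} {m d : ℕ}

/-- `𝒢_i = (ε_i, ε_{i-1}, ε_{i-2}, …)`. -/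
def innov (ε : ℤ → Ω → Fin m → ℝ) (i : ℤ) (ω : Ω) : Past m :=
  fun k => ε (i - k) ω

/-- `𝒢_i^{*(l)}`: the sequence `𝒢_i` with the single entry `ε_l` replaced by `ε'_l`. -/
def innovStar (ε ε' : ℤ → Ω → Fin m → ℝ) (i l : ℤ) (ω : Ω) : Past m :=
  fun k => if i - k = l then ε' l ω else ε (i - k) ω

/-- `Z_i = (X_i, X_{i-1}, X_{i-2}, …)` with `X_i = J_i(𝒢_i)`. -/
def obs (J : ℤ → Past m → Fin d → ℝ) (ε : ℤ → Ω → Fin m → ℝ) (i : ℤ) (ω : Ω) : Past d :=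
  fun k => J (i - k) (innov ε (i - k) ω)

/-- The rescaled time `i / n`, as a point of `[0,1]` (no clamping occurs for `i ≤ n`). -/
def grid (n i : ℕ) : unitInterval :=
  Set.projIcc (0 : ℝ) 1 zero_le_one ((i : ℝ) / (n : ℝ))

/-- The random variable `f(Z_i, i/n)`. -/
def evalObs (J : ℤ → Past m → Fin d → ℝ) (ε : ℤ → Ω → Fin m → ℝ) (n i : ℕ) (f : Fn d)
    (ω : Ω) : ℝ :=
  f (obs J ε i ω, grid n i)

/-- The random variable `W_i(f) = w_i(f)(𝒢_i)`. -/
def WVar (w : ℕ → Fn d → Past m → ℝ) (ε : ℤ → Ω → Fin m → ℝ) (i : ℕ) (f : Fn d)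
    (ω : Ω) : ℝ :=
  w i f (innov ε i ω)

/-- The random variable `W_i(f)^{*(i-j)} = w_i(f)(𝒢_i^{*(i-j)})`. -/
def WStar (w : ℕ → Fn d → Past m → ℝ) (ε ε' : ℤ → Ω → Fin m → ℝ) (i j : ℕ) (f : Fn d)
    (ω : Ω) : ℝ :=
  w i f (innovStar ε ε' i ((i : ℤ) - j) ω)

variable [MeasurableSpace Ω] (μ : Measure Ω)

/-- `‖f‖_{ν,n} = ( (1/n) ∑_{i=1}^n ‖f(Z_i, i/n)‖_ν^ν )^{1/ν}`, with values in `[0,∞]`. -/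
def normN (J : ℤ → Past m → Fin d → ℝ) (ε : ℤ → Ω → Fin m → ℝ) (n : ℕ) (ν : ℝ≥0)
    (f : Fn d) : ℝ≥0∞ :=
  ((n : ℝ≥0∞)⁻¹ *
    ∑ i ∈ Finset.Icc 1 n, eLpNorm (evalObs J ε n i f) (ν : ℝ≥0∞) μ ^ (ν : ℝ)) ^ (1 / (ν : ℝ))

/-- `V(f) = ‖f‖_{2,n} + ∑_{k ≥ 1} min(‖f‖_{2,n}, 𝔻 Δ(k))`, with values in `[0,∞]`. -/
def V (J : ℤ → Past m → Fin d → ℝ) (ε : ℤ → Ω → Fin m → ℝ) (n : ℕ) (DD : ℝ) (Δ : ℕ → ℝ)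
    (f : Fn d) : ℝ≥0∞ :=
  normN μ J ε n 2 f + ∑' k : ℕ, min (normN μ J ε n 2 f) (ENNReal.ofReal (DD * Δ (k + 1)))

/-- `𝔾_n^W(f) = n^{-1/2} ∑_{i=1}^n (W_i(f) - 𝔼 W_i(f))`. -/
def GW (w : ℕ → Fn d → Past m → ℝ) (ε : ℤ → Ω → Fin m → ℝ) (n : ℕ) (f : Fn d) (ω : Ω) : ℝ :=
  (Real.sqrt n)⁻¹ * ∑ i ∈ Finset.Icc 1 n, (WVar w ε i f ω - ∫ ω', WVar w ε i f ω' ∂μ)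

/-- Outer expectation of a `[0,∞]`-valued map; it is the expectation for measurable maps. -/
def outerExp (X : Ω → ℝ≥0∞) : ℝ≥0∞ :=
  ⨅ (Y : Ω → ℝ≥0∞) (_ : Measurable Y) (_ : ∀ ω, X ω ≤ Y ω), ∫⁻ ω, Y ω ∂μ

/-- The innovations `ε_i` and their copies `ε'_i`, `i ∈ ℤ`, are measurable and all together
independent and identically distributed. -/
structure IIDWithCopy (ε ε' : ℤ → Ω → Fin m → ℝ) : Prop where
  meas : ∀ i, Measurable (ε i)
  meas' : ∀ i, Measurable (ε' i)
  indep : iIndepFun (fun t : ℤ ⊕ ℤ => Sum.elim ε ε' t) μ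
  ident : ∀ i, IdentDistrib (ε i) (ε 0) μ μ
  ident' : ∀ i, IdentDistrib (ε' i) (ε 0) μ μ

/-- `D_n^∞(u) = sup_{f ∈ 𝓕} |D_{f,n}(u)|`, with values in `[0,∞]`. -/
def DInf (𝓕 : Set (Fn d)) (D : Fn d → unitInterval → ℝ) (u : unitInterval) : ℝ≥0∞ :=
  ⨆ f ∈ 𝓕, ‖D f u‖ₑ

/-- The conditions on the random variables `W_i(f) = w_i(f)(𝒢_i)`. -/
structure WCondition (J : ℤ → Past m → Fin d → ℝ) (ε ε' : ℤ → Ω → Fin m → ℝ) (n : ℕ)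
    (𝓕 : Set (Fn d)) (w : ℕ → Fn d → Past m → ℝ) (D : Fn d → unitInterval → ℝ)
    (Δ : ℕ → ℝ) : Prop where
  meas : ∀ i ∈ Finset.Icc 1 n, ∀ f : Fn d, Measurable f → Measurable (w i f)
  /-- Additivity. The exceptional null set may depend on an integrable bound `g` of the
  functions involved, so that (regular versions of) conditional expectations are included. -/
  add : ∀ i ∈ Finset.Icc 1 n, ∀ g : Fn d, Measurable g → Integrable (evalObs J ε n i g) μ →
    ∀ᵐ ω ∂μ, ∀ f₁ f₂ : Fn d, Measurable f₁ → Measurable f₂ →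
      (∀ x, |f₁ x| ≤ g x) → (∀ x, |f₂ x| ≤ g x) →
      WVar w ε i (f₁ + f₂) ω = WVar w ε i f₁ ω + WVar w ε i f₂ ω
  /-- Monotonicity: `|f| ≤ h` implies `|W_i(f)| ≤ W_i(h)`. -/
  mono : ∀ i ∈ Finset.Icc 1 n, ∀ g : Fn d, Measurable g → Integrable (evalObs J ε n i g) μ →
    ∀ᵐ ω ∂μ, ∀ f h : Fn d, Measurable f → Measurable h →
      (∀ x, |f x| ≤ h x) → (∀ x, h x ≤ g x) →
      |WVar w ε i f ω| ≤ WVar w ε i h ω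
  /-- `‖W_i(f)‖_s ≤ ‖f(Z_i, i/n)‖_s` for `s ∈ {1, 2, 3, …} ∪ {∞}`. -/
  norm_le : ∀ i ∈ Finset.Icc 1 n, ∀ f : Fn d, Measurable f → ∀ s : ℕ∞, 1 ≤ s →
    eLpNorm (WVar w ε i f) (s : ℝ≥0∞) μ ≤ eLpNorm (evalObs J ε n i f) (s : ℝ≥0∞) μ
  /-- `‖ sup_{f ∈ 𝓕} |W_i(f) - W_i(f)^{*(i-j)}| ‖_2 ≤ D_n^∞(i/n) Δ(j)`. -/
  dep_sup : ∀ i ∈ Finset.Icc 1 n, ∀ j : ℕ, 1 ≤ j →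
    (∫⁻ ω, (⨆ f ∈ 𝓕, ‖WVar w ε i f ω - WStar w ε ε' i j f ω‖ₑ) ^ 2 ∂μ) ^ (1 / 2 : ℝ)
      ≤ DInf 𝓕 D (grid n i) * ENNReal.ofReal (Δ j)
  /-- `‖W_i(f) - W_i(f)^{*(i-j)}‖_2 ≤ |D_{f,n}(i/n)| Δ(j)`. -/
  dep : ∀ i ∈ Finset.Icc 1 n, ∀ j : ℕ, 1 ≤ j → ∀ f ∈ 𝓕,
    eLpNorm (fun ω => WVar w ε i f ω - WStar w ε ε' i j f ω) 2 μ
      ≤ ENNReal.ofReal (|D f (grid n i)| * Δ j)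

end ProcessDefs

/-- The bracketing number `ℕ(η, 𝓕, V)`: the least number of brackets
`[l, u] = {f ∈ 𝓕 : l ≤ f ≤ u}` with `l, u ∈ 𝓕` and `V(u - l) ≤ η` that cover `𝓕`
(`⊤` if no finite number suffices). -/
def bracketNum {d : ℕ} (η : ℝ) (𝓕 : Set (Fn d)) (V : Fn d → ℝ≥0∞) : ℕ∞ :=
  ⨅ (B : Finset (Fn d × Fn d))
    (_ : (∀ b ∈ B, b.1 ∈ 𝓕 ∧ b.2 ∈ 𝓕 ∧ V (b.2 - b.1) ≤ ENNReal.ofReal η) ∧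
      ∀ f ∈ 𝓕, ∃ b ∈ B, b.1 ≤ f ∧ f ≤ b.2), (B.card : ℕ∞)

/-- `H(k) = max(1, log k)`, with `H(∞) = ∞`. -/
def HFun : ℕ∞ → ℝ≥0∞
  | ⊤ => ⊤
  | (k : ℕ) => ENNReal.ofReal (max 1 (Real.log k))

/-- `β(q) = ∑_{j ≥ q} Δ(j)`. -/
def betaFun (Δ : ℕ → ℝ) (q : ℕ) : ℝ := ∑' j : ℕ, Δ (q + j)

/-- `q*(x) = min {q ∈ {1, 2, …} : β(q) ≤ q x}`. -/
def qStar (Δ : ℕ → ℝ) (x : ℝ) : ℕ := sInf {q : ℕ | 1 ≤ q ∧ betaFun Δ q ≤ q * x}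

/-- `r(δ) = max {r > 0 : q*(r) r ≤ δ}`. -/
def rFun (Δ : ℕ → ℝ) (δ : ℝ) : ℝ := sSup {r : ℝ | 0 < r ∧ (qStar Δ r : ℝ) * r ≤ δ}

/-- `m(n, δ, k) = r(δ / 𝔻) 𝔻^∞ n^{1/2} / H(k)^{1/2}`. -/
def mFun (Δ : ℕ → ℝ) (DD DDinf : ℝ) (n : ℕ) (δ : ℝ) (k : ℕ∞) : ℝ≥0∞ :=
  ENNReal.ofReal (rFun Δ (δ / DD) * DDinf * Real.sqrt n) / (HFun k) ^ (1 / 2 : ℝ)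

/-- `F 𝟙{F > t}`. -/
def tailPart {d : ℕ} (F : Fn d) (t : ℝ≥0∞) : Fn d :=
  Set.indicator {x | t < ENNReal.ofReal (F x)} F

end EmpProc

end

/-!
The bound is proved by chaining along brackets, on top of a maximal inequality for finitely many
processes that exploits the functional dependence of the `W_i` on the innovations.

*Finitely many processes.* Let `y_i(𝒢_i)`, `i = 1, …, n`, be bounded random vectors with finitely many
coordinates. Averaging all but the first `j` arguments of `y_i` over an independent copy of the
innovations gives the conditional expectations `trunc`, and `y_i(𝒢_i)` minus its mean is the sum over
the lags `j` of the increments `innovPart`. The second moment of the increment of lag `j` is at most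
that of `y_i(𝒢_i) - y_i(𝒢_i^{*(i-j)})`, because the entries of the pooled sample are exchangeable.
The increments of lag less than `q` are summed over blocks of length `q`: every other block is
independent of the rest, so that a Bernstein type inequality (`integral_norm_sum_le_of_indep`)
applies. For a fixed lag `j ≥ q` the increments form martingale differences when time runs backwards,
and `integral_norm_sum_le_of_weakMartingale`, proved with the log-sum-exp function, bounds the maximum
of their sums with the second moments of the suprema only; this is why the uniform dependence
coefficients `𝔻^∞ Δ(j)` enter through their tail sum `β(q)`. The result is
`IIDWithCopy.integral_norm_sum_sub_le`. With `q = q*(r(δ/𝔻))` and truncation at the level `m(n, δ, k)`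
both contributions are of the order `√n δ √H(k)`
(`IIDWithCopy.integral_norm_centredSum_le`).

*Chaining.* The variables `W_i(f)` are truncated at `t = m(n, σ, ·)/4`. For each `k ≥ 0` the class is
covered by as few brackets `[l, u]` with `V(u - l) ≤ σ / 2^k` as possible. If `l` and
`l'` are the lower ends of brackets of the sizes `δ` and `δ/2` which contain `f`, then the difference
`W(f) - W(l)`, truncated at the level of `δ`, is the difference
`W(f) - W(l')`, truncated at the level of `δ/2`, plus the truncated difference
`W(l') - W(l)`, plus an error which by monotonicity is at most an expression in the ends of the two
brackets (`abs_clip_sub_link_le`). Only pairs of brackets with a common element matter, so no nested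
partitions are needed. The links and the error bounds are finite families to which the maximal
inequality applies, and the means of the error bounds are controlled by second moments divided by
truncation levels (`sq_div_truncLevel_le`). Summation over finitely many steps gives
`exists_integrable_bound_centredSum`, and the sum is compared with the entropy integral.

*Truncation of the class.* Additivity and monotonicity of `W_i`, applied with the bound `2F`, show
that almost surely and simultaneously for all `f ∈ 𝓕` truncating `W_i(f)` at `t` costs at most
`W_i(F 1{F > t})` (`WCondition.ae_forall`); this yields the last term of the bound.
-/

namespace EmpProc

/-! ### Maximal inequalities for finitely many variables -/

theorem exp_le_one_add_add_sq {x : ℝ} (hx : |x| ≤ 1) : Real.exp x ≤ 1 + x + x ^ 2 := by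
  have := abs_le.1 (Real.abs_exp_sub_one_sub_id_le hx)
  linarith [this.2]

theorem exp_le_add_exp_sq (x : ℝ) : Real.exp x ≤ x + Real.exp (x ^ 2) := by
  have h2 := Real.add_one_le_exp (x ^ 2)
  rcases le_or_gt |x| 1 with h | h
  · linarith [exp_le_one_add_add_sq h]
  · rcases lt_abs.1 h with h | h
    · have : Real.exp x ≤ Real.exp (x ^ 2) := Real.exp_le_exp.2 (by nlinarith)
      linarith
    · have : Real.exp x ≤ 1 := Real.exp_le_one_iff.2 (by linarith)
      nlinarith

section SoftMax

variable {ι : Type*} [Fintype ι]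

/-- The log-sum-exp function, a smooth surrogate of the maximum of the coordinates. -/
noncomputable def logSumExp (s : ι → ℝ) : ℝ := Real.log (∑ i, Real.exp (s i))

/-- The softmax weights, that is, the gradient of `logSumExp`. -/
noncomputable def softMax (s : ι → ℝ) (i : ι) : ℝ := Real.exp (s i) / ∑ j, Real.exp (s j)

theorem sum_exp_pos [Nonempty ι] (s : ι → ℝ) : 0 < ∑ i, Real.exp (s i) :=
  Finset.sum_pos (fun _ _ => Real.exp_pos _) Finset.univ_nonempty

theorem softMax_nonneg (s : ι → ℝ) (i : ι) : 0 ≤ softMax s i :=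
  div_nonneg (Real.exp_pos _).le (Finset.sum_nonneg fun _ _ => (Real.exp_pos _).le)

theorem sum_softMax [Nonempty ι] (s : ι → ℝ) : ∑ i, softMax s i = 1 := by
  unfold softMax
  rw [← Finset.sum_div, div_self (sum_exp_pos s).ne']

theorem softMax_le_one [Nonempty ι] (s : ι → ℝ) (i : ι) : softMax s i ≤ 1 := by
  rw [← sum_softMax s]
  exact Finset.single_le_sum (f := softMax s) (fun j _ => softMax_nonneg s j) (Finset.mem_univ i)

theorem le_logSumExp (s : ι → ℝ) (i : ι) : s i ≤ logSumExp s := by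
  rw [logSumExp, ← Real.log_exp (s i)]
  refine Real.log_le_log (by positivity) ?_
  simpa using Finset.single_le_sum (f := fun i => Real.exp (s i))
    (fun j _ => (Real.exp_pos _).le) (Finset.mem_univ i)

/-- The second order bound for `logSumExp`: its Hessian is at most a constant in the supremum norm,
whatever the number of coordinates. -/
theorem logSumExp_add_le [Nonempty ι] (s ξ : ι → ℝ) {B : ℝ} (hB : ∀ i, |ξ i| ≤ B) :
    logSumExp (fun i => s i + ξ i) ≤ logSumExp s + ∑ i, softMax s i * ξ i + 4 * B ^ 2 := by
  set b := ∑ i, softMax s i * ξ i with hb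
  have hbB : |b| ≤ B := by
    calc |b| ≤ ∑ i, |softMax s i * ξ i| := Finset.abs_sum_le_sum_abs _ _
      _ ≤ ∑ i, softMax s i * B := Finset.sum_le_sum fun i _ => by
          rw [abs_mul, abs_of_nonneg (softMax_nonneg s i)]
          exact mul_le_mul_of_nonneg_left (hB i) (softMax_nonneg s i)
      _ = B := by rw [← Finset.sum_mul, sum_softMax, one_mul]
  have hZ := sum_exp_pos s
  have key : ∑ i, Real.exp (s i + ξ i)
      ≤ (∑ i, Real.exp (s i)) * (Real.exp b * Real.exp (4 * B ^ 2)) := by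
    have h1 : ∑ i, Real.exp (s i + ξ i)
        = (∑ i, Real.exp (s i)) * (Real.exp b * ∑ i, softMax s i * Real.exp (ξ i - b)) := by
      rw [Finset.mul_sum, Finset.mul_sum]
      refine Finset.sum_congr rfl fun i _ => ?_
      rw [Real.exp_sub, Real.exp_add, softMax]
      field_simp
    rw [h1]
    refine mul_le_mul_of_nonneg_left (mul_le_mul_of_nonneg_left ?_ (Real.exp_pos b).le) hZ.le
    calc ∑ i, softMax s i * Real.exp (ξ i - b)
        ≤ ∑ i, softMax s i * ((ξ i - b) + Real.exp (4 * B ^ 2)) := by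
          refine Finset.sum_le_sum fun i _ => mul_le_mul_of_nonneg_left ?_ (softMax_nonneg s i)
          refine (exp_le_add_exp_sq _).trans (add_le_add le_rfl (Real.exp_le_exp.2 ?_))
          have h1 := abs_le.1 (hB i)
          have h2 := abs_le.1 hbB
          nlinarith
      _ = Real.exp (4 * B ^ 2) := by
          simp only [mul_add, mul_sub, Finset.sum_add_distrib, Finset.sum_sub_distrib,
            ← Finset.sum_mul, sum_softMax]
          rw [← hb]; ring
  calc logSumExp (fun i => s i + ξ i)
      ≤ Real.log ((∑ i, Real.exp (s i)) * (Real.exp b * Real.exp (4 * B ^ 2))) :=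
        Real.log_le_log (sum_exp_pos _) key
    _ = _ := by
      rw [Real.log_mul hZ.ne' (by positivity), Real.log_mul (by positivity) (by positivity),
        Real.log_exp, Real.log_exp, logSumExp]; ring

end SoftMax

variable {Ω : Type*} [MeasurableSpace Ω] {μ : Measure Ω} [IsProbabilityMeasure μ]
variable {A : Type*} [Fintype A]

/-- The vector of all `± t x_a`; its maximal entry is `|t| ‖x‖`. -/
def signed (t : ℝ) (x : A → ℝ) : A ⊕ A → ℝ := Sum.elim (fun a => t * x a) (fun a => -(t * x a))

theorem mul_norm_le_logSumExp_signed [Nonempty A] {t : ℝ} (x : A → ℝ) :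
    t * ‖x‖ ≤ logSumExp (signed t x) := by
  obtain ⟨a, ha⟩ : ∃ a, ‖x‖ = |x a| := by
    obtain ⟨a, ha⟩ := Finite.exists_max (fun a => ‖x a‖)
    refine ⟨a, le_antisymm ((pi_norm_le_iff_of_nonneg (norm_nonneg _)).2 ha) (norm_le_pi_norm x a)⟩
  rw [ha]
  rcases abs_cases (x a) with ⟨h, _⟩ | ⟨h, _⟩ <;> rw [h]
  · exact le_logSumExp (signed t x) (Sum.inl a)
  · simpa [signed] using le_logSumExp (signed t x) (Sum.inr a)

theorem measurable_logSumExp {ι : Type*} [Fintype ι] : Measurable (logSumExp (ι := ι)) := by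
  unfold logSumExp; fun_prop

theorem measurable_softMax {ι : Type*} [Fintype ι] (i : ι) :
    Measurable (fun s : ι → ℝ => softMax s i) := by
  unfold softMax; fun_prop

theorem measurable_signed {A : Type*} (t : ℝ) : Measurable (signed (A := A) t) := by
  refine measurable_pi_iff.2 fun s => ?_
  rcases s with a | a <;> simp only [signed, Sum.elim_inl, Sum.elim_inr] <;> fun_prop

theorem log_two_mul_card_le [Nonempty A] {H : ℝ} (hH : 1 ≤ H) (hA : Real.log (Fintype.card A) ≤ H) :
    Real.log (2 * Fintype.card A) ≤ 2 * H := by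
  rw [Real.log_mul (by norm_num) (by simp)]
  have := Real.log_two_lt_d9
  linarith

theorem integrable_of_norm_le {E : Type*} [NormedAddCommGroup E] {f : Ω → E}
    (hf : AEStronglyMeasurable f μ) {K : ℝ} (h : ∀ ω, ‖f ω‖ ≤ K) : Integrable f μ :=
  Integrable.of_bound hf K (Filter.Eventually.of_forall h)

/-- A maximal inequality for finitely many (weak) martingales, without any boundedness entering the
bound: `logSumExp` of the partial sums grows in expectation by at most the expected square of the
supremum norm of each increment. -/
theorem integral_norm_sum_le_of_weakMartingale (N : ℕ) (ξ : ℕ → Ω → A → ℝ)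
    (hm : ∀ r, Measurable (ξ r)) {K : ℝ} (hK : ∀ r ω, ‖ξ r ω‖ ≤ K)
    (hmart : ∀ r < N, ∀ g : (A → ℝ) → ℝ, Measurable g → (∀ x, |g x| ≤ 1) → ∀ a,
      ∫ ω, g (∑ r' ∈ Finset.range r, ξ r' ω) * ξ r ω a ∂μ = 0)
    {H : ℝ} (hH : 1 ≤ H) (hA : Real.log (Fintype.card A) ≤ H) {V : ℝ} (hV : 0 ≤ V)
    (hsum : ∑ r ∈ Finset.range N, ∫ ω, ‖ξ r ω‖ ^ 2 ∂μ ≤ V ^ 2) :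
    ∫ ω, ‖∑ r ∈ Finset.range N, ξ r ω‖ ∂μ ≤ 6 * Real.sqrt H * V := by
  rcases isEmpty_or_nonempty A with hA0 | hA0
  · have : ∀ ω, ‖∑ r ∈ Finset.range N, ξ r ω‖ = 0 := fun ω => by
      rw [norm_eq_zero]; exact Subsingleton.elim _ _
    simp only [this, integral_zero]; positivity
  set S : ℕ → Ω → A → ℝ := fun r ω => ∑ r' ∈ Finset.range r, ξ r' ω with hS
  have hSm : ∀ r, Measurable (S r) := fun r => Finset.measurable_fun_sum _ fun r' _ => hm r'
  have hSb : ∀ r ω, ‖S r ω‖ ≤ r * K := fun r ω => by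
    refine (norm_sum_le _ _).trans ((Finset.sum_le_sum fun r' _ => hK r' ω).trans ?_)
    simp
  -- the bound for a fixed smoothing parameter `t`; `logSumExp` increases by a term of mean zero and
  -- a second order term in each step
  have main : ∀ t : ℝ, 0 < t → ∫ ω, ‖S N ω‖ ∂μ ≤ 2 * H / t + 4 * t * V ^ 2 := by
    intro t ht
    have hLm : ∀ r, Measurable fun ω => logSumExp (signed t (S r ω)) := fun r =>
      measurable_logSumExp.comp ((measurable_signed t).comp (hSm r))
    have hLu : ∀ x : A → ℝ, logSumExp (signed t x) ≤ Real.log (2 * Fintype.card A) + t * ‖x‖ := by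
      intro x
      rw [logSumExp, ← Real.log_exp (t * ‖x‖), ← Real.log_mul (by simp) (by positivity)]
      refine Real.log_le_log (sum_exp_pos _) ?_
      have : ∀ s : A ⊕ A, Real.exp (signed t x s) ≤ Real.exp (t * ‖x‖) := by
        intro s
        refine Real.exp_le_exp.2 ((le_abs_self _).trans ?_)
        rcases s with a | a <;>
        · simp only [signed, Sum.elim_inl, Sum.elim_inr, abs_neg, abs_mul, abs_of_pos ht]
          exact mul_le_mul_of_nonneg_left (norm_le_pi_norm x a) ht.le
      refine (Finset.sum_le_sum fun s _ => this s).trans ?_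
      simp [two_mul]
    have hL0 : ∀ x : A → ℝ, 0 ≤ logSumExp (signed t x) := fun x =>
      (by positivity : 0 ≤ t * ‖x‖).trans (mul_norm_le_logSumExp_signed x)
    have hLi : ∀ r, Integrable (fun ω => logSumExp (signed t (S r ω))) μ := fun r => by
      refine integrable_of_norm_le (hLm r).aestronglyMeasurable
        (K := Real.log (2 * Fintype.card A) + t * (r * K)) fun ω => ?_
      rw [Real.norm_of_nonneg (hL0 _)]
      refine (hLu _).trans ?_
      gcongr; exact hSb r ω
    have hξ2 : ∀ r, Integrable (fun ω => ‖ξ r ω‖ ^ 2) μ := fun r => by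
      refine integrable_of_norm_le ((hm r).norm.pow_const 2).aestronglyMeasurable
        (K := K ^ 2) fun ω => ?_
      rw [Real.norm_of_nonneg (by positivity)]
      exact pow_le_pow_left₀ (norm_nonneg _) (hK r ω) 2
    have step : ∀ r ≤ N, ∫ ω, logSumExp (signed t (S r ω)) ∂μ
        ≤ Real.log (2 * Fintype.card A)
          + 4 * t ^ 2 * ∑ r' ∈ Finset.range r, ∫ ω, ‖ξ r' ω‖ ^ 2 ∂μ := by
      intro r
      induction r with
      | zero =>
        intro _
        simp only [Finset.range_zero, Finset.sum_empty, mul_zero, add_zero, hS]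
        simpa using hLu 0
      | succ r ih =>
        intro hr
        have hpt : ∀ ω, logSumExp (signed t (S (r + 1) ω)) ≤ logSumExp (signed t (S r ω))
            + ∑ s, softMax (signed t (S r ω)) s * signed t (ξ r ω) s
            + 4 * t ^ 2 * ‖ξ r ω‖ ^ 2 := by
          intro ω
          have h1 : signed t (S (r + 1) ω)
              = fun s => signed t (S r ω) s + signed t (ξ r ω) s := by
            funext s
            rcases s with a | a <;>
              simp only [hS, signed, Finset.sum_range_succ, Sum.elim_inl, Sum.elim_inr,
                Pi.add_apply] <;> ring
          rw [h1]
          have h2 := logSumExp_add_le (signed t (S r ω)) (signed t (ξ r ω)) (B := t * ‖ξ r ω‖) ?_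
          · calc _ ≤ _ := h2
              _ = _ := by ring
          · intro s
            rcases s with a | a <;>
            · simp only [signed, Sum.elim_inl, Sum.elim_inr, abs_neg, abs_mul, abs_of_pos ht]
              exact mul_le_mul_of_nonneg_left (norm_le_pi_norm (ξ r ω) a) ht.le
        have hterm : ∀ s : A ⊕ A, Integrable
            (fun ω => softMax (signed t (S r ω)) s * signed t (ξ r ω) s) μ ∧
            ∫ ω, softMax (signed t (S r ω)) s * signed t (ξ r ω) s ∂μ = 0 := by
          intro s
          have hg : Measurable (fun x : A → ℝ => softMax (signed t x) s) :=
            (measurable_softMax s).comp (measurable_signed t)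
          have hg1 : ∀ x : A → ℝ, |softMax (signed t x) s| ≤ 1 := fun x => by
            rw [abs_of_nonneg (softMax_nonneg _ _)]; exact softMax_le_one _ _
          have hint : ∀ a, Integrable (fun ω => softMax (signed t (S r ω)) s * ξ r ω a) μ := by
            intro a
            refine integrable_of_norm_le (K := K) (Measurable.aestronglyMeasurable
              ((hg.comp (hSm r)).mul ((measurable_pi_apply a).comp (hm r)))) fun ω => ?_
            rw [norm_mul]
            calc _ ≤ 1 * ‖ξ r ω a‖ := mul_le_mul_of_nonneg_right (hg1 _) (norm_nonneg _)
              _ ≤ K := by rw [one_mul]; exact (norm_le_pi_norm _ a).trans (hK r ω)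
          rcases s with a | a
          · have h0 := hmart r (by omega) _ hg hg1 a
            have e : ∀ ω, softMax (signed t (S r ω)) (Sum.inl a) * signed t (ξ r ω) (Sum.inl a)
                = t * (softMax (signed t (S r ω)) (Sum.inl a) * ξ r ω a) := fun ω => by
              simp only [signed, Sum.elim_inl]; ring
            simp only [e]
            refine ⟨(hint a).const_mul t, ?_⟩
            rw [integral_const_mul, h0, mul_zero]
          · have h0 := hmart r (by omega) _ hg hg1 a
            have e : ∀ ω, softMax (signed t (S r ω)) (Sum.inr a) * signed t (ξ r ω) (Sum.inr a)
                = (-t) * (softMax (signed t (S r ω)) (Sum.inr a) * ξ r ω a) := fun ω => by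
              simp only [signed, Sum.elim_inr]; ring
            simp only [e]
            refine ⟨(hint a).const_mul (-t), ?_⟩
            rw [integral_const_mul, h0, mul_zero]
        have hI : Integrable (fun ω => ∑ s, softMax (signed t (S r ω)) s * signed t (ξ r ω) s) μ :=
          integrable_finsetSum _ fun s _ => (hterm s).1
        have hI2 : Integrable (fun ω => logSumExp (signed t (S r ω))
            + ∑ s, softMax (signed t (S r ω)) s * signed t (ξ r ω) s) μ := (hLi r).add hI
        calc ∫ ω, logSumExp (signed t (S (r + 1) ω)) ∂μ
            ≤ ∫ ω, (logSumExp (signed t (S r ω))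
            + ∑ s, softMax (signed t (S r ω)) s * signed t (ξ r ω) s
            + 4 * t ^ 2 * ‖ξ r ω‖ ^ 2) ∂μ :=
              integral_mono (hLi _) (hI2.add ((hξ2 r).const_mul _)) hpt
          _ = ∫ ω, logSumExp (signed t (S r ω)) ∂μ + 0 + 4 * t ^ 2 * ∫ ω, ‖ξ r ω‖ ^ 2 ∂μ := by
              rw [integral_add hI2 ((hξ2 r).const_mul _), integral_add (hLi r) hI,
                integral_finsetSum _ fun s _ => (hterm s).1, integral_const_mul]
              simp [hterm]
          _ ≤ _ := by
              rw [Finset.sum_range_succ]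
              have := ih (by omega)
              linarith
    have h1 : t * ∫ ω, ‖S N ω‖ ∂μ ≤ ∫ ω, logSumExp (signed t (S N ω)) ∂μ := by
      rw [← integral_const_mul]
      refine integral_mono ?_ (hLi N) fun ω => mul_norm_le_logSumExp_signed _
      exact (integrable_of_norm_le (hSm N).norm.aestronglyMeasurable (K := N * K)
        fun ω => by rw [norm_norm]; exact hSb N ω).const_mul t
    have h2 := step N le_rfl
    have h3 := log_two_mul_card_le hH hA
    have h4 : t * ∫ ω, ‖S N ω‖ ∂μ ≤ 2 * H + 4 * t ^ 2 * V ^ 2 := by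
      have : 4 * t ^ 2 * ∑ r' ∈ Finset.range N, ∫ ω, ‖ξ r' ω‖ ^ 2 ∂μ ≤ 4 * t ^ 2 * V ^ 2 :=
        mul_le_mul_of_nonneg_left hsum (by positivity)
      linarith
    have : ∫ ω, ‖S N ω‖ ∂μ ≤ (2 * H + 4 * t ^ 2 * V ^ 2) / t := by
      rw [le_div_iff₀ ht]; linarith
    calc _ ≤ _ := this
      _ = _ := by field_simp
  -- optimize the smoothing parameter, after replacing `V` by a positive number
  have hsH : 0 < Real.sqrt H := Real.sqrt_pos.2 (by linarith)
  have hHs : Real.sqrt H * Real.sqrt H = H := Real.mul_self_sqrt (by linarith)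
  have opt : ∀ W : ℝ, V < W → ∫ ω, ‖S N ω‖ ∂μ ≤ 6 * Real.sqrt H * W := by
    intro W hW
    have hW0 : 0 < W := hV.trans_lt hW
    have h := main (Real.sqrt H / W) (by positivity)
    have h2 : 4 * (Real.sqrt H / W) * V ^ 2 ≤ 4 * (Real.sqrt H / W) * W ^ 2 :=
      mul_le_mul_of_nonneg_left (pow_le_pow_left₀ hV hW.le 2) (by positivity)
    have h3 : 2 * H / (Real.sqrt H / W) = 2 * Real.sqrt H * W := by
      rw [div_div_eq_mul_div, div_eq_iff hsH.ne', ← hHs, Real.sqrt_mul_self hsH.le]; ring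
    have h4 : 4 * (Real.sqrt H / W) * W ^ 2 = 4 * Real.sqrt H * W := by field_simp
    linarith
  refine le_of_forall_pos_le_add fun η hη => ?_
  have := opt (V + η / (6 * Real.sqrt H)) (by linarith [show 0 < η / (6 * Real.sqrt H) by positivity])
  calc _ ≤ _ := this
    _ = _ := by field_simp

/-- A Bernstein type maximal inequality for finitely many sums of independent bounded centred
random variables. -/
theorem integral_norm_sum_le_of_indep (N : ℕ) (T : ℕ → Ω → A → ℝ)
    (hm : ∀ c, Measurable (T c)) {K : ℝ} (hK0 : 0 < K) (hK : ∀ c ω, ‖T c ω‖ ≤ K)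
    (hmean : ∀ c a, ∫ ω, T c ω a ∂μ = 0)
    (hind : ∀ c a, IndepFun (fun ω => ∑ c' ∈ Finset.range c, T c' ω a) (fun ω => T c ω a) μ)
    {H : ℝ} (hH : 1 ≤ H) (hA : Real.log (Fintype.card A) ≤ H) {v : ℝ} (hv : 0 < v)
    (hvar : ∀ a, ∑ c ∈ Finset.range N, ∫ ω, (T c ω a) ^ 2 ∂μ ≤ v ^ 2) :
    ∫ ω, ‖∑ c ∈ Finset.range N, T c ω‖ ∂μ ≤ 2 * H * K + 3 * Real.sqrt H * v := by
  have hsH : 0 < Real.sqrt H := Real.sqrt_pos.2 (by linarith)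
  have hHs : Real.sqrt H * Real.sqrt H = H := Real.mul_self_sqrt (by linarith)
  rcases isEmpty_or_nonempty A with hA0 | hA0
  · have : ∀ ω, ‖∑ r ∈ Finset.range N, T r ω‖ = 0 := fun ω => by
      rw [norm_eq_zero]; exact Subsingleton.elim _ _
    simp only [this, integral_zero]; positivity
  have hTa : ∀ c a, Measurable fun ω => T c ω a := fun c a => (measurable_pi_apply a).comp (hm c)
  have hTK : ∀ c a ω, |T c ω a| ≤ K := fun c a ω => (norm_le_pi_norm (T c ω) a).trans (hK c ω)
  have hSm : ∀ c, Measurable fun ω => ∑ c' ∈ Finset.range c, T c' ω := fun r =>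
    Finset.measurable_fun_sum _ fun r' _ => hm r'
  have hSb : ∀ r ω, ‖∑ c' ∈ Finset.range r, T c' ω‖ ≤ r * K := fun r ω => by
    refine (norm_sum_le _ _).trans ((Finset.sum_le_sum fun r' _ => hK r' ω).trans ?_)
    simp
  -- moment generating functions, for either sign of the argument
  have hmgf : ∀ t : ℝ, |t| * K ≤ 1 → ∀ a,
      ∫ ω, Real.exp (t * ∑ c ∈ Finset.range N, T c ω a) ∂μ ≤ Real.exp (t ^ 2 * v ^ 2) := by
    intro t ht a
    have hone : ∀ c, ∫ ω, Real.exp (t * T c ω a) ∂μ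
        ≤ Real.exp (t ^ 2 * ∫ ω, (T c ω a) ^ 2 ∂μ) := by
      intro c
      have i1 : Integrable (fun ω => T c ω a) μ :=
        integrable_of_norm_le (hTa c a).aestronglyMeasurable (hTK c a)
      have i2 : Integrable (fun ω => (T c ω a) ^ 2) μ :=
        integrable_of_norm_le (K := K ^ 2) ((hTa c a).pow_const 2).aestronglyMeasurable fun ω => by
          rw [norm_pow]; exact pow_le_pow_left₀ (norm_nonneg _) (hTK c a ω) 2
      have habs : ∀ ω, |t * T c ω a| ≤ 1 := fun ω => by
        rw [abs_mul]
        exact (mul_le_mul_of_nonneg_left (hTK c a ω) (abs_nonneg t)).trans ht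
      have i3 : Integrable (fun ω => Real.exp (t * T c ω a)) μ :=
        integrable_of_norm_le (K := Real.exp 1)
          (((hTa c a).const_mul t).exp).aestronglyMeasurable fun ω => by
            rw [Real.norm_of_nonneg (Real.exp_pos _).le]
            exact Real.exp_le_exp.2 (abs_le.1 (habs ω)).2
      have i4 : Integrable (fun ω => 1 + t * T c ω a) μ := (integrable_const 1).add (i1.const_mul t)
      calc ∫ ω, Real.exp (t * T c ω a) ∂μ
          ≤ ∫ ω, (1 + t * T c ω a + t ^ 2 * (T c ω a) ^ 2) ∂μ := by
            refine integral_mono i3 (i4.add (i2.const_mul _)) fun ω => ?_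
            have := exp_le_one_add_add_sq (habs ω)
            simpa [mul_pow] using this
        _ = 1 + t ^ 2 * ∫ ω, (T c ω a) ^ 2 ∂μ := by
            rw [integral_add i4 (i2.const_mul _),
              integral_add (integrable_const 1) (i1.const_mul t), integral_const_mul,
              integral_const_mul, hmean]
            simp
        _ ≤ _ := by linarith [Real.add_one_le_exp (t ^ 2 * ∫ ω, (T c ω a) ^ 2 ∂μ)]
    have hprod : ∀ r, ∫ ω, Real.exp (t * ∑ c ∈ Finset.range r, T c ω a) ∂μ
        ≤ Real.exp (t ^ 2 * ∑ c ∈ Finset.range r, ∫ ω, (T c ω a) ^ 2 ∂μ) := by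
      intro r
      induction r with
      | zero => simp
      | succ r ih =>
        have hi := (hind r a).comp (φ := fun x => Real.exp (t * x)) (ψ := fun x => Real.exp (t * x))
          (by fun_prop) (by fun_prop)
        have hs : Measurable fun ω => ∑ c ∈ Finset.range r, T c ω a :=
          Finset.measurable_fun_sum _ fun c _ => hTa c a
        have e : ∫ ω, Real.exp (t * ∑ c ∈ Finset.range (r + 1), T c ω a) ∂μ
            = (∫ ω, Real.exp (t * ∑ c ∈ Finset.range r, T c ω a) ∂μ)
              * ∫ ω, Real.exp (t * T r ω a) ∂μ := by
          have := hi.integral_fun_mul_eq_mul_integral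
            ((hs.const_mul t).exp).aestronglyMeasurable
            (((hTa r a).const_mul t).exp).aestronglyMeasurable
          simp only [Function.comp_def] at this
          rw [← this]
          refine integral_congr_ae (Filter.Eventually.of_forall fun ω => ?_)
          simp only [Finset.sum_range_succ, mul_add, Real.exp_add]
        rw [e, Finset.sum_range_succ, mul_add, Real.exp_add]
        exact mul_le_mul ih (hone r) (integral_nonneg fun _ => (Real.exp_pos _).le)
          (Real.exp_pos _).le
    refine (hprod N).trans (Real.exp_le_exp.2 ?_)
    exact mul_le_mul_of_nonneg_left (hvar a) (sq_nonneg t)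
  set S : Ω → A → ℝ := fun ω => ∑ c ∈ Finset.range N, T c ω with hS
  have hSa : ∀ ω a, S ω a = ∑ c ∈ Finset.range N, T c ω a := fun ω a => by
    simp [hS, Finset.sum_apply]
  have hSi : Integrable (fun ω => ‖S ω‖) μ :=
    integrable_of_norm_le (hSm N).norm.aestronglyMeasurable (K := N * K)
      fun ω => by rw [norm_norm]; exact hSb N ω
  have hSam : ∀ a, Measurable fun ω => S ω a := fun a => (measurable_pi_apply a).comp (hSm N)
  have main : ∀ t : ℝ, 0 < t → t * K ≤ 1 →
      ∫ ω, ‖S ω‖ ∂μ ≤ (2 * H + t ^ 2 * v ^ 2) / t := by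
    intro t ht htK
    set L := Real.log (2 * Fintype.card A) + t ^ 2 * v ^ 2 with hL
    have iexp : ∀ (u : ℝ) (a : A), Integrable (fun ω => Real.exp (u * S ω a)) μ := fun u a =>
      integrable_of_norm_le (K := Real.exp (|u| * (N * K)))
        (((hSam a).const_mul u).exp).aestronglyMeasurable fun ω => by
          rw [Real.norm_of_nonneg (Real.exp_pos _).le]
          refine Real.exp_le_exp.2 ((le_abs_self _).trans ?_)
          rw [abs_mul]
          exact mul_le_mul_of_nonneg_left ((norm_le_pi_norm _ a).trans (hSb N ω)) (abs_nonneg _)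
    -- the inequality `x + 1 ≤ exp x` at `x = t ‖S‖ - L`, where `exp L` bounds the mean of the sum
    -- of all the exponentials
    have hpt : ∀ ω, t * ‖S ω‖ ≤ L - 1
        + Real.exp (-L) * ∑ a, (Real.exp (t * S ω a) + Real.exp (-t * S ω a)) := by
      intro ω
      obtain ⟨a, ha⟩ := Finite.exists_max (fun a => ‖S ω a‖)
      have ha' : ‖S ω‖ = |S ω a| :=
        le_antisymm ((pi_norm_le_iff_of_nonneg (norm_nonneg _)).2 ha) (norm_le_pi_norm (S ω) a)
      have h1 := Real.add_one_le_exp (t * ‖S ω‖ - L)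
      have h2 : Real.exp (t * ‖S ω‖) ≤ ∑ a, (Real.exp (t * S ω a) + Real.exp (-t * S ω a)) := by
        have h3 := Finset.single_le_sum
          (f := fun a => Real.exp (t * S ω a) + Real.exp (-t * S ω a))
          (fun a _ => by positivity) (Finset.mem_univ a)
        refine le_trans ?_ h3
        rw [ha']
        have p1 := Real.exp_pos (t * S ω a)
        have p2 := Real.exp_pos (-t * S ω a)
        rcases abs_cases (S ω a) with ⟨h, _⟩ | ⟨h, _⟩ <;> rw [h]
        · linarith
        · rw [show t * -S ω a = -t * S ω a by ring]; linarith
      rw [sub_eq_add_neg, Real.exp_add] at h1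
      have h4 := mul_le_mul_of_nonneg_left h2 (Real.exp_pos (-L)).le
      linarith
    have iadd : ∀ a : A, Integrable (fun ω => Real.exp (t * S ω a) + Real.exp (-t * S ω a)) μ :=
      fun a => (iexp t a).add (iexp (-t) a)
    have isum : Integrable (fun ω => ∑ a, (Real.exp (t * S ω a) + Real.exp (-t * S ω a))) μ :=
      integrable_finsetSum _ fun a _ => iadd a
    have hE : ∫ ω, ∑ a, (Real.exp (t * S ω a) + Real.exp (-t * S ω a)) ∂μ ≤ Real.exp L := by
      rw [integral_finsetSum _ fun a _ => iadd a]
      have hb : ∀ a, ∫ ω, (Real.exp (t * S ω a) + Real.exp (-t * S ω a)) ∂μ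
          ≤ 2 * Real.exp (t ^ 2 * v ^ 2) := by
        intro a
        rw [integral_add (iexp t a) (iexp (-t) a)]
        have h1 := hmgf t (by rwa [abs_of_pos ht]) a
        have h2 := hmgf (-t) (by rwa [abs_neg, abs_of_pos ht]) a
        simp only [← hSa, neg_sq] at h1 h2
        linarith
      refine (Finset.sum_le_sum fun a _ => hb a).trans ?_
      rw [hL, Real.exp_add, Real.exp_log (by positivity)]
      simp; linarith
    have h5 : t * ∫ ω, ‖S ω‖ ∂μ ≤ L := by
      rw [← integral_const_mul]
      calc ∫ ω, t * ‖S ω‖ ∂μ ≤ ∫ ω, (L - 1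
            + Real.exp (-L) * ∑ a, (Real.exp (t * S ω a) + Real.exp (-t * S ω a))) ∂μ :=
            integral_mono (hSi.const_mul t) ((integrable_const _).add (isum.const_mul _)) hpt
        _ = L - 1 + Real.exp (-L)
              * ∫ ω, ∑ a, (Real.exp (t * S ω a) + Real.exp (-t * S ω a)) ∂μ := by
            rw [integral_add (integrable_const _) (isum.const_mul _), integral_const_mul]; simp
        _ ≤ L - 1 + Real.exp (-L) * Real.exp L := by gcongr
        _ = L := by rw [← Real.exp_add]; simp
    rw [le_div_iff₀ ht]
    have := log_two_mul_card_le hH hA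
    linarith
  -- the optimal smoothing parameter `√H / v` if it satisfies the constraint `t * K ≤ 1`, and the
  -- largest admissible one otherwise
  rcases le_total K (v / Real.sqrt H) with h | h
  · have h1 := main (Real.sqrt H / v) (by positivity) (by
      calc Real.sqrt H / v * K ≤ Real.sqrt H / v * (v / Real.sqrt H) := by gcongr
        _ = 1 := by field_simp)
    have h2 : (2 * H + (Real.sqrt H / v) ^ 2 * v ^ 2) / (Real.sqrt H / v)
        = 3 * Real.sqrt H * v := by
      have : (Real.sqrt H / v) ^ 2 * v ^ 2 = Real.sqrt H * Real.sqrt H := by field_simp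
      rw [this]
      nth_rewrite 1 [← hHs]
      field_simp; norm_num
    have h3 : 0 ≤ 2 * H * K := by positivity
    linarith
  · have h1 := main (1 / K) (by positivity) (by field_simp; exact le_rfl)
    have h2 : (2 * H + (1 / K) ^ 2 * v ^ 2) / (1 / K) = 2 * H * K + v * v / K := by field_simp
    have h3 : v * v / K ≤ Real.sqrt H * v := by
      rw [div_le_iff₀ hK0]
      have : v ≤ K * Real.sqrt H := (div_le_iff₀ hsH).1 h
      nlinarith
    have h4 : 0 ≤ Real.sqrt H * v := by positivity
    linarith

/-! ### Innovations and their independent copy -/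

theorem indepFun_restrict_of_disjoint {Ω ι E : Type*} [MeasurableSpace Ω] [MeasurableSpace E]
    {μ : Measure Ω} {X : ι → Ω → E} (hX : ∀ i, Measurable (X i)) (hind : iIndepFun X μ)
    {S T : Set ι} (hST : Disjoint S T) :
    IndepFun (fun ω (i : S) => X i ω) (fun ω (i : T) => X i ω) μ := by
  have h := indep_iSup_of_disjoint (m := fun i => MeasurableSpace.comap (X i) inferInstance)
    (fun i => (hX i).comap_le) hind hST
  have e : ∀ U : Set ι, MeasurableSpace.comap (fun ω (i : U) => X i ω) MeasurableSpace.pi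
      = ⨆ i ∈ U, MeasurableSpace.comap (X i) inferInstance := by
    intro U
    simp only [MeasurableSpace.pi, MeasurableSpace.comap_iSup, MeasurableSpace.comap_comp,
      Function.comp_def, iSup_subtype]
  rw [IndepFun_iff_Indep, e, e]
  exact h

/-- The sequence which agrees with `g` up to (excluding) index `j` and with `z` from there on. -/
def glue {E : Type*} (j : ℕ) (g z : ℕ → E) : ℕ → E := fun k => if k < j then g k else z k

theorem measurable_glue {E : Type*} [MeasurableSpace E] (j : ℕ) :
    Measurable fun p : (ℕ → E) × (ℕ → E) => glue j p.1 p.2 := by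
  refine measurable_pi_iff.2 fun k => ?_
  unfold glue
  split_ifs <;> fun_prop

section Innovations

variable {Ω : Type*} [MeasurableSpace Ω] {μ : Measure Ω} [IsProbabilityMeasure μ] {m : ℕ}
  {ε ε' : ℤ → Ω → Fin m → ℝ}

/-- The common law of all the sequences of innovations `innov ε i` and `innov ε' i`. -/
noncomputable def pastLaw (μ : Measure Ω) (ε' : ℤ → Ω → Fin m → ℝ) : Measure (Past m) :=
  μ.map (innov ε' 0)

omit [IsProbabilityMeasure μ] in
theorem IIDWithCopy.measurable_pool (h : IIDWithCopy μ ε ε') (t : ℤ ⊕ ℤ) :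
    Measurable (Sum.elim ε ε' t) := by
  rcases t with i | i
  exacts [h.meas i, h.meas' i]

omit [IsProbabilityMeasure μ] in
/-- Exchangeability: the joint law of distinct members of the pooled sample `ε, ε'` does not depend
on which members are taken. -/
theorem IIDWithCopy.map_pool_eq (h : IIDWithCopy μ ε ε') {T : Type*} {s s' : T → ℤ ⊕ ℤ}
    (hs : s.Injective) (hs' : s'.Injective) :
    μ.map (fun ω t => Sum.elim ε ε' (s t) ω) = μ.map (fun ω t => Sum.elim ε ε' (s' t) ω) := by
  have key : ∀ {s : T → ℤ ⊕ ℤ}, s.Injective → μ.map (fun ω t => Sum.elim ε ε' (s t) ω)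
      = Measure.infinitePi (fun _ : T => μ.map (ε 0)) := by
    intro s hs
    rw [(h.indep.precomp hs).map_fun_eq_infinitePi_map fun t => h.measurable_pool _]
    congr 1
    funext t
    rcases s t with i | i
    exacts [(h.ident i).map_eq, (h.ident' i).map_eq]
  rw [key hs, key hs']

omit [IsProbabilityMeasure μ] in
theorem IIDWithCopy.integral_pool_eq (h : IIDWithCopy μ ε ε') {T G : Type*}
    [NormedAddCommGroup G] [NormedSpace ℝ G] {s s' : T → ℤ ⊕ ℤ}
    (hs : s.Injective) (hs' : s'.Injective) {f : (T → Fin m → ℝ) → G} (hf : StronglyMeasurable f) :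
    ∫ ω, f (fun t => Sum.elim ε ε' (s t) ω) ∂μ = ∫ ω, f (fun t => Sum.elim ε ε' (s' t) ω) ∂μ := by
  have hm : ∀ s : T → ℤ ⊕ ℤ, Measurable fun ω t => Sum.elim ε ε' (s t) ω := fun s =>
    measurable_pi_iff.2 fun t => h.measurable_pool _
  rw [← integral_map (hm s).aemeasurable hf.aestronglyMeasurable,
    ← integral_map (hm s').aemeasurable hf.aestronglyMeasurable, h.map_pool_eq hs hs']

omit [MeasurableSpace Ω] in
theorem innov_eq (ε : ℤ → Ω → Fin m → ℝ) (i : ℤ) (ω : Ω) :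
    innov ε i ω = fun k : ℕ => (fun l => ε l ω) (i - k) := rfl

theorem measurable_innov (hε : ∀ i, Measurable (ε i)) (i : ℤ) : Measurable (innov ε i) :=
  measurable_pi_iff.2 fun _ => hε _

theorem measurable_innovStar (hε : ∀ i, Measurable (ε i)) (hε' : ∀ i, Measurable (ε' i))
    (i l : ℤ) : Measurable (innovStar ε ε' i l) := by
  refine measurable_pi_iff.2 fun k => ?_
  unfold innovStar
  split_ifs
  exacts [hε' _, hε _]

omit [IsProbabilityMeasure μ] in
theorem IIDWithCopy.map_innov' (h : IIDWithCopy μ ε ε') (i : ℤ) :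
    μ.map (innov ε' i) = pastLaw μ ε' :=
  h.map_pool_eq (s := fun k : ℕ => Sum.inr (i - k)) (s' := fun k : ℕ => Sum.inr (0 - k))
    (fun a b hab => by simpa using hab) (fun a b hab => by simpa using hab)

omit [IsProbabilityMeasure μ] in
theorem IIDWithCopy.map_innov (h : IIDWithCopy μ ε ε') (i : ℤ) :
    μ.map (innov ε i) = pastLaw μ ε' :=
  h.map_pool_eq (s := fun k : ℕ => Sum.inl (i - k)) (s' := fun k : ℕ => Sum.inr (0 - k))
    (fun a b hab => by simpa using hab) (fun a b hab => by simpa using hab)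

theorem IIDWithCopy.isProbabilityMeasure_pastLaw (h : IIDWithCopy μ ε ε') :
    IsProbabilityMeasure (pastLaw μ ε') :=
  Measure.isProbabilityMeasure_map (measurable_innov h.meas' 0).aemeasurable

omit [IsProbabilityMeasure μ] in
theorem IIDWithCopy.indepFun_innov' (h : IIDWithCopy μ ε ε') (i : ℤ) :
    IndepFun (fun ω l => ε l ω) (innov ε' i) μ := by
  have hd : Disjoint (Set.range (Sum.inl : ℤ → ℤ ⊕ ℤ)) (Set.range Sum.inr) :=
    Set.disjoint_range_iff.2 fun _ _ => by simp
  exact (indepFun_restrict_of_disjoint (fun t => h.measurable_pool t) h.indep hd).comp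
    (φ := fun x l => x ⟨Sum.inl l, l, rfl⟩) (ψ := fun x k => x ⟨Sum.inr (i - (k : ℕ)), _, rfl⟩)
    (by fun_prop) (by fun_prop)

variable {G : Type*} [NormedAddCommGroup G] [NormedSpace ℝ G] [MeasurableSpace G] [BorelSpace G]
  [SecondCountableTopology G]

omit [IsProbabilityMeasure μ] in
theorem IIDWithCopy.integral_pastLaw (h : IIDWithCopy μ ε ε') (i : ℤ) {f : Past m → G}
    (hf : Measurable f) : ∫ g, f g ∂(pastLaw μ ε') = ∫ ω, f (innov ε i ω) ∂μ := by
  rw [← h.map_innov i, integral_map (measurable_innov h.meas i).aemeasurable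
    hf.aestronglyMeasurable]

/-- Fubini for the innovations and the independent copy. -/
theorem IIDWithCopy.integral_innov' (h : IIDWithCopy μ ε ε') (i : ℤ)
    {f : (ℤ → Fin m → ℝ) × Past m → G} (hf : Measurable f) {K : ℝ} (hK : ∀ x, ‖f x‖ ≤ K) :
    ∫ ω, f (fun l => ε l ω, innov ε' i ω) ∂μ
      = ∫ ω, ∫ z, f (fun l => ε l ω, z) ∂(pastLaw μ ε') ∂μ := by
  have := h.isProbabilityMeasure_pastLaw
  have hm : Measurable fun ω l => ε l ω := measurable_pi_iff.2 h.meas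
  have hm' := measurable_innov h.meas' i
  have : IsProbabilityMeasure (μ.map fun ω l => ε l ω) :=
    Measure.isProbabilityMeasure_map hm.aemeasurable
  have e := (indepFun_iff_map_prod_eq_prod_map_map hm.aemeasurable hm'.aemeasurable).1
    (h.indepFun_innov' i)
  rw [← integral_map (f := f) (hm.prodMk hm').aemeasurable hf.aestronglyMeasurable, e,
    h.map_innov' i, integral_prod _ (integrable_of_norm_le hf.aestronglyMeasurable hK),
    integral_map hm.aemeasurable]
  exact (hf.stronglyMeasurable.integral_prod_right').aestronglyMeasurable

/-- The conditional expectation of `y` given its first `j` arguments, when the arguments are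
distributed according to the product law `Q`. -/
noncomputable def trunc (Q : Measure (Past m)) (j : ℕ) (y : Past m → G) (g : Past m) : G :=
  ∫ z, y (glue j g z) ∂Q

/-- The part of `y` which is due to the argument number `j`, given the arguments before it. -/
noncomputable def innovPart (Q : Measure (Past m)) (j : ℕ) (y : Past m → G) (g : Past m) : G :=
  trunc Q (j + 1) y g - trunc Q j y g

omit [MeasurableSpace G] [BorelSpace G] [SecondCountableTopology G] in
theorem trunc_congr (Q : Measure (Past m)) {j : ℕ} (y : Past m → G) {g g' : Past m}
    (h : ∀ k < j, g k = g' k) : trunc Q j y g = trunc Q j y g' := by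
  have : ∀ z, glue j g z = glue j g' z := fun z => by
    funext k
    unfold glue
    split_ifs with hk
    exacts [h k hk, rfl]
  simp only [trunc, this]

omit [MeasurableSpace G] [BorelSpace G] [SecondCountableTopology G] in
theorem innovPart_congr (Q : Measure (Past m)) {j : ℕ} (y : Past m → G) {g g' : Past m}
    (h : ∀ k ≤ j, g k = g' k) : innovPart Q j y g = innovPart Q j y g' := by
  rw [innovPart, innovPart, trunc_congr Q y fun k hk => h k (by omega),
    trunc_congr Q (j := j) y fun k hk => h k (by omega)]

theorem measurable_trunc {Q : Measure (Past m)} [SFinite Q] (j : ℕ) {y : Past m → G}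
    (hy : Measurable y) : Measurable (trunc Q j y) :=
  (((hy.comp (measurable_glue j)).stronglyMeasurable).integral_prod_right').measurable

theorem measurable_innovPart {Q : Measure (Past m)} [SFinite Q] (j : ℕ) {y : Past m → G}
    (hy : Measurable y) : Measurable (innovPart Q j y) :=
  (measurable_trunc (j + 1) hy).sub (measurable_trunc j hy)

omit [MeasurableSpace G] [BorelSpace G] [SecondCountableTopology G] in
theorem norm_trunc_le {Q : Measure (Past m)} [IsProbabilityMeasure Q] (j : ℕ) {y : Past m → G}
    {M : ℝ} (hM : ∀ g, ‖y g‖ ≤ M) (g : Past m) : ‖trunc Q j y g‖ ≤ M := by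
  simpa [trunc] using norm_integral_le_of_norm_le_const (μ := Q)
    (Filter.Eventually.of_forall fun z => hM (glue j g z))

omit [MeasurableSpace G] [BorelSpace G] [SecondCountableTopology G] in
theorem norm_innovPart_le {Q : Measure (Past m)} [IsProbabilityMeasure Q] (j : ℕ) {y : Past m → G}
    {M : ℝ} (hM : ∀ g, ‖y g‖ ≤ M) (g : Past m) : ‖innovPart Q j y g‖ ≤ 2 * M := by
  refine (norm_sub_le _ _).trans ?_
  linarith [norm_trunc_le (Q := Q) (j + 1) hM g, norm_trunc_le (Q := Q) j hM g]

omit [MeasurableSpace G] [BorelSpace G] [SecondCountableTopology G] in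
theorem trunc_zero (Q : Measure (Past m)) (y : Past m → G) (g : Past m) :
    trunc Q 0 y g = ∫ z, y z ∂Q := rfl

omit [NormedSpace ℝ G] in
theorem integrable_glue {Q : Measure (Past m)} [IsProbabilityMeasure Q] (j : ℕ) {y : Past m → G}
    (hy : Measurable y) {M : ℝ} (hM : ∀ g, ‖y g‖ ≤ M) (g : Past m) :
    Integrable (fun z => y (glue j g z)) Q := by
  refine integrable_of_norm_le (Measurable.aestronglyMeasurable ?_) fun z => hM _
  exact hy.comp ((measurable_glue j).comp (measurable_const.prodMk measurable_id))

theorem trunc_apply {A : Type*} [Fintype A] {Q : Measure (Past m)} [IsProbabilityMeasure Q] (j : ℕ)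
    {y : Past m → A → ℝ} (hy : Measurable y) {M : ℝ} (hM : ∀ g, ‖y g‖ ≤ M) (g : Past m) (a : A) :
    trunc Q j y g a = trunc Q j (fun g => y g a) g := by
  unfold trunc
  exact eval_integral (μ := Q) (fun a => Integrable.eval (integrable_glue j hy hM g) a) a

theorem innovPart_apply {A : Type*} [Fintype A] {Q : Measure (Past m)} [IsProbabilityMeasure Q]
    (j : ℕ) {y : Past m → A → ℝ} (hy : Measurable y) {M : ℝ} (hM : ∀ g, ‖y g‖ ≤ M) (g : Past m)
    (a : A) : innovPart Q j y g a = innovPart Q j (fun g => y g a) g := by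
  rw [innovPart, innovPart, Pi.sub_apply, trunc_apply _ hy hM, trunc_apply _ hy hM]

omit [SecondCountableTopology G] in
theorem sq_norm_integral_le {α : Type*} [MeasurableSpace α] {Q : Measure α}
    [IsProbabilityMeasure Q] {u : α → G} (hu : Measurable u) {K : ℝ} (hK : ∀ x, ‖u x‖ ≤ K) :
    ‖∫ x, u x ∂Q‖ ^ 2 ≤ ∫ x, ‖u x‖ ^ 2 ∂Q := by
  set c := ∫ x, ‖u x‖ ∂Q with hc
  have i1 : Integrable (fun x => ‖u x‖) Q :=
    integrable_of_norm_le hu.norm.aestronglyMeasurable fun x => by rw [norm_norm]; exact hK x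
  have i2 : Integrable (fun x => ‖u x‖ ^ 2) Q :=
    integrable_of_norm_le (K := K ^ 2) (hu.norm.pow_const 2).aestronglyMeasurable fun x => by
      rw [norm_pow, norm_norm]; exact pow_le_pow_left₀ (norm_nonneg _) (hK x) 2
  have h1 : ‖∫ x, u x ∂Q‖ ^ 2 ≤ c ^ 2 :=
    pow_le_pow_left₀ (norm_nonneg _) (norm_integral_le_integral_norm _) 2
  have h2 : 2 * c * c - c ^ 2 ≤ ∫ x, ‖u x‖ ^ 2 ∂Q := by
    calc 2 * c * c - c ^ 2 = ∫ x, (2 * c * ‖u x‖ - c ^ 2) ∂Q := by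
          rw [integral_sub (i1.const_mul _) (integrable_const _), integral_const_mul, ← hc]; simp
      _ ≤ ∫ x, ‖u x‖ ^ 2 ∂Q :=
          integral_mono ((i1.const_mul _).sub (integrable_const _)) i2 fun x => by
            nlinarith [sq_nonneg (‖u x‖ - c)]
  nlinarith

/-- Jensen's inequality, the copy being integrated out. -/
theorem IIDWithCopy.integral_sq_norm_le (h : IIDWithCopy μ ε ε') (i : ℤ)
    {u : Past m × Past m → G} (hu : Measurable u) {K : ℝ} (hK : ∀ x, ‖u x‖ ≤ K) :
    ∫ ω, ‖∫ z, u (innov ε i ω, z) ∂(pastLaw μ ε')‖ ^ 2 ∂μ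
      ≤ ∫ ω, ‖u (innov ε i ω, innov ε' i ω)‖ ^ 2 ∂μ := by
  have := h.isProbabilityMeasure_pastLaw
  have hpast : Measurable fun p : (ℤ → Fin m → ℝ) × Past m =>
      ((fun k : ℕ => p.1 (i - k) : Past m), p.2) := by fun_prop
  have hK2 : ∀ x, ‖‖u x‖ ^ 2‖ ≤ K ^ 2 := fun x => by
    rw [norm_pow, norm_norm]; exact pow_le_pow_left₀ (norm_nonneg _) (hK x) 2
  have e := h.integral_innov' i (f := fun p => ‖u ((fun k : ℕ => p.1 (i - k) : Past m), p.2)‖ ^ 2)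
    ((hu.comp hpast).norm.pow_const 2) fun x => hK2 _
  simp only [innov_eq] at e ⊢
  rw [e]
  have hm : Measurable fun ω => (fun k : ℕ => ε (i - k) ω : Past m) := measurable_innov h.meas i
  refine integral_mono ?_ ?_ fun ω => sq_norm_integral_le (hu.comp measurable_prodMk_left) fun z => hK _
  · refine integrable_of_norm_le (K := K ^ 2) ?_ fun ω => ?_
    · exact (((hu.stronglyMeasurable.integral_prod_right').measurable.comp hm).norm.pow_const
        2).aestronglyMeasurable
    · rw [norm_pow, norm_norm]
      refine pow_le_pow_left₀ (norm_nonneg _) ?_ 2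
      simpa using norm_integral_le_of_norm_le_const (μ := pastLaw μ ε')
        (Filter.Eventually.of_forall fun z => hK (_, z))
  · refine integrable_of_norm_le (K := K ^ 2) ?_ fun ω => ?_
    · exact ((((hu.norm.pow_const 2).stronglyMeasurable).integral_prod_right').measurable.comp
        hm).aestronglyMeasurable
    · simpa using norm_integral_le_of_norm_le_const (μ := pastLaw μ ε')
        (Filter.Eventually.of_forall fun z => hK2 (_, z))

theorem IIDWithCopy.integral_sq_norm_trunc_le (h : IIDWithCopy μ ε ε') (i : ℤ) (j : ℕ)
    {y : Past m → G} (hy : Measurable y) {M : ℝ} (hM : ∀ g, ‖y g‖ ≤ M) :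
    ∫ ω, ‖trunc (pastLaw μ ε') j y (innov ε i ω)‖ ^ 2 ∂μ ≤ ∫ ω, ‖y (innov ε i ω)‖ ^ 2 ∂μ := by
  refine (h.integral_sq_norm_le i (u := fun p => y (glue j p.1 p.2))
    (hy.comp (measurable_glue j)) (K := M) fun x => hM _).trans (le_of_eq ?_)
  have e := h.integral_pool_eq (s := fun k : ℕ => if k < j then Sum.inl (i - k) else Sum.inr (i - k))
    (s' := fun k : ℕ => Sum.inl (i - k)) (f := fun g => ‖y g‖ ^ 2)
    (fun a b hab => by simp only at hab; split_ifs at hab <;> simpa using hab)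
    (fun a b hab => by simpa using hab) (hy.norm.pow_const 2).stronglyMeasurable
  refine Eq.trans ?_ e
  refine integral_congr_ae (Filter.Eventually.of_forall fun ω => ?_)
  simp only
  congr 3
  funext k
  unfold glue innov
  split_ifs <;> rfl

/-- The innovation parts are controlled by the functional dependence measure. -/
theorem IIDWithCopy.integral_sq_norm_innovPart_le (h : IIDWithCopy μ ε ε') (i : ℤ) (j : ℕ)
    {y : Past m → G} (hy : Measurable y) {M : ℝ} (hM : ∀ g, ‖y g‖ ≤ M) :
    ∫ ω, ‖innovPart (pastLaw μ ε') j y (innov ε i ω)‖ ^ 2 ∂μ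
      ≤ ∫ ω, ‖y (innov ε i ω) - y (innovStar ε ε' i (i - j) ω)‖ ^ 2 ∂μ := by
  have := h.isProbabilityMeasure_pastLaw
  have h1 := h.integral_sq_norm_le i (u := fun p => y (glue (j + 1) p.1 p.2) - y (glue j p.1 p.2))
    ((hy.comp (measurable_glue _)).sub (hy.comp (measurable_glue j))) (K := 2 * M)
    fun x => (norm_sub_le _ _).trans (by linarith [hM (glue (j + 1) x.1 x.2), hM (glue j x.1 x.2)])
  have e0 : ∀ g, innovPart (pastLaw μ ε') j y g
      = ∫ z, (y (glue (j + 1) g z) - y (glue j g z)) ∂(pastLaw μ ε') := fun g =>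
    (integral_sub (integrable_glue _ hy hM g) (integrable_glue _ hy hM g)).symm
  simp only [e0]
  refine h1.trans (le_of_eq ?_)
  have hmf : Measurable fun x : Option ℕ → Fin m → ℝ =>
      ‖y (fun k => x (some k)) - y (fun k => if k = j then x none else x (some k))‖ ^ 2 := by
    refine (Measurable.sub (hy.comp (by fun_prop)) (hy.comp ?_)).norm.pow_const 2
    refine measurable_pi_iff.2 fun k => ?_
    split_ifs <;> fun_prop
  -- the arguments from number `j + 1` on are exchanged for their copies; the index `none` stands for
  -- the copy of the argument number `j`
  have e := h.integral_pool_eq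
    (s := fun o : Option ℕ => o.elim (Sum.inr (i - j))
      fun k => if k ≤ j then Sum.inl (i - k) else Sum.inr (i - k))
    (s' := fun o : Option ℕ => o.elim (Sum.inr (i - j)) fun k => Sum.inl (i - k))
    (f := fun x => ‖y (fun k => x (some k))
      - y (fun k => if k = j then x none else x (some k))‖ ^ 2) ?_ ?_ hmf.stronglyMeasurable
  · refine Eq.trans ?_ (e.trans ?_)
    · refine integral_congr_ae (Filter.Eventually.of_forall fun ω => ?_)
      simp only
      congr 4
      · funext k
        simp only [glue, innov, Option.elim]
        split_ifs <;> first | rfl | omega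
      · funext k
        simp only [glue, innov, Option.elim]
        split_ifs with h1 h2 h3 h4 h5 <;> first | rfl | omega | (subst h4; rfl)
    · refine integral_congr_ae (Filter.Eventually.of_forall fun ω => ?_)
      simp only
      congr 4
      funext k
      simp only [innovStar, Option.elim]
      split_ifs with h1 h2 h2 <;> first | rfl | omega
  · intro a b hab
    rcases a with _ | a <;> rcases b with _ | b <;> simp only [Option.elim] at hab ⊢
    all_goals split_ifs at hab <;> simp at hab ⊢ <;> omega
  · intro a b hab
    rcases a with _ | a <;> rcases b with _ | b <;> simp at hab ⊢ <;> omega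

/-- The innovation parts form martingale differences in reversed time. -/
theorem IIDWithCopy.integral_mul_innovPart_eq_zero (h : IIDWithCopy μ ε ε') (i : ℤ) (j : ℕ)
    {y : Past m → ℝ} (hy : Measurable y) {M : ℝ} (hM : ∀ g, ‖y g‖ ≤ M)
    {φ : (ℕ → Fin m → ℝ) → ℝ} (hφ : Measurable φ) {K : ℝ} (hK : ∀ x, ‖φ x‖ ≤ K) :
    ∫ ω, φ (fun l => ε (i - j + 1 + l) ω) * innovPart (pastLaw μ ε') j y (innov ε i ω) ∂μ = 0 := by
  have := h.isProbabilityMeasure_pastLaw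
  have hK0 : 0 ≤ K := (norm_nonneg _).trans (hK 0)
  have hmφ : Measurable fun ω => φ (fun l => ε (i - j + 1 + l) ω) :=
    hφ.comp (measurable_pi_iff.2 fun l => h.meas _)
  have hb : ∀ x v, ‖v‖ ≤ M → ‖φ x * v‖ ≤ K * M := fun x v hv => by
    rw [norm_mul]; exact mul_le_mul (hK x) hv (norm_nonneg _) hK0
  -- the truncations at `q` are computed by Fubini
  have fub : ∀ q : ℕ, ∫ ω, φ (fun l => ε (i - j + 1 + l) ω)
        * trunc (pastLaw μ ε') q y (innov ε i ω) ∂μ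
      = ∫ ω, φ (fun l => ε (i - j + 1 + l) ω) * y (glue q (innov ε i ω) (innov ε' i ω)) ∂μ := by
    intro q
    have hmf : Measurable fun p : (ℤ → Fin m → ℝ) × Past m =>
        φ (fun l => p.1 (i - j + 1 + l)) * y (glue q (fun k : ℕ => p.1 (i - k)) p.2) := by
      have h1 : Measurable fun p : (ℤ → Fin m → ℝ) × Past m =>
        ((fun k : ℕ => p.1 (i - k) : Past m), p.2) := by fun_prop
      exact (hφ.comp (by fun_prop)).mul (hy.comp ((measurable_glue q).comp h1))
    have e := h.integral_innov' i hmf (K := K * M) fun x => hb _ _ (hM _)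
    simp only [innov_eq] at e ⊢
    rw [e]
    refine integral_congr_ae (Filter.Eventually.of_forall fun ω => ?_)
    simp only [trunc, integral_const_mul]
  have hint : ∀ q : ℕ, Integrable (fun ω => φ (fun l => ε (i - j + 1 + l) ω)
      * trunc (pastLaw μ ε') q y (innov ε i ω)) μ := fun q =>
    integrable_of_norm_le (K := K * M) (Measurable.aestronglyMeasurable
      (hmφ.mul ((measurable_trunc q hy).comp (measurable_innov h.meas i))))
      fun ω => hb _ _ (norm_trunc_le q hM _)
  simp only [innovPart, mul_sub]
  rw [integral_sub (hint _) (hint _), fub, fub, sub_eq_zero]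
  -- the entry `ε (i - j)` does not enter `φ`, hence it may be exchanged for its copy
  have hmf : Measurable fun x : ℕ ⊕ ℕ → Fin m → ℝ => φ (fun l => x (Sum.inl l))
      * y (fun k => if k < j then x (Sum.inl (j - 1 - k)) else x (Sum.inr (k - j))) := by
    refine (hφ.comp (by fun_prop)).mul (hy.comp (measurable_pi_iff.2 fun k => ?_))
    split_ifs <;> fun_prop
  have e := h.integral_pool_eq
    (s := Sum.elim (fun l : ℕ => Sum.inl (i - j + 1 + l))
      (fun p : ℕ => if p = 0 then Sum.inl (i - j) else Sum.inr (i - j - p)))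
    (s' := Sum.elim (fun l : ℕ => Sum.inl (i - j + 1 + l)) (fun p : ℕ => Sum.inr (i - j - p)))
    (f := fun x => φ (fun l => x (Sum.inl l))
      * y (fun k => if k < j then x (Sum.inl (j - 1 - k)) else x (Sum.inr (k - j)))) ?_ ?_
    hmf.stronglyMeasurable
  · refine Eq.trans ?_ (e.trans ?_)
    · refine integral_congr_ae (Filter.Eventually.of_forall fun ω => ?_)
      simp only [Sum.elim_inl, Sum.elim_inr]
      congr 2
      funext k
      simp only [glue, innov]
      rcases lt_trichotomy k j with hk | hk | hk
      · rw [if_pos (by omega), if_pos hk, show i - (j : ℤ) + 1 + ((j - 1 - k : ℕ) : ℤ) = i - k by omega]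
      · subst hk; simp
      · rw [if_neg (by omega), if_neg (by omega), if_neg (by omega), Sum.elim_inr,
          show i - (j : ℤ) - ((k - j : ℕ) : ℤ) = i - k by omega]
    · refine integral_congr_ae (Filter.Eventually.of_forall fun ω => ?_)
      simp only [Sum.elim_inl, Sum.elim_inr]
      congr 2
      funext k
      simp only [glue, innov]
      split_ifs with hk
      · rw [show i - (j : ℤ) + 1 + ((j - 1 - k : ℕ) : ℤ) = i - k by omega]
      · rw [show i - (j : ℤ) - ((k - j : ℕ) : ℤ) = i - k by omega]
  · intro a b hab
    rcases a with a | a <;> rcases b with b | b <;> simp only [Sum.elim_inl, Sum.elim_inr] at hab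
    all_goals (try split_ifs at hab) <;> simp at hab ⊢ <;> omega
  · intro a b hab
    rcases a with a | a <;> rcases b with b | b <;> simp at hab ⊢ <;> omega

theorem glue_glue_of_le {E : Type*} {j j' : ℕ} (hj : j ≤ j') (g z z' : ℕ → E) :
    glue j (glue j' g z') z = glue j g z := by
  funext k
  unfold glue
  split_ifs <;> first | rfl | omega

/-- The conditional expectations given the first `j` arguments converge in mean as `j → ∞`, by Lévy's
upward theorem. -/
theorem IIDWithCopy.tendsto_integral_abs_sub_trunc (h : IIDWithCopy μ ε ε') (i : ℤ)
    {y : Past m → ℝ} (hy : Measurable y) {M : ℝ} (hM : ∀ g, ‖y g‖ ≤ M) :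
    Filter.Tendsto (fun j => ∫ ω, |y (innov ε i ω) - trunc (pastLaw μ ε') j y (innov ε i ω)| ∂μ)
      Filter.atTop (nhds 0) := by
  have := h.isProbabilityMeasure_pastLaw
  set Q := pastLaw μ ε' with hQ
  have hg0 : ∀ j, Measurable fun g : Past m => glue j g 0 := fun j =>
    (measurable_glue j).comp (measurable_id.prodMk measurable_const)
  let ℱ : Filtration ℕ (inferInstance : MeasurableSpace (Past m)) :=
    { seq := fun j => MeasurableSpace.comap (fun g : Past m => glue j g 0) inferInstance
      mono' := by
        intro j j' hj
        rintro s ⟨B, hB, rfl⟩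
        refine ⟨(fun g : Past m => glue j g 0) ⁻¹' B, hg0 j hB, ?_⟩
        ext g
        simp only [Set.mem_preimage, glue_glue_of_le hj]
      le' := fun j => (hg0 j).comap_le }
  have hsup : (⨆ j, ℱ j) = (inferInstance : MeasurableSpace (Past m)) := by
    refine le_antisymm (iSup_le fun j => ℱ.le j) ?_
    refine iSup_le fun k => ?_
    refine le_trans ?_ (le_iSup (fun j => (ℱ j : MeasurableSpace (Past m))) (k + 1))
    rintro s ⟨B, hB, rfl⟩
    refine ⟨(fun g : Past m => g k) ⁻¹' B, measurable_pi_apply k hB, ?_⟩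
    ext g
    simp [glue]
  have hyi : Integrable y Q := integrable_of_norm_le hy.aestronglyMeasurable hM
  have hti : ∀ j, Integrable (trunc Q j y) Q := fun j =>
    integrable_of_norm_le (measurable_trunc j hy).aestronglyMeasurable (norm_trunc_le j hM)
  -- Fubini and exchangeability identify `trunc` with a conditional expectation
  have hcond : ∀ j, trunc Q j y =ᵐ[Q] Q[y | ℱ j] := by
    intro j
    refine ae_eq_condExp_of_forall_setIntegral_eq (ℱ.le j) hyi (fun s _ _ => (hti j).integrableOn)
      ?_ ?_
    · rintro s ⟨B, hB, rfl⟩ -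
      have hs : MeasurableSet ((fun g : Past m => glue j g 0) ⁻¹' B) := hg0 j hB
      rw [← integral_indicator hs, ← integral_indicator hs]
      set b : Past m → ℝ := B.indicator fun _ => 1 with hb
      have hbm : Measurable b := measurable_const.indicator hB
      have hb1 : ∀ g, ‖b g‖ ≤ 1 := fun g => by
        rw [hb]; exact (norm_indicator_le_norm_self _ _).trans (by simp)
      have e1 : ∀ f : Past m → ℝ, ((fun g : Past m => glue j g 0) ⁻¹' B).indicator f
          = fun g => b (glue j g 0) * f g := fun f => by
        funext g
        by_cases hg : glue j g 0 ∈ B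
        · rw [Set.indicator_of_mem (by exact hg), hb, Set.indicator_of_mem hg, one_mul]
        · rw [Set.indicator_of_notMem (by exact hg), hb, Set.indicator_of_notMem hg, zero_mul]
      rw [e1, e1, hQ, h.integral_pastLaw i (f := fun g => b (glue j g 0) * trunc (pastLaw μ ε') j y g)
          ((hbm.comp (hg0 j)).mul (measurable_trunc j hy)),
        h.integral_pastLaw i (f := fun g => b (glue j g 0) * y g) ((hbm.comp (hg0 j)).mul hy)]
      have hmf : Measurable fun p : (ℤ → Fin m → ℝ) × Past m =>
          b (glue j (fun k : ℕ => p.1 (i - k)) 0) * y (glue j (fun k : ℕ => p.1 (i - k)) p.2) := by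
        have h1 : Measurable fun p : (ℤ → Fin m → ℝ) × Past m =>
          ((fun k : ℕ => p.1 (i - k) : Past m), p.2) := by fun_prop
        exact (hbm.comp ((hg0 j).comp (by fun_prop))).mul (hy.comp ((measurable_glue j).comp h1))
      have e := h.integral_innov' i hmf (K := 1 * M) fun x => by
        rw [norm_mul]; exact mul_le_mul (hb1 _) (hM _) (norm_nonneg _) zero_le_one
      have e2 := h.integral_pool_eq
        (s := fun k : ℕ => if k < j then Sum.inl (i - k) else Sum.inr (i - k))
        (s' := fun k : ℕ => Sum.inl (i - k)) (f := fun g => b (glue j g 0) * y g)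
        (fun a b hab => by simp only at hab; split_ifs at hab <;> simpa using hab)
        (fun a b hab => by simpa using hab) ((hbm.comp (hg0 j)).mul hy).stronglyMeasurable
      refine Eq.trans ?_ (e.symm.trans (Eq.trans ?_ e2))
      · refine integral_congr_ae (Filter.Eventually.of_forall fun ω => ?_)
        simp only [trunc, integral_const_mul, innov_eq]
      · refine integral_congr_ae (Filter.Eventually.of_forall fun ω => ?_)
        have e3 : (fun k : ℕ => Sum.elim ε ε' (if k < j then Sum.inl (i - k) else Sum.inr (i - k)) ω)
            = glue j (innov ε i ω) (innov ε' i ω) := by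
          funext k
          unfold glue innov
          split_ifs <;> rfl
        simp only
        rw [e3, glue_glue_of_le le_rfl]
        rfl
    · have e : trunc Q j y = fun g => trunc Q j y (glue j g 0) := by
        funext g
        refine trunc_congr Q y fun k hk => ?_
        simp [glue, hk]
      have : StronglyMeasurable[ℱ j] (trunc Q j y) := by
        rw [e]
        refine Measurable.stronglyMeasurable ?_
        exact (measurable_trunc j hy).comp (comap_measurable _)
      exact this.aestronglyMeasurable
  have hlim := hyi.tendsto_eLpNorm_condExp (ℱ := ℱ) (by
    rw [hsup]; exact hy.stronglyMeasurable)
  have hreal := (ENNReal.tendsto_toReal ENNReal.zero_ne_top).comp hlim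
  rw [ENNReal.toReal_zero] at hreal
  refine hreal.congr fun j => ?_
  have e1 : eLpNorm (Q[y | ℱ j] - y) 1 Q = eLpNorm (fun g => y g - trunc Q j y g) 1 Q := by
    rw [eLpNorm_sub_comm]
    refine eLpNorm_congr_ae ?_
    filter_upwards [hcond j] with g hg
    rw [Pi.sub_apply, hg]
  have hmd : Measurable fun g => y g - trunc Q j y g := hy.sub (measurable_trunc j hy)
  rw [Function.comp_apply, e1, eLpNorm_one_eq_lintegral_enorm,
    ← integral_norm_eq_lintegral_enorm hmd.aestronglyMeasurable, hQ,
    h.integral_pastLaw i hmd.norm]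
  rfl

end Innovations

/-! ### A maximal inequality for finitely many dependent processes -/

section FiniteMaximal

variable {Ω : Type*} [MeasurableSpace Ω] {μ : Measure Ω} [IsProbabilityMeasure μ] {m : ℕ}
  {ε ε' : ℤ → Ω → Fin m → ℝ}

theorem IIDWithCopy.integral_trunc (h : IIDWithCopy μ ε ε') (i : ℤ) (q : ℕ)
    {y : Past m → ℝ} (hy : Measurable y) {M : ℝ} (hM : ∀ g, ‖y g‖ ≤ M) :
    ∫ ω, trunc (pastLaw μ ε') q y (innov ε i ω) ∂μ = ∫ g, y g ∂(pastLaw μ ε') := by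
  have := h.isProbabilityMeasure_pastLaw
  induction q with
  | zero => simp [trunc_zero]
  | succ q ih =>
    rw [← ih]
    have h0 := h.integral_mul_innovPart_eq_zero i q hy hM (φ := fun _ => 1) measurable_const
      (K := 1) (by simp)
    have hi : ∀ q, Integrable (fun ω => trunc (pastLaw μ ε') q y (innov ε i ω)) μ := fun q =>
      integrable_of_norm_le (K := M) ((measurable_trunc q hy).comp
        (measurable_innov h.meas i)).aestronglyMeasurable fun ω => norm_trunc_le q hM _
    simp only [one_mul, innovPart] at h0
    rw [integral_sub (hi _) (hi _)] at h0
    linarith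

/-- Innovation parts of the same lag at different times are orthogonal. -/
theorem IIDWithCopy.integral_innovPart_mul_innovPart (h : IIDWithCopy μ ε ε') {i i' : ℤ}
    (hi : i < i') (j : ℕ) {y y' : Past m → ℝ} (hy : Measurable y) (hy' : Measurable y') {M : ℝ}
    (hM : ∀ g, ‖y g‖ ≤ M) (hM' : ∀ g, ‖y' g‖ ≤ M) :
    ∫ ω, innovPart (pastLaw μ ε') j y' (innov ε i' ω)
      * innovPart (pastLaw μ ε') j y (innov ε i ω) ∂μ = 0 := by
  have := h.isProbabilityMeasure_pastLaw
  -- the later innovation part is a function of the innovations after time `i - j`, so `toNat` is only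
  -- applied to nonnegative numbers where it matters
  have e := h.integral_mul_innovPart_eq_zero i j hy hM
    (φ := fun x => innovPart (pastLaw μ ε') j y' (fun k => x (i' - k - (i - j + 1)).toNat))
    ((measurable_innovPart j hy').comp (by fun_prop)) (K := 2 * M)
    fun x => norm_innovPart_le j hM' _
  rw [← e]
  refine integral_congr_ae (Filter.Eventually.of_forall fun ω => ?_)
  simp only
  congr 1
  refine innovPart_congr _ _ fun k hk => ?_
  simp only [innov]
  congr 1
  omega

theorem IIDWithCopy.integral_sq_sum_innovPart (h : IIDWithCopy μ ε ε') (I : Finset ℕ) (j : ℕ)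
    {y : ℕ → Past m → ℝ} (hy : ∀ i, Measurable (y i)) {M : ℝ} (hM : ∀ i g, ‖y i g‖ ≤ M) :
    ∫ ω, (∑ i ∈ I, innovPart (pastLaw μ ε') j (y i) (innov ε i ω)) ^ 2 ∂μ
      = ∑ i ∈ I, ∫ ω, (innovPart (pastLaw μ ε') j (y i) (innov ε i ω)) ^ 2 ∂μ := by
  have := h.isProbabilityMeasure_pastLaw
  set U : ℕ → Ω → ℝ := fun i ω => innovPart (pastLaw μ ε') j (y i) (innov ε i ω) with hU
  have hUm : ∀ i, Measurable (U i) := fun i =>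
    (measurable_innovPart j (hy i)).comp (measurable_innov h.meas i)
  have hUb : ∀ i ω, ‖U i ω‖ ≤ 2 * M := fun i ω => norm_innovPart_le j (hM i) _
  have hint : ∀ i i', Integrable (fun ω => U i ω * U i' ω) μ := fun i i' =>
    integrable_of_norm_le (K := 2 * M * (2 * M)) ((hUm i).mul (hUm i')).aestronglyMeasurable
      fun ω => by
        rw [norm_mul]
        exact mul_le_mul (hUb _ _) (hUb _ _) (norm_nonneg _) ((norm_nonneg _).trans (hUb i ω))
  have horth : ∀ i i', i ≠ i' → ∫ ω, U i ω * U i' ω ∂μ = 0 := by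
    intro i i' hne
    rcases lt_or_gt_of_ne hne with hlt | hlt
    · have := h.integral_innovPart_mul_innovPart (i := i) (i' := i') (by exact_mod_cast hlt) j
        (hy i) (hy i') (hM i) (hM i')
      rw [← this]
      exact integral_congr_ae (Filter.Eventually.of_forall fun ω => mul_comm _ _)
    · exact h.integral_innovPart_mul_innovPart (i := i') (i' := i) (by exact_mod_cast hlt) j
        (hy i') (hy i) (hM i') (hM i)
  have e : ∀ ω, (∑ i ∈ I, U i ω) ^ 2 = ∑ i ∈ I, ∑ i' ∈ I, U i ω * U i' ω := fun ω => by
    rw [sq, Finset.sum_mul_sum]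
  have e2 : ∀ i ω, U i ω ^ 2 = U i ω * U i ω := fun i ω => sq _
  change ∫ ω, (∑ i ∈ I, U i ω) ^ 2 ∂μ = ∑ i ∈ I, ∫ ω, U i ω ^ 2 ∂μ
  simp only [e, e2]
  rw [integral_finsetSum _ fun i _ => integrable_finsetSum _ fun i' _ => hint i i']
  refine Finset.sum_congr rfl fun i hi => ?_
  rw [integral_finsetSum _ fun i' _ => hint i i']
  exact Finset.sum_eq_single_of_mem i hi fun i' _ hne => horth i i' hne.symm

theorem sum_Icc_one_eq_sum_range_sub {B : Type*} [AddCommMonoid B] (n : ℕ) (f : ℕ → B) :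
    ∑ i ∈ Finset.Icc 1 n, f i = ∑ r ∈ Finset.range n, f (n - r) := by
  refine (Finset.sum_nbij' (fun r => n - r) (fun i => n - i) ?_ ?_ ?_ ?_ ?_).symm
  · intro r hr; simp only [Finset.mem_range, Finset.mem_Icc] at hr ⊢; omega
  · intro r hr; simp only [Finset.mem_range, Finset.mem_Icc] at hr ⊢; omega
  · intro r hr; simp only [Finset.mem_range] at hr ⊢; omega
  · intro r hr; simp only [Finset.mem_Icc] at hr ⊢; omega
  · intro r _; rfl

variable {A : Type*} [Fintype A]

/-- The contribution of all innovation parts of a given lag: they are martingale differences when the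
time `i` runs backwards. -/
theorem IIDWithCopy.integral_norm_sum_innovPart_le (h : IIDWithCopy μ ε ε') (n j : ℕ)
    {y : ℕ → Past m → A → ℝ} (hy : ∀ i, Measurable (y i)) {M : ℝ} (hM : ∀ i g, ‖y i g‖ ≤ M)
    {H : ℝ} (hH : 1 ≤ H) (hA : Real.log (Fintype.card A) ≤ H) {V : ℝ} (hV : 0 ≤ V)
    (hsum : ∑ i ∈ Finset.Icc 1 n,
      ∫ ω, ‖innovPart (pastLaw μ ε') j (y i) (innov ε i ω)‖ ^ 2 ∂μ ≤ V ^ 2) :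
    ∫ ω, ‖∑ i ∈ Finset.Icc 1 n, innovPart (pastLaw μ ε') j (y i) (innov ε i ω)‖ ∂μ
      ≤ 6 * Real.sqrt H * V := by
  have := h.isProbabilityMeasure_pastLaw
  simp only [sum_Icc_one_eq_sum_range_sub] at hsum ⊢
  refine integral_norm_sum_le_of_weakMartingale n
    (fun r ω => innovPart (pastLaw μ ε') j (y (n - r)) (innov ε (n - r : ℕ) ω))
    (fun r => (measurable_innovPart j (hy _)).comp (measurable_innov h.meas _))
    (K := 2 * M) (fun r ω => norm_innovPart_le j (hM _) _) ?_ hH hA hV hsum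
  intro r hr g hg hg1 a
  -- the later innovation parts are functions of the innovations after time `n - r - j`
  have e := h.integral_mul_innovPart_eq_zero (n - r : ℕ) j (y := fun g => y (n - r) g a)
    ((measurable_pi_apply a).comp (hy _)) (M := M) (fun g => (norm_le_pi_norm _ a).trans (hM _ g))
    (φ := fun x => g (∑ r' ∈ Finset.range r, innovPart (pastLaw μ ε') j (y (n - r'))
      (fun k => x (((n - r' : ℕ) : ℤ) - k - (((n - r : ℕ) : ℤ) - j + 1)).toNat)))
    (hg.comp (Finset.measurable_fun_sum _ fun r' _ =>
      (measurable_innovPart j (hy _)).comp (by fun_prop))) (K := 1) (fun x => hg1 _)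
  rw [← e]
  refine integral_congr_ae (Filter.Eventually.of_forall fun ω => ?_)
  simp only
  rw [innovPart_apply j (hy _) (hM _)]
  congr 2
  refine Finset.sum_congr rfl fun r' hr' => innovPart_congr _ _ fun k hk => ?_
  have := Finset.mem_range.1 hr'
  simp only [innov]
  congr 1
  omega

omit [IsProbabilityMeasure μ] in
theorem IIDWithCopy.iIndepFun_innovations (h : IIDWithCopy μ ε ε') : iIndepFun ε μ :=
  h.indep.precomp (g := Sum.inl) Sum.inl_injective

omit [IsProbabilityMeasure μ] in
/-- Functions of the innovations before time `L` are independent of functions of the innovations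
from time `L` on. -/
theorem IIDWithCopy.indepFun_of_past_future (h : IIDWithCopy μ ε ε') (L : ℤ)
    {f f' : (ℤ → Fin m → ℝ) → ℝ} (hf : Measurable f) (hf' : Measurable f')
    (hfL : ∀ x x', (∀ l < L, x l = x' l) → f x = f x')
    (hfL' : ∀ x x', (∀ l, L ≤ l → x l = x' l) → f' x = f' x') :
    IndepFun (fun ω => f (fun l => ε l ω)) (fun ω => f' (fun l => ε l ω)) μ := by
  have hd : Disjoint (Set.Iio L) (Set.Ici L) := Set.disjoint_left.2 fun l h1 h2 =>
    not_lt.2 (Set.mem_Ici.1 h2) (Set.mem_Iio.1 h1)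
  have h0 := indepFun_restrict_of_disjoint h.meas h.iIndepFun_innovations hd
  classical
  have hext : ∀ S : Set ℤ, Measurable fun (x : S → Fin m → ℝ) (l : ℤ) =>
      if hl : l ∈ S then x ⟨l, hl⟩ else (0 : Fin m → ℝ) := fun S => by
    refine measurable_pi_iff.2 fun l => ?_
    by_cases hl : l ∈ S <;> simp only [hl, dite_true, dite_false] <;> fun_prop
  have := h0.comp (hf.comp (hext _)) (hf'.comp (hext _))
  convert this using 1
  · funext ω
    refine hfL _ _ fun l hl => ?_
    simp [hl]
  · funext ω
    refine hfL' _ _ fun l hl => ?_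
    simp [hl]

end FiniteMaximal

section FiniteMaximal

variable {Ω : Type*} [MeasurableSpace Ω] {μ : Measure Ω} [IsProbabilityMeasure μ] {m : ℕ}
  {ε ε' : ℤ → Ω → Fin m → ℝ} {A : Type*} [Fintype A]

omit [IsProbabilityMeasure μ] [Fintype A] [MeasurableSpace Ω] in
theorem sum_range_innovPart {G : Type*} [NormedAddCommGroup G] [NormedSpace ℝ G]
    (Q : Measure (Past m)) (q : ℕ) (y : Past m → G) (g : Past m) :
    ∑ j ∈ Finset.range q, innovPart Q j y g = trunc Q q y g - ∫ z, y z ∂Q := by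
  rw [← trunc_zero Q y g]
  exact Finset.sum_range_sub (fun j => trunc Q j y g) q

/-- The contribution of the innovation parts of lag less than `q` over every other block of
length `q`; these blocks are independent. -/
theorem IIDWithCopy.integral_norm_sum_blocks_le (h : IIDWithCopy μ ε ε') (n : ℕ) {q : ℕ}
    (hq : 1 ≤ q) (s : ℕ) {y : ℕ → Past m → A → ℝ} (hy : ∀ i, Measurable (y i)) {M : ℝ}
    (hM0 : 0 < M) (hM : ∀ i g, ‖y i g‖ ≤ M)
    {H : ℝ} (hH : 1 ≤ H) (hA : Real.log (Fintype.card A) ≤ H)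
    {C : A → ℕ → ℝ} (hC : ∀ a j, 0 < C a j)
    (hu : ∀ a, ∀ j < q, ∑ i ∈ Finset.Icc 1 n,
      ∫ ω, (innovPart (pastLaw μ ε') j (fun g => y i g a) (innov ε i ω)) ^ 2 ∂μ ≤ C a j ^ 2)
    {W : ℝ} (hW : 0 < W) (hCW : ∀ a, ∑ j ∈ Finset.range q, C a j ≤ W) :
    ∫ ω, ‖∑ c ∈ Finset.range (n + 1), ∑ i ∈ Finset.Icc 1 n with i / q = 2 * c + s,
        (trunc (pastLaw μ ε') q (y i) (innov ε i ω) - ∫ z, y i z ∂(pastLaw μ ε'))‖ ∂μ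
      ≤ 2 * H * (2 * q * M) + 3 * Real.sqrt H * W := by
  have := h.isProbabilityMeasure_pastLaw
  set Q := pastLaw μ ε' with hQ
  set I : ℕ → Finset ℕ := fun c => {i ∈ Finset.Icc 1 n | i / q = 2 * c + s} with hI
  have hya : ∀ i a, Measurable fun g => y i g a := fun i a => (measurable_pi_apply a).comp (hy i)
  have hMa : ∀ i a g, ‖y i g a‖ ≤ M := fun i a g => (norm_le_pi_norm (y i g) a).trans (hM i g)
  set f : A → ℕ → (ℤ → Fin m → ℝ) → ℝ := fun a c e => ∑ i ∈ I c,
    (trunc Q q (fun g => y i g a) (fun k => e (i - k)) - ∫ z, y i z a ∂Q) with hf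
  have hTf : ∀ c ω a, (∑ i ∈ I c, (trunc Q q (y i) (innov ε i ω) - ∫ z, y i z ∂Q)) a
      = f a c (fun l => ε l ω) := by
    intro c ω a
    rw [Finset.sum_apply]
    refine Finset.sum_congr rfl fun i _ => ?_
    rw [Pi.sub_apply, trunc_apply q (hy i) (hM i), eval_integral (fun a =>
      integrable_of_norm_le (hya i a).aestronglyMeasurable (hMa i a)) a]
    rfl
  have hfm : ∀ a c, Measurable (f a c) := fun a c => Finset.measurable_fun_sum _ fun i _ =>
    ((measurable_trunc q (hya i a)).comp (by fun_prop)).sub measurable_const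
  have hmem : ∀ c i, i ∈ I c → q * (2 * c + s) ≤ i ∧ i < q * (2 * c + s) + q := by
    intro c i hi
    have h1 := (Finset.mem_filter.1 hi).2
    have h2 := Nat.div_add_mod i q
    have h3 := Nat.mod_lt i (show q > 0 by omega)
    rw [h1] at h2
    omega
  have hTU : ∀ a c ω, f a c (fun l => ε l ω) = ∑ j ∈ Finset.range q, ∑ i ∈ I c,
      innovPart Q j (fun g => y i g a) (innov ε i ω) := by
    intro a c ω
    rw [Finset.sum_comm]
    refine Finset.sum_congr rfl fun i _ => ?_
    rw [sum_range_innovPart]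
    rfl
  refine integral_norm_sum_le_of_indep (n + 1)
    (fun c ω => ∑ i ∈ I c, (trunc Q q (y i) (innov ε i ω) - ∫ z, y i z ∂Q))
    (fun c => Finset.measurable_fun_sum _ fun i _ =>
      ((measurable_trunc q (hy i)).comp (measurable_innov h.meas i)).sub measurable_const)
    (K := 2 * q * M) (by positivity) ?_ ?_ ?_ hH hA hW ?_
  · intro c ω
    have hcard : (I c).card ≤ q := by
      have : I c ⊆ Finset.Ico (q * (2 * c + s)) (q * (2 * c + s) + q) := fun i hi =>
        Finset.mem_Ico.2 (hmem c i hi)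
      simpa using Finset.card_le_card this
    have hcardR : ((I c).card : ℝ) ≤ q := by exact_mod_cast hcard
    refine (norm_sum_le _ _).trans ((Finset.sum_le_sum (g := fun _ => 2 * M) fun i _ => ?_).trans ?_)
    · refine (norm_sub_le _ _).trans ?_
      have h1 := norm_trunc_le (Q := Q) q (hM i) (innov ε i ω)
      have h2 : ‖∫ z, y i z ∂Q‖ ≤ M := by
        simpa using norm_integral_le_of_norm_le_const (μ := Q)
          (Filter.Eventually.of_forall fun z => hM i z)
      linarith
    · rw [Finset.sum_const, nsmul_eq_mul]
      nlinarith
  · intro c a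
    simp only [hTf]
    simp only [hf]
    have hi : ∀ i, Integrable (fun ω => trunc Q q (fun g => y i g a) (innov ε i ω)) μ := fun i =>
      integrable_of_norm_le (K := M) ((measurable_trunc q (hya i a)).comp
        (measurable_innov h.meas i)).aestronglyMeasurable fun ω => norm_trunc_le q (hMa i a) _
    refine (integral_finsetSum _ fun i _ => (hi i).sub (integrable_const _)).trans ?_
    refine Finset.sum_eq_zero fun i _ => ?_
    refine (integral_sub (hi i) (integrable_const _)).trans ?_
    rw [hQ, h.integral_trunc i q (hya i a) (hMa i a)]
    simp
  · intro c a
    simp only [hTf]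
    refine h.indepFun_of_past_future ((q * (2 * c + s) : ℕ) - q)
      (f := fun e => ∑ c' ∈ Finset.range c, f a c' e) (f' := f a c)
      (Finset.measurable_fun_sum _ fun c' _ => hfm a c') (hfm a c) ?_ ?_
    · intro x x' hx
      refine Finset.sum_congr rfl fun c' hc' => Finset.sum_congr rfl fun i hi => ?_
      congr 1
      refine trunc_congr _ _ fun k _ => hx _ ?_
      have h1 := (hmem c' i hi).2
      have h2 : q * (2 * c' + s) + 2 * q ≤ q * (2 * c + s) := by
        have : 2 * c' + s + 2 ≤ 2 * c + s := by have := Finset.mem_range.1 hc'; omega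
        calc q * (2 * c' + s) + 2 * q = q * (2 * c' + s + 2) := by ring
          _ ≤ _ := Nat.mul_le_mul_left q this
      omega
    · intro x x' hx
      refine Finset.sum_congr rfl fun i hi => ?_
      congr 1
      refine trunc_congr _ _ fun k hk => hx _ ?_
      have h1 := (hmem c i hi).1
      omega
  · intro a
    simp only [hTf, hTU]
    set U : ℕ → ℕ → Ω → ℝ := fun j i ω => innovPart Q j (fun g => y i g a) (innov ε i ω) with hU
    set S := ∑ j ∈ Finset.range q, C a j with hS
    have hS0 : 0 ≤ S := Finset.sum_nonneg fun j _ => (hC a j).le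
    have hUm : ∀ j i, Measurable (U j i) := fun j i =>
      (measurable_innovPart j (hya i a)).comp (measurable_innov h.meas i)
    have hUb : ∀ j i ω, ‖U j i ω‖ ≤ 2 * M := fun j i ω => norm_innovPart_le j (hMa i a) _
    have hVi : ∀ j c, Integrable (fun ω => (∑ i ∈ I c, U j i ω) ^ 2) μ := fun j c =>
      integrable_of_norm_le (K := ((I c).card * (2 * M)) ^ 2)
        ((Finset.measurable_fun_sum _ fun i _ => hUm j i).pow_const 2).aestronglyMeasurable
        fun ω => by
          rw [norm_pow]
          refine pow_le_pow_left₀ (norm_nonneg _) ?_ 2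
          refine (norm_sum_le _ _).trans ((Finset.sum_le_sum fun i _ => hUb j i ω).trans ?_)
          simp
    -- a Cauchy-Schwarz inequality with weights adapted to the sizes of the innovation parts
    have hone : ∀ c, ∫ ω, (∑ j ∈ Finset.range q, ∑ i ∈ I c, U j i ω) ^ 2 ∂μ
        ≤ S * ∑ j ∈ Finset.range q, (∑ i ∈ I c, ∫ ω, U j i ω ^ 2 ∂μ) / C a j := by
      intro c
      have hpt : ∀ ω, (∑ j ∈ Finset.range q, ∑ i ∈ I c, U j i ω) ^ 2
          ≤ S * ∑ j ∈ Finset.range q, (∑ i ∈ I c, U j i ω) ^ 2 / C a j := fun ω =>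
        Finset.sum_sq_le_sum_mul_sum_of_sq_le_mul _ (fun j _ => (hC a j).le)
          (fun j _ => div_nonneg (sq_nonneg _) (hC a j).le)
          fun j _ => by rw [mul_div_cancel₀ _ (hC a j).ne']
      have hr : Integrable (fun ω => ∑ j ∈ Finset.range q, (∑ i ∈ I c, U j i ω) ^ 2 / C a j) μ :=
        integrable_finsetSum _ fun j _ => (hVi j c).div_const _
      calc _ ≤ ∫ ω, S * ∑ j ∈ Finset.range q, (∑ i ∈ I c, U j i ω) ^ 2 / C a j ∂μ :=
            integral_mono_of_nonneg (Filter.Eventually.of_forall fun ω => sq_nonneg _)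
              (hr.const_mul S) (Filter.Eventually.of_forall hpt)
        _ = _ := by
            rw [integral_const_mul, integral_finsetSum _ fun j _ => (hVi j c).div_const _]
            congr 1
            refine Finset.sum_congr rfl fun j _ => ?_
            rw [integral_div, ← h.integral_sq_sum_innovPart (I c) j (fun i => hya i a)
              (fun i => hMa i a)]
    have hdis : ∀ j, ∑ c ∈ Finset.range (n + 1), ∑ i ∈ I c, ∫ ω, U j i ω ^ 2 ∂μ
        ≤ ∑ i ∈ Finset.Icc 1 n, ∫ ω, U j i ω ^ 2 ∂μ := by
      intro j
      rw [← Finset.sum_biUnion]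
      · refine Finset.sum_le_sum_of_subset_of_nonneg ?_ fun i _ _ =>
          integral_nonneg fun ω => sq_nonneg _
        intro i hi
        obtain ⟨c, _, hc⟩ := Finset.mem_biUnion.1 hi
        exact (Finset.mem_filter.1 hc).1
      · intro c _ c' _ hne
        refine Finset.disjoint_left.2 fun i h1 h2 => hne ?_
        have h3 := (Finset.mem_filter.1 h1).2
        have h4 := (Finset.mem_filter.1 h2).2
        omega
    calc ∑ c ∈ Finset.range (n + 1), ∫ ω, (∑ j ∈ Finset.range q, ∑ i ∈ I c, U j i ω) ^ 2 ∂μ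
        ≤ ∑ c ∈ Finset.range (n + 1),
            S * ∑ j ∈ Finset.range q, (∑ i ∈ I c, ∫ ω, U j i ω ^ 2 ∂μ) / C a j :=
          Finset.sum_le_sum fun c _ => hone c
      _ = S * ∑ j ∈ Finset.range q,
            (∑ c ∈ Finset.range (n + 1), ∑ i ∈ I c, ∫ ω, U j i ω ^ 2 ∂μ) / C a j := by
          rw [← Finset.mul_sum, Finset.sum_comm]
          simp only [Finset.sum_div]
      _ ≤ S * ∑ j ∈ Finset.range q, C a j := by
          refine mul_le_mul_of_nonneg_left (Finset.sum_le_sum fun j hj => ?_) hS0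
          rw [div_le_iff₀ (hC a j), ← sq]
          exact (hdis j).trans (hu a j (Finset.mem_range.1 hj))
      _ ≤ W ^ 2 := by
          rw [← hS, ← sq]
          exact pow_le_pow_left₀ hS0 (hCW a) 2

/-- The maximal inequality for finitely many bounded processes. The innovation parts of lag less
than `q` are summed over blocks of length `q` and treated by a Bernstein type inequality, those of
larger lag are treated as martingale differences in reversed time. -/
theorem IIDWithCopy.integral_norm_sum_sub_le (h : IIDWithCopy μ ε ε') {n : ℕ} (hn : 1 ≤ n) {q : ℕ}
    (hq : 1 ≤ q) {y : ℕ → Past m → A → ℝ} (hy : ∀ i, Measurable (y i)) {M : ℝ}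
    (hM0 : 0 < M) (hM : ∀ i g, ‖y i g‖ ≤ M)
    {H : ℝ} (hH : 1 ≤ H) (hA : Real.log (Fintype.card A) ≤ H)
    {Δ : ℕ → ℝ} (hΔ0 : ∀ j, 0 ≤ Δ j) (hΔ : Summable Δ) {x : A → ℝ} (hx : ∀ a, 0 ≤ x a)
    {D₂ Dinf : ℝ} (hD₂ : 0 ≤ D₂) (hDinf : 0 ≤ Dinf)
    (h2 : ∀ a, ∑ i ∈ Finset.Icc 1 n, ∫ ω, (y i (innov ε i ω) a) ^ 2 ∂μ ≤ n * x a ^ 2)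
    (hd : ∀ a, ∀ j : ℕ, 1 ≤ j → ∑ i ∈ Finset.Icc 1 n, ∫ ω, (y i (innov ε i ω) a
      - y i (innovStar ε ε' i (i - j) ω) a) ^ 2 ∂μ ≤ n * (D₂ * Δ j) ^ 2)
    (hdinf : ∀ j : ℕ, 1 ≤ j → ∑ i ∈ Finset.Icc 1 n, ∫ ω, ‖y i (innov ε i ω)
      - y i (innovStar ε ε' i (i - j) ω)‖ ^ 2 ∂μ ≤ n * (Dinf * Δ j) ^ 2)
    {v : ℝ} (hv : 0 < v) (hxv : ∀ a, x a + ∑ j ∈ Finset.Ico 1 q, min (x a) (D₂ * Δ j) ≤ v) :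
    ∫ ω, ‖∑ i ∈ Finset.Icc 1 n, (y i (innov ε i ω) - ∫ ω', y i (innov ε i ω') ∂μ)‖ ∂μ
      ≤ 8 * H * q * M + Real.sqrt H * Real.sqrt n * (18 * v + 6 * Dinf * betaFun Δ q) := by
  have := h.isProbabilityMeasure_pastLaw
  set Q := pastLaw μ ε' with hQ
  have hn0 : (0 : ℝ) < n := by exact_mod_cast hn
  have hq0 : (0 : ℝ) < q := by exact_mod_cast hq
  have hsn : 0 < Real.sqrt n := Real.sqrt_pos.2 hn0
  have hnn : Real.sqrt n ^ 2 = n := Real.sq_sqrt hn0.le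
  have hya : ∀ i a, Measurable fun g => y i g a := fun i a => (measurable_pi_apply a).comp (hy i)
  have hMa : ∀ i a g, ‖y i g a‖ ≤ M := fun i a g => (norm_le_pi_norm (y i g) a).trans (hM i g)
  -- the lags less than `q`; the summand `v / q` below makes the weights positive
  set c : A → ℕ → ℝ := fun a j => if j = 0 then x a else min (x a) (D₂ * Δ j) with hc
  have hc0 : ∀ a j, 0 ≤ c a j := fun a j => by
    simp only [hc]
    split_ifs
    exacts [hx a, le_min (hx a) (mul_nonneg hD₂ (hΔ0 j))]
  have hblock : ∀ s : ℕ, ∫ ω, ‖∑ c ∈ Finset.range (n + 1),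
        ∑ i ∈ Finset.Icc 1 n with i / q = 2 * c + s,
          (trunc Q q (y i) (innov ε i ω) - ∫ z, y i z ∂Q)‖ ∂μ
      ≤ 2 * H * (2 * q * M) + 3 * Real.sqrt H * (Real.sqrt n * (3 * v)) := by
    intro s
    refine h.integral_norm_sum_blocks_le n hq s hy hM0 hM hH hA
      (C := fun a j => Real.sqrt n * (2 * c a j + v / q))
      (fun a j => mul_pos hsn (by have := hc0 a j; positivity)) ?_ (by positivity) ?_
    · intro a j _
      have hUU : ∑ i ∈ Finset.Icc 1 n,
          ∫ ω, (innovPart Q j (fun g => y i g a) (innov ε i ω)) ^ 2 ∂μ ≤ n * (2 * c a j) ^ 2 := by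
        have hA1 : ∑ i ∈ Finset.Icc 1 n,
            ∫ ω, (innovPart Q j (fun g => y i g a) (innov ε i ω)) ^ 2 ∂μ ≤ n * (2 * x a) ^ 2 := by
          have hti : ∀ (i : ℕ) (p : ℕ), Integrable
              (fun ω => (trunc Q p (fun g => y i g a) (innov ε i ω)) ^ 2) μ := fun i p =>
            integrable_of_norm_le (K := M ^ 2) (((measurable_trunc p (hya i a)).comp
              (measurable_innov h.meas i)).pow_const 2).aestronglyMeasurable fun ω => by
                rw [norm_pow]
                exact pow_le_pow_left₀ (norm_nonneg _) (norm_trunc_le p (hMa i a) _) 2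
          have hle : ∀ i : ℕ, ∫ ω, (innovPart Q j (fun g => y i g a) (innov ε i ω)) ^ 2 ∂μ
              ≤ 4 * ∫ ω, (y i (innov ε i ω) a) ^ 2 ∂μ := by
            intro i
            have e1 := h.integral_sq_norm_trunc_le i (j + 1) (hya i a) (hMa i a)
            have e2 := h.integral_sq_norm_trunc_le i j (hya i a) (hMa i a)
            simp only [Real.norm_eq_abs, sq_abs] at e1 e2
            calc _ ≤ ∫ ω, (2 * (trunc Q (j + 1) (fun g => y i g a) (innov ε i ω)) ^ 2
                    + 2 * (trunc Q j (fun g => y i g a) (innov ε i ω)) ^ 2) ∂μ := by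
                  refine integral_mono_of_nonneg (Filter.Eventually.of_forall fun ω => sq_nonneg _)
                    (((hti i _).const_mul 2).add ((hti i _).const_mul 2))
                    (Filter.Eventually.of_forall fun ω => ?_)
                  simp only [innovPart]
                  nlinarith [sq_nonneg (trunc Q (j + 1) (fun g => y i g a) (innov ε i ω)
                    + trunc Q j (fun g => y i g a) (innov ε i ω))]
              _ ≤ _ := by
                  rw [integral_add ((hti i _).const_mul 2) ((hti i _).const_mul 2),
                    integral_const_mul, integral_const_mul]
                  linarith
          calc _ ≤ ∑ i ∈ Finset.Icc 1 n, 4 * ∫ ω, (y i (innov ε i ω) a) ^ 2 ∂μ :=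
                Finset.sum_le_sum fun i _ => hle i
            _ ≤ _ := by rw [← Finset.mul_sum]; linarith [h2 a]
        rcases Nat.eq_zero_or_pos j with hj | hj
        · simpa [hc, hj] using hj ▸ hA1
        · have hA2 : ∑ i ∈ Finset.Icc 1 n,
              ∫ ω, (innovPart Q j (fun g => y i g a) (innov ε i ω)) ^ 2 ∂μ
              ≤ n * (D₂ * Δ j) ^ 2 := by
            refine (Finset.sum_le_sum fun i _ => ?_).trans (hd a j hj)
            have := h.integral_sq_norm_innovPart_le i j (hya i a) (hMa i a)
            simpa only [Real.norm_eq_abs, sq_abs] using this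
          have e0 : c a j = min (x a) (D₂ * Δ j) := by simp [hc, hj.ne']
          rw [e0]
          rcases le_total (x a) (D₂ * Δ j) with hm | hm
          · rw [min_eq_left hm]; exact hA1
          · rw [min_eq_right hm]
            refine hA2.trans (mul_le_mul_of_nonneg_left ?_ hn0.le)
            have := mul_nonneg hD₂ (hΔ0 j)
            nlinarith
      refine hUU.trans ?_
      rw [mul_pow (Real.sqrt n), hnn]
      refine mul_le_mul_of_nonneg_left (pow_le_pow_left₀ (by linarith [hc0 a j]) ?_ 2) hn0.le
      have : 0 < v / q := by positivity
      linarith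
    · intro a
      rw [← Finset.mul_sum]
      refine mul_le_mul_of_nonneg_left ?_ hsn.le
      rw [Finset.sum_add_distrib, ← Finset.mul_sum]
      have e1 : ∑ j ∈ Finset.range q, c a j ≤ v := by
        rw [Finset.range_eq_Ico, Finset.sum_eq_sum_Ico_succ_bot (by omega)]
        refine le_trans (le_of_eq ?_) (hxv a)
        simp only [hc, if_true]
        congr 1
        refine Finset.sum_congr rfl fun j hj => ?_
        rw [if_neg (by have := (Finset.mem_Ico.1 hj).1; omega)]
      have e2 : ∑ _j ∈ Finset.range q, v / q = v := by
        rw [Finset.sum_const, Finset.card_range, nsmul_eq_mul]; field_simp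
      linarith
  -- the larger lags
  have hlag : ∀ j ≥ 1, ∫ ω, ‖∑ i ∈ Finset.Icc 1 n, innovPart Q j (y i) (innov ε i ω)‖ ∂μ
      ≤ 6 * Real.sqrt H * (Real.sqrt n * (Dinf * Δ j)) := by
    intro j hj
    refine h.integral_norm_sum_innovPart_le n j hy hM hH hA
      (by have := hΔ0 j; positivity) ?_
    rw [mul_pow (Real.sqrt n), hnn]
    refine (Finset.sum_le_sum fun i _ => ?_).trans (hdinf j hj)
    exact h.integral_sq_norm_innovPart_le i j (hy i) (hM i)
  -- the remainder
  set R : ℕ → ℝ := fun J => ∑ i ∈ Finset.Icc 1 n,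
    ∑ a, ∫ ω, |y i (innov ε i ω) a - trunc Q J (fun g => y i g a) (innov ε i ω)| ∂μ with hR
  have hRlim : Filter.Tendsto R Filter.atTop (nhds 0) := by
    have : Filter.Tendsto R Filter.atTop (nhds (∑ _i ∈ Finset.Icc 1 n, ∑ _a : A, (0 : ℝ))) :=
      tendsto_finsetSum _ fun i _ => tendsto_finsetSum _ fun a _ =>
        h.tendsto_integral_abs_sub_trunc i (hya i a) (hMa i a)
    simpa using this
  have hmt : ∀ J i, Measurable fun ω => trunc Q J (y i) (innov ε (i : ℕ) ω) := fun J i =>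
    (measurable_trunc J (hy i)).comp (measurable_innov h.meas i)
  have hmy : ∀ i : ℕ, Measurable fun ω => y i (innov ε i ω) := fun i =>
    (hy i).comp (measurable_innov h.meas i)
  have hmu : ∀ j i, Measurable fun ω => innovPart Q j (y i) (innov ε (i : ℕ) ω) := fun j i =>
    (measurable_innovPart j (hy i)).comp (measurable_innov h.meas i)
  have hity : ∀ i : ℕ, Integrable (fun ω => y i (innov ε i ω)) μ := fun i =>
    integrable_of_norm_le (hmy i).aestronglyMeasurable fun ω => hM i _
  have hitt : ∀ J (i : ℕ), Integrable (fun ω => trunc Q J (y i) (innov ε i ω)) μ := fun J i =>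
    integrable_of_norm_le (hmt J i).aestronglyMeasurable fun ω => norm_trunc_le J (hM i) _
  have hitu : ∀ j (i : ℕ), Integrable (fun ω => innovPart Q j (y i) (innov ε i ω)) μ := fun j i =>
    (hitt _ _).sub (hitt _ _)
  have main : ∀ J ≥ q, ∫ ω, ‖∑ i ∈ Finset.Icc 1 n, (y i (innov ε i ω)
        - ∫ ω', y i (innov ε i ω') ∂μ)‖ ∂μ
      ≤ 8 * H * q * M + Real.sqrt H * Real.sqrt n * (18 * v + 6 * Dinf * betaFun Δ q) + R J := by
    intro J hJ
    set B : ℕ → Ω → A → ℝ := fun s ω => ∑ c ∈ Finset.range (n + 1),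
        ∑ i ∈ Finset.Icc 1 n with i / q = 2 * c + s,
          (trunc Q q (y i) (innov ε i ω) - ∫ z, y i z ∂Q) with hB
    have hdec : ∀ ω, ∑ i ∈ Finset.Icc 1 n, (y i (innov ε i ω) - ∫ ω', y i (innov ε i ω') ∂μ)
        = B 0 ω + B 1 ω
          + ∑ j ∈ Finset.Ico q J, ∑ i ∈ Finset.Icc 1 n, innovPart Q j (y i) (innov ε i ω)
          + ∑ i ∈ Finset.Icc 1 n, (y i (innov ε i ω) - trunc Q J (y i) (innov ε i ω)) := by
      intro ω
      have e1 : B 0 ω + B 1 ω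
          = ∑ i ∈ Finset.Icc 1 n, (trunc Q q (y i) (innov ε i ω) - ∫ z, y i z ∂Q) := by
        simp only [hB, Finset.sum_filter]
        rw [Finset.sum_comm, Finset.sum_comm (s := Finset.range (n + 1)), ← Finset.sum_add_distrib]
        refine Finset.sum_congr rfl fun i hi => ?_
        have hin : i / q ≤ n := (Nat.div_le_self i q).trans (Finset.mem_Icc.1 hi).2
        rcases Nat.even_or_odd' (i / q) with ⟨b, hb | hb⟩
        · rw [Finset.sum_eq_single_of_mem b (Finset.mem_range.2 (by omega))
              (fun c _ hc => if_neg (by omega)),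
            Finset.sum_eq_zero (s := Finset.range (n + 1)) fun c _ => if_neg (by omega),
            if_pos (by omega), add_zero]
        · rw [Finset.sum_eq_zero (s := Finset.range (n + 1)) fun c _ => if_neg (by omega),
            Finset.sum_eq_single_of_mem b (Finset.mem_range.2 (by omega))
              (fun c _ hc => if_neg (by omega)), if_pos (by omega), zero_add]
      rw [e1, Finset.sum_comm, ← Finset.sum_add_distrib, ← Finset.sum_add_distrib]
      refine Finset.sum_congr rfl fun i _ => ?_
      have e2 : ∑ j ∈ Finset.Ico q J, innovPart Q j (y i) (innov ε i ω)
          = trunc Q J (y i) (innov ε i ω) - trunc Q q (y i) (innov ε i ω) := by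
        rw [Finset.sum_Ico_eq_sub _ hJ, sum_range_innovPart, sum_range_innovPart]
        abel
      rw [e2, ← h.integral_pastLaw i (hy i)]
      abel
    have hBi : ∀ s, Integrable (B s) μ := fun s => integrable_finsetSum _ fun c _ =>
      integrable_finsetSum _ fun i _ => (hitt q i).sub (integrable_const _)
    have hUi : ∀ j, Integrable
        (fun ω => ∑ i ∈ Finset.Icc 1 n, innovPart Q j (y i) (innov ε i ω)) μ := fun j =>
      integrable_finsetSum _ fun i _ => hitu j i
    have hai : ∀ (i : ℕ) a, Integrable
        (fun ω => |y i (innov ε i ω) a - trunc Q J (fun g => y i g a) (innov ε i ω)|) μ := by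
      intro i a
      have e := ((hity i).sub (hitt J i)).eval a
      simp only [Pi.sub_apply, trunc_apply J (hy i) (hM i)] at e
      exact e.abs
    have hpt : ∀ ω, ‖∑ i ∈ Finset.Icc 1 n, (y i (innov ε i ω) - ∫ ω', y i (innov ε i ω') ∂μ)‖
        ≤ ‖B 0 ω‖ + ‖B 1 ω‖
          + ∑ j ∈ Finset.Ico q J, ‖∑ i ∈ Finset.Icc 1 n, innovPart Q j (y i) (innov ε i ω)‖
          + ∑ i ∈ Finset.Icc 1 n, ∑ a,
            |y i (innov ε i ω) a - trunc Q J (fun g => y i g a) (innov ε i ω)| := by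
      intro ω
      rw [hdec]
      refine (norm_add_le _ _).trans (add_le_add ((norm_add_le _ _).trans
        (add_le_add (norm_add_le _ _) (norm_sum_le _ _))) ((norm_sum_le _ _).trans
          (Finset.sum_le_sum fun i _ => ?_)))
      refine (pi_norm_le_iff_of_nonneg (Finset.sum_nonneg fun a _ => abs_nonneg _)).2 fun a => ?_
      rw [Pi.sub_apply, trunc_apply J (hy i) (hM i), Real.norm_eq_abs]
      exact Finset.single_le_sum (f := fun a => |y i (innov ε i ω) a
        - trunc Q J (fun g => y i g a) (innov ε i ω)|) (fun a _ => abs_nonneg _) (Finset.mem_univ a)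
    have i1 : Integrable (fun ω => ‖B 0 ω‖ + ‖B 1 ω‖) μ := (hBi 0).norm.add (hBi 1).norm
    have i2 : Integrable (fun ω => ∑ j ∈ Finset.Ico q J,
        ‖∑ i ∈ Finset.Icc 1 n, innovPart Q j (y i) (innov ε i ω)‖) μ :=
      integrable_finsetSum _ fun j _ => (hUi j).norm
    have i3 : Integrable (fun ω => ∑ i ∈ Finset.Icc 1 n, ∑ a,
        |y i (innov ε i ω) a - trunc Q J (fun g => y i g a) (innov ε i ω)|) μ :=
      integrable_finsetSum _ fun i _ => integrable_finsetSum _ fun a _ => hai i a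
    have i12 : Integrable (fun ω => ‖B 0 ω‖ + ‖B 1 ω‖ + ∑ j ∈ Finset.Ico q J,
        ‖∑ i ∈ Finset.Icc 1 n, innovPart Q j (y i) (innov ε i ω)‖) μ := i1.add i2
    refine (integral_mono_of_nonneg (Filter.Eventually.of_forall fun ω => norm_nonneg _)
      (i12.add i3) (Filter.Eventually.of_forall hpt)).trans ?_
    rw [integral_add' i12 i3, integral_add i1 i2, integral_add (hBi 0).norm (hBi 1).norm,
      integral_finsetSum _ fun j _ => (hUi j).norm,
      integral_finsetSum _ fun i _ => integrable_finsetSum _ fun a _ => hai i a]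
    simp only [integral_finsetSum _ fun a _ => hai _ a]
    have b0 := hblock 0
    have b1 := hblock 1
    have b2 : ∑ j ∈ Finset.Ico q J,
        ∫ ω, ‖∑ i ∈ Finset.Icc 1 n, innovPart Q j (y i) (innov ε i ω)‖ ∂μ
        ≤ 6 * Real.sqrt H * (Real.sqrt n * (Dinf * betaFun Δ q)) := by
      calc _ ≤ ∑ j ∈ Finset.Ico q J, 6 * Real.sqrt H * (Real.sqrt n * (Dinf * Δ j)) :=
            Finset.sum_le_sum fun j hj => hlag j (by have := (Finset.mem_Ico.1 hj).1; omega)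
        _ = 6 * Real.sqrt H * (Real.sqrt n * (Dinf * ∑ j ∈ Finset.Ico q J, Δ j)) := by
            simp only [Finset.mul_sum]
        _ ≤ _ := by
            gcongr
            rw [Finset.sum_Ico_eq_sum_range]
            have hs : Summable fun j => Δ (q + j) := by
              simpa only [add_comm q] using (summable_nat_add_iff q).2 hΔ
            exact hs.sum_le_tsum _ fun j _ => hΔ0 _
    have b3 : ∑ i ∈ Finset.Icc 1 n, ∑ a, ∫ ω, |y i (innov ε i ω) a
        - trunc Q J (fun g => y i g a) (innov ε i ω)| ∂μ = R J := rfl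
    rw [b3]
    linarith
  have hlim : Filter.Tendsto (fun J => 8 * H * q * M
      + Real.sqrt H * Real.sqrt n * (18 * v + 6 * Dinf * betaFun Δ q) + R J) Filter.atTop
      (nhds (8 * H * q * M
      + Real.sqrt H * Real.sqrt n * (18 * v + 6 * Dinf * betaFun Δ q) + 0)) :=
    tendsto_const_nhds.add hRlim
  rw [add_zero] at hlim
  exact ge_of_tendsto hlim (Filter.eventually_atTop.2 ⟨q, main⟩)

end FiniteMaximal

/-! ### Rate functions -/

section Rates

variable {Δ : ℕ → ℝ}

theorem betaFun_nonneg (hΔ0 : ∀ k, 0 ≤ Δ k) (q : ℕ) : 0 ≤ betaFun Δ q :=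
  tsum_nonneg fun _ => hΔ0 _

theorem summable_shift (hΔ : Summable Δ) (q : ℕ) : Summable fun j => Δ (q + j) := by
  simpa only [add_comm q] using (summable_nat_add_iff q).2 hΔ

theorem betaFun_anti (hΔ0 : ∀ k, 0 ≤ Δ k) (hΔ : Summable Δ) : Antitone (betaFun Δ) := by
  refine antitone_nat_of_succ_le fun q => ?_
  rw [betaFun, betaFun, (summable_shift hΔ q).tsum_eq_zero_add]
  have : ∀ j, Δ (q + 1 + j) = Δ (q + (j + 1)) := fun j => by congr 1; ring
  simp only [this]
  linarith [hΔ0 (q + 0)]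

theorem qStar_mem (hΔ0 : ∀ k, 0 ≤ Δ k) (hΔ : Summable Δ) {x : ℝ} (hx : 0 < x) :
    1 ≤ qStar Δ x ∧ betaFun Δ (qStar Δ x) ≤ qStar Δ x * x := by
  refine Nat.sInf_mem (s := {q : ℕ | 1 ≤ q ∧ betaFun Δ q ≤ q * x}) ?_
  obtain ⟨q, hq⟩ := exists_nat_ge (betaFun Δ 0 / x)
  refine ⟨q + 1, by omega, ((betaFun_anti hΔ0 hΔ) (Nat.zero_le _)).trans ?_⟩
  rw [div_le_iff₀ hx] at hq
  push_cast
  nlinarith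

theorem qStar_le {x : ℝ} {q : ℕ} (hq : 1 ≤ q) (h : betaFun Δ q ≤ q * x) : qStar Δ x ≤ q :=
  Nat.sInf_le ⟨hq, h⟩

theorem qStar_anti (hΔ0 : ∀ k, 0 ≤ Δ k) (hΔ : Summable Δ) {x y : ℝ} (hx : 0 < x) (hxy : x ≤ y) :
    qStar Δ y ≤ qStar Δ x := by
  obtain ⟨h1, h2⟩ := qStar_mem hΔ0 hΔ hx
  exact qStar_le h1 (h2.trans (by gcongr))

/-- The set whose maximum is `rFun Δ δ` is nonempty. -/
theorem exists_qStar_mul_le {Δ : ℕ → ℝ} {δ : ℝ} (hδ : 0 < δ) :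
    ∃ r : ℝ, 0 < r ∧ (qStar Δ r : ℝ) * r ≤ δ := by
  have hlim : Filter.Tendsto (betaFun Δ) Filter.atTop (nhds 0) := by
    have e : betaFun Δ = fun i => ∑' k, Δ (k + i) := by
      funext i
      exact tsum_congr fun k => by rw [add_comm]
    rw [e]
    exact tendsto_sum_nat_add Δ
  obtain ⟨q, hq1, hq⟩ := ((Filter.eventually_ge_atTop 1).and
    (hlim.eventually (ge_mem_nhds hδ))).exists
  have hq0 : (0 : ℝ) < q := by exact_mod_cast hq1
  refine ⟨δ / q, by positivity, ?_⟩
  have h1 : qStar Δ (δ / q) ≤ q := qStar_le hq1 (by rw [mul_div_cancel₀ _ hq0.ne']; exact hq)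
  have h2 : (qStar Δ (δ / q) : ℝ) ≤ q := by exact_mod_cast h1
  calc (qStar Δ (δ / q) : ℝ) * (δ / q) ≤ q * (δ / q) := by gcongr
    _ = δ := mul_div_cancel₀ _ hq0.ne'

theorem le_of_qStar_mul_le (hΔ0 : ∀ k, 0 ≤ Δ k) (hΔ : Summable Δ) {r δ : ℝ} (hr : 0 < r)
    (h : (qStar Δ r : ℝ) * r ≤ δ) : r ≤ δ := by
  have : (1 : ℝ) ≤ qStar Δ r := by exact_mod_cast (qStar_mem hΔ0 hΔ hr).1
  nlinarith

theorem le_rFun (hΔ0 : ∀ k, 0 ≤ Δ k) (hΔ : Summable Δ) {r δ : ℝ} (hr : 0 < r)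
    (h : (qStar Δ r : ℝ) * r ≤ δ) : r ≤ rFun Δ δ :=
  le_csSup ⟨δ, fun _ hs => le_of_qStar_mul_le hΔ0 hΔ hs.1 hs.2⟩ ⟨hr, h⟩

theorem rFun_pos (hΔ0 : ∀ k, 0 ≤ Δ k) (hΔ : Summable Δ) {δ : ℝ} (hδ : 0 < δ) : 0 < rFun Δ δ := by
  obtain ⟨r, hr, h⟩ := exists_qStar_mul_le hδ
  exact hr.trans_le (le_rFun hΔ0 hΔ hr h)

/-- The supremum in the definition of `rFun` is attained. -/
theorem qStar_rFun_mul_le (hΔ0 : ∀ k, 0 ≤ Δ k) (hΔ : Summable Δ) {δ : ℝ} (hδ : 0 < δ) :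
    (qStar Δ (rFun Δ δ) : ℝ) * rFun Δ δ ≤ δ := by
  have hpos := rFun_pos hΔ0 hΔ hδ
  have hq : (0 : ℝ) < qStar Δ (rFun Δ δ) := by exact_mod_cast (qStar_mem hΔ0 hΔ hpos).1
  rw [← le_div_iff₀' hq]
  refine csSup_le (exists_qStar_mul_le hδ) fun r hr => ?_
  rw [le_div_iff₀' hq]
  refine le_trans ?_ hr.2
  have h1 := qStar_anti hΔ0 hΔ hr.1 (le_rFun hΔ0 hΔ hr.1 hr.2)
  have h2 : (qStar Δ (rFun Δ δ) : ℝ) ≤ qStar Δ r := by exact_mod_cast h1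
  exact mul_le_mul_of_nonneg_right h2 hr.1.le

theorem two_mul_rFun_half_le (hΔ0 : ∀ k, 0 ≤ Δ k) (hΔ : Summable Δ) {δ : ℝ} (hδ : 0 < δ) :
    2 * rFun Δ (δ / 2) ≤ rFun Δ δ := by
  have hpos := rFun_pos hΔ0 hΔ (half_pos hδ)
  refine le_rFun hΔ0 hΔ (by linarith) ?_
  have h1 := qStar_rFun_mul_le hΔ0 hΔ (half_pos hδ)
  have h2 : (qStar Δ (2 * rFun Δ (δ / 2)) : ℝ) ≤ qStar Δ (rFun Δ (δ / 2)) := by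
    exact_mod_cast qStar_anti hΔ0 hΔ hpos (by linarith)
  nlinarith

theorem summable_min (hΔ0 : ∀ k, 0 ≤ Δ k) (hΔ : Summable Δ) {t : ℝ} (ht : 0 ≤ t) :
    Summable fun k => min t (Δ (k + 1)) :=
  ((summable_nat_add_iff 1).2 hΔ).of_nonneg_of_le (fun _ => le_min ht (hΔ0 _))
    fun _ => min_le_right _ _

/-- A bound `δ` for the norm `V` gives the bound `rFun Δ δ` for the underlying second moment norm
`t`; here `𝔻 = 1`. -/
theorem le_rFun_of_add_tsum_min_le (hanti : Antitone Δ) (hΔ0 : ∀ k, 0 ≤ Δ k) (hΔ : Summable Δ)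
    {t δ : ℝ} (hδ : 0 < δ) (ht : 0 ≤ t) (h : t + ∑' k : ℕ, min t (Δ (k + 1)) ≤ δ) :
    t ≤ rFun Δ δ := by
  rcases ht.eq_or_lt with rfl | ht0
  · exact (rFun_pos hΔ0 hΔ hδ).le
  refine le_rFun hΔ0 hΔ ht0 (le_trans ?_ h)
  have hsum := summable_min hΔ0 hΔ ht
  have hnn : ∀ k, 0 ≤ min t (Δ (k + 1)) := fun k => le_min ht (hΔ0 _)
  obtain ⟨q, hq⟩ : ∃ q, qStar Δ t = q + 1 :=
    ⟨qStar Δ t - 1, by have := (qStar_mem hΔ0 hΔ ht0).1; omega⟩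
  rw [hq]
  push_cast
  suffices hs : (q : ℝ) * t ≤ ∑' k : ℕ, min t (Δ (k + 1)) by linarith
  rcases Nat.eq_zero_or_pos q with rfl | hq0
  · simpa using tsum_nonneg hnn
  rcases le_or_gt t (Δ q) with hc | hc
  · -- the first `q` summands equal `t`
    have h1 := hsum.sum_le_tsum (Finset.range q) fun k _ => hnn k
    refine le_trans (le_of_eq ?_) h1
    rw [Finset.sum_congr rfl fun _ hk => min_eq_left (hc.trans (hanti
      (Finset.mem_range.1 hk)))]
    simp
  · -- the summands from index `q` on are those of `betaFun Δ q`
    have h1 : (q : ℝ) * t < betaFun Δ q := by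
      by_contra hcon
      have := qStar_le hq0 (not_lt.1 hcon)
      omega
    refine h1.le.trans ?_
    have h2 : betaFun Δ q = ∑' j : ℕ, min t (Δ (j + (q - 1) + 1)) := by
      unfold betaFun
      congr 1
      funext j
      rw [show j + (q - 1) + 1 = q + j by omega, min_eq_right]
      exact (hanti (by omega)).trans hc.le
    rw [h2, ← hsum.sum_add_tsum_nat_add (q - 1)]
    have := Finset.sum_nonneg (s := Finset.range (q - 1)) fun k _ => hnn k
    linarith

end Rates

/-! ### Truncation of real numbers -/

/-- Truncation of a real number to the interval `[-a, a]`. -/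
def clip (a x : ℝ) : ℝ := max (-a) (min a x)

theorem abs_clip_le {a : ℝ} (ha : 0 ≤ a) (x : ℝ) : |clip a x| ≤ a :=
  abs_le.2 ⟨le_max_left _ _, max_le (by linarith) (min_le_left _ _)⟩

theorem abs_clip_sub_clip_le (a x y : ℝ) : |clip a x - clip a y| ≤ |x - y| := by
  unfold clip
  calc |max (-a) (min a x) - max (-a) (min a y)| ≤ |min a x - min a y| := by
        rw [max_comm, max_comm (-a)]; exact abs_max_sub_max_le_abs _ _ _
    _ ≤ |x - y| := by
        rw [min_comm, min_comm a]
        simpa using abs_min_sub_min_le_max x a y a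

theorem clip_mono (a : ℝ) : Monotone (clip a) := fun _ _ h =>
  max_le_max le_rfl (min_le_min le_rfl h)

theorem clip_of_abs_le {a x : ℝ} (h : |x| ≤ a) : clip a x = x := by
  rw [abs_le] at h
  rw [clip, min_eq_right h.2, max_eq_right h.1]

theorem abs_clip_le_abs {a : ℝ} (ha : 0 ≤ a) (x : ℝ) : |clip a x| ≤ |x| := by
  have := abs_clip_sub_clip_le a x 0
  rwa [clip_of_abs_le (x := 0) (by simpa using ha), sub_zero, sub_zero] at this

theorem measurable_clip (a : ℝ) : Measurable (clip a) := by
  unfold clip; fun_prop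

/-- The part of `|x|` above level `a`. -/
def excess (a x : ℝ) : ℝ := max (|x| - a) 0

theorem abs_sub_clip_le {a : ℝ} (ha : 0 ≤ a) (x : ℝ) : |x - clip a x| ≤ excess a x := by
  unfold excess clip
  rcases le_total a x with h1 | h1
  · rw [min_eq_left h1, max_eq_right (by linarith), abs_of_nonneg (by linarith),
      abs_of_nonneg (by linarith)]
    exact le_max_left _ _
  · rw [min_eq_right h1]
    rcases le_total (-a) x with h2 | h2
    · rw [max_eq_right h2]; simp
    · rw [max_eq_left h2, abs_of_nonpos (by linarith), abs_of_nonpos (by linarith : x ≤ 0)]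
      exact le_trans (by linarith) (le_max_left _ _)

theorem excess_nonneg (a x : ℝ) : 0 ≤ excess a x := le_max_right _ _

theorem excess_le_abs {a : ℝ} (ha : 0 ≤ a) (x : ℝ) : excess a x ≤ |x| :=
  max_le (by linarith) (abs_nonneg _)

theorem abs_excess_sub_excess_le (a x y : ℝ) : |excess a x - excess a y| ≤ |x - y| := by
  unfold excess
  refine (abs_max_sub_max_le_abs _ _ _).trans ?_
  rw [sub_sub_sub_cancel_right]
  exact abs_abs_sub_abs_le _ _

theorem excess_le_sq_div {a : ℝ} (ha : 0 < a) (x : ℝ) : excess a x ≤ x ^ 2 / a := by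
  refine max_le ?_ (by positivity)
  rw [le_div_iff₀ ha, ← sq_abs]
  nlinarith [sq_nonneg (|x| - a)]

theorem excess_le_excess {a x y : ℝ} (h : |x| ≤ |y|) : excess a x ≤ excess a y :=
  max_le_max (by linarith) le_rfl

theorem measurable_excess (a : ℝ) : Measurable (excess a) := by
  unfold excess
  exact (measurable_norm.sub measurable_const).max measurable_const

/-- Truncation is additive up to an error which is bounded, and which vanishes unless one of the two
summands exceeds its truncation level. -/
theorem abs_clip_add_sub_le {a b : ℝ} (ha : 0 ≤ a) (hb : 0 ≤ b) (x y : ℝ) :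
    |clip (a + b) (x + y) - clip a x - clip b y| ≤ min (excess a x + excess b y) (2 * (a + b)) := by
  have h1 := abs_clip_le ha x
  have h2 := abs_clip_le hb y
  have h3 := abs_clip_le (add_nonneg ha hb) (x + y)
  refine le_min ?_ ?_
  · have e : clip a x + clip b y = clip (a + b) (clip a x + clip b y) :=
      (clip_of_abs_le ((abs_add_le _ _).trans (add_le_add h1 h2))).symm
    rw [sub_sub, e]
    refine (abs_clip_sub_clip_le _ _ _).trans ?_
    rw [show x + y - (clip a x + clip b y) = (x - clip a x) + (y - clip b y) by ring]
    exact (abs_add_le _ _).trans (add_le_add (abs_sub_clip_le ha x) (abs_sub_clip_le hb y))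
  · rw [abs_le] at h1 h2 h3 ⊢
    constructor <;> linarith

/-! ### The bound at one level of the chain -/

/-- The norm `V` as a function of the second moment norm `x = ‖f‖_{2,n}`. -/
noncomputable def vNorm (Δ : ℕ → ℝ) (DD x : ℝ) : ℝ := x + ∑' k : ℕ, min x (DD * Δ (k + 1))

/-- The truncation level `m(n, δ, k)` with `h = H(k)`. -/
noncomputable def truncLevel (Δ : ℕ → ℝ) (DD DDinf : ℝ) (n : ℕ) (δ h : ℝ) : ℝ :=
  rFun Δ (δ / DD) * DDinf * Real.sqrt n / Real.sqrt h

section VNorm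

variable {Δ : ℕ → ℝ} {DD : ℝ}

theorem summable_min_mul (hΔ0 : ∀ k, 0 ≤ Δ k) (hΔ : Summable Δ) (hDD : 0 ≤ DD) {x : ℝ}
    (hx : 0 ≤ x) : Summable fun k => min x (DD * Δ (k + 1)) :=
  summable_min (Δ := fun k => DD * Δ k) (fun k => mul_nonneg hDD (hΔ0 k)) (hΔ.mul_left DD) hx

theorem le_vNorm (hΔ0 : ∀ k, 0 ≤ Δ k) (hDD : 0 ≤ DD) {x : ℝ} (hx : 0 ≤ x) : x ≤ vNorm Δ DD x :=
  le_add_of_nonneg_right (tsum_nonneg fun _ => le_min hx (mul_nonneg hDD (hΔ0 _)))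

theorem vNorm_mul_le (hΔ0 : ∀ k, 0 ≤ Δ k) (hΔ : Summable Δ) (hDD : 0 ≤ DD) {x c : ℝ}
    (hx : 0 ≤ x) (hc : 1 ≤ c) : vNorm Δ DD (c * x) ≤ c * vNorm Δ DD x := by
  have hc0 : 0 ≤ c := by linarith
  rw [vNorm, vNorm, mul_add, ← tsum_mul_left]
  refine add_le_add le_rfl (Summable.tsum_le_tsum (fun k => ?_)
    (summable_min_mul hΔ0 hΔ hDD (by positivity)) ((summable_min_mul hΔ0 hΔ hDD hx).mul_left c))
  rw [mul_min_of_nonneg _ _ hc0]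
  exact min_le_min le_rfl (le_mul_of_one_le_left (mul_nonneg hDD (hΔ0 _)) hc)

theorem vNorm_add_le (hΔ0 : ∀ k, 0 ≤ Δ k) (hΔ : Summable Δ) (hDD : 0 ≤ DD) {x y : ℝ}
    (hx : 0 ≤ x) (hy : 0 ≤ y) : vNorm Δ DD (x + y) ≤ vNorm Δ DD x + vNorm Δ DD y := by
  have h1 := summable_min_mul hΔ0 hΔ hDD hx
  have h2 := summable_min_mul hΔ0 hΔ hDD hy
  have h3 : ∑' k : ℕ, min (x + y) (DD * Δ (k + 1))
      ≤ ∑' k : ℕ, min x (DD * Δ (k + 1)) + ∑' k : ℕ, min y (DD * Δ (k + 1)) := by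
    rw [← h1.tsum_add h2]
    refine Summable.tsum_le_tsum (fun k => ?_)
      (summable_min_mul hΔ0 hΔ hDD (add_nonneg hx hy)) (h1.add h2)
    have h0 : 0 ≤ DD * Δ (k + 1) := mul_nonneg hDD (hΔ0 _)
    rcases le_total x (DD * Δ (k + 1)) with h | h <;> rcases le_total y (DD * Δ (k + 1)) with h' | h'
    · rw [min_eq_left h, min_eq_left h']; exact min_le_left _ _
    · rw [min_eq_right h']; exact (min_le_right _ _).trans (le_add_of_nonneg_left (le_min hx h0))
    · rw [min_eq_right h]; exact (min_le_right _ _).trans (le_add_of_nonneg_right (le_min hy h0))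
    · rw [min_eq_right h]; exact (min_le_right _ _).trans (le_add_of_nonneg_right (le_min hy h0))
  unfold vNorm
  linarith

theorem le_mul_rFun_of_vNorm_le (hanti : Antitone Δ) (hΔ0 : ∀ k, 0 ≤ Δ k) (hΔ : Summable Δ)
    (hDD : 0 < DD) {x δ : ℝ} (hx : 0 ≤ x) (hδ : 0 < δ) (h : vNorm Δ DD x ≤ δ) :
    x ≤ DD * rFun Δ (δ / DD) := by
  have h1 : x / DD + ∑' k : ℕ, min (x / DD) (Δ (k + 1)) ≤ δ / DD := by
    rw [le_div_iff₀ hDD, add_mul, div_mul_cancel₀ _ hDD.ne', ← tsum_mul_right]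
    refine le_trans (le_of_eq ?_) h
    rw [vNorm]
    congr 1
    refine tsum_congr fun k => ?_
    rw [min_mul_of_nonneg _ _ hDD.le, div_mul_cancel₀ _ hDD.ne', mul_comm DD]
  have h2 := le_rFun_of_add_tsum_min_le hanti hΔ0 hΔ (by positivity) (by positivity) h1
  rwa [div_le_iff₀' hDD] at h2

variable {DDinf : ℝ} {n : ℕ}

theorem truncLevel_pos (hΔ0 : ∀ k, 0 ≤ Δ k) (hΔ : Summable Δ) (hDD : 0 < DD) (hDDinf : 0 < DDinf)
    (hn : 1 ≤ n) {δ h : ℝ} (hδ : 0 < δ) (hh : 1 ≤ h) : 0 < truncLevel Δ DD DDinf n δ h := by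
  have h1 := rFun_pos hΔ0 hΔ (δ := δ / DD) (by positivity)
  have h2 : (0 : ℝ) < n := by exact_mod_cast hn
  have h3 : 0 < h := by linarith
  unfold truncLevel
  positivity

theorem two_mul_truncLevel_half_le (hΔ0 : ∀ k, 0 ≤ Δ k) (hΔ : Summable Δ) (hDD : 0 < DD)
    (hDDinf : 0 < DDinf) {δ h h' : ℝ} (hδ : 0 < δ) (hh : 1 ≤ h) (hh' : h ≤ h') :
    2 * truncLevel Δ DD DDinf n (δ / 2) h' ≤ truncLevel Δ DD DDinf n δ h := by
  have h1 := two_mul_rFun_half_le hΔ0 hΔ (δ := δ / DD) (by positivity)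
  have h2 := rFun_pos hΔ0 hΔ (δ := δ / DD / 2) (by positivity)
  have h5 := rFun_pos hΔ0 hΔ (δ := δ / DD) (by positivity)
  have h3 : 0 < Real.sqrt h := Real.sqrt_pos.2 (by linarith)
  have h4 : Real.sqrt h ≤ Real.sqrt h' := Real.sqrt_le_sqrt hh'
  unfold truncLevel
  rw [div_right_comm δ 2 DD]
  calc 2 * (rFun Δ (δ / DD / 2) * DDinf * Real.sqrt n / Real.sqrt h')
      = (2 * rFun Δ (δ / DD / 2)) * DDinf * Real.sqrt n / Real.sqrt h' := by ring
    _ ≤ rFun Δ (δ / DD) * DDinf * Real.sqrt n / Real.sqrt h := by gcongr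

/-- The second moment bound which controls the parts above the truncation level. -/
theorem sq_div_truncLevel_le (hanti : Antitone Δ) (hΔ0 : ∀ k, 0 ≤ Δ k) (hΔ : Summable Δ)
    (hDD : 0 < DD) (hDDinf : 0 < DDinf) (hn : 1 ≤ n) {x δ h : ℝ} (hx : 0 ≤ x) (hδ : 0 < δ)
    (hh : 1 ≤ h) (hv : vNorm Δ DD x ≤ δ) :
    n * x ^ 2 / truncLevel Δ DD DDinf n δ h ≤ Real.sqrt n * (DD / DDinf) * (δ * Real.sqrt h) := by
  have hm := truncLevel_pos hΔ0 hΔ hDD hDDinf hn hδ hh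
  have h1 := le_mul_rFun_of_vNorm_le hanti hΔ0 hΔ hDD hx hδ hv
  have h2 : x ≤ δ := (le_vNorm hΔ0 hDD.le hx).trans hv
  have h3 : 0 < Real.sqrt h := Real.sqrt_pos.2 (by linarith)
  have hr := rFun_pos hΔ0 hΔ (δ := δ / DD) (by positivity)
  have hn0 : (0 : ℝ) ≤ n := Nat.cast_nonneg n
  rw [div_le_iff₀ hm]
  have e : Real.sqrt n * (DD / DDinf) * (δ * Real.sqrt h) * truncLevel Δ DD DDinf n δ h
      = (Real.sqrt n * Real.sqrt n) * (δ * (DD * rFun Δ (δ / DD))) := by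
    unfold truncLevel
    field_simp
  rw [e, Real.mul_self_sqrt hn0, sq]
  gcongr

end VNorm

section LevelBound

variable {Ω : Type*} [MeasurableSpace Ω] (μ : Measure Ω) {m : ℕ} (ε ε' : ℤ → Ω → Fin m → ℝ)
  (n : ℕ)

/-- The sum over `i = 1, …, n` of the centred variables `q_i(𝒢_i)`. -/
noncomputable def centredSum {G : Type*} [NormedAddCommGroup G] [NormedSpace ℝ G]
    (q : ℕ → Past m → G) (ω : Ω) : G :=
  ∑ i ∈ Finset.Icc 1 n, (q i (innov ε i ω) - ∫ ω', q i (innov ε i ω') ∂μ)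

/-- A class of processes `p_i(θ)(𝒢_i)`, bounded by `T`, whose dependence on the distant past is
controlled by `DD * Δ` individually and by `DDinf * Δ` uniformly in `θ`. -/
structure DependentClass {Θ : Type*} (Δ : ℕ → ℝ) (DD DDinf T : ℝ) (p : ℕ → Θ → Past m → ℝ) :
    Prop where
  meas : ∀ i θ, Measurable (p i θ)
  bound : ∀ i θ g, |p i θ g| ≤ T
  dep : ∀ θ, ∀ j : ℕ, 1 ≤ j → ∑ i ∈ Finset.Icc 1 n, ∫ ω, (p i θ (innov ε i ω)
    - p i θ (innovStar ε ε' i (i - j) ω)) ^ 2 ∂μ ≤ n * (DD * Δ j) ^ 2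
  dep_sup : ∀ j : ℕ, 1 ≤ j → ∑ i ∈ Finset.Icc 1 n, ∫⁻ ω, (⨆ θ, ‖p i θ (innov ε i ω)
    - p i θ (innovStar ε ε' i (i - j) ω)‖ₑ) ^ 2 ∂μ ≤ ENNReal.ofReal (n * (DDinf * Δ j) ^ 2)

variable {μ ε ε' n} [IsProbabilityMeasure μ]

/-- The maximal inequality for finitely many processes which are Lipschitz functions of at most four
members of a dependent class. The choice `q = q*(r(δ / 𝔻))` balances the contribution of the blocks,
which is of the order `q` times the truncation level, and that of the lags from `q` on, which is of
the order `β(q)`. -/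
theorem IIDWithCopy.integral_norm_centredSum_le (h : IIDWithCopy μ ε ε') (hn : 1 ≤ n)
    {Θ : Type*} {Δ : ℕ → ℝ} {DD DDinf T : ℝ} {p : ℕ → Θ → Past m → ℝ}
    (hp : DependentClass μ ε ε' n Δ DD DDinf T p) (hΔ0 : ∀ k, 0 ≤ Δ k) (hΔ : Summable Δ)
    (hDD : 0 < DD) (hDDinf : 0 < DDinf) {A : Type*} [Fintype A] {y : ℕ → Past m → A → ℝ}
    (hy : ∀ i, Measurable (y i)) {δ H : ℝ} (hδ : 0 < δ) (hH : 1 ≤ H)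
    (hA : Real.log (Fintype.card A) ≤ 2 * H)
    (hM : ∀ i g a, |y i g a| ≤ 2 * truncLevel Δ DD DDinf n δ H)
    (hLip : ∀ a, ∃ θ : Fin 4 → Θ, ∀ i g g', |y i g a - y i g' a|
      ≤ ∑ s, |p i (θ s) g - p i (θ s) g'|)
    (hx : ∀ a, ∃ x : ℝ, 0 ≤ x ∧ vNorm Δ DD x ≤ 4 * δ ∧
      ∑ i ∈ Finset.Icc 1 n, ∫ ω, (y i (innov ε i ω) a) ^ 2 ∂μ ≤ n * x ^ 2) :
    ∫ ω, ‖centredSum μ ε n y ω‖ ∂μ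
      ≤ 576 * (Real.sqrt n * (1 + DDinf / DD) * (δ * Real.sqrt H)) := by
  choose x hx0 hxv hx2 using hx
  have hMpos := truncLevel_pos hΔ0 hΔ hDD hDDinf hn hδ hH
  set r := rFun Δ (δ / DD) with hr
  have hr0 : 0 < r := rFun_pos hΔ0 hΔ (by positivity)
  obtain ⟨hq1, hqβ⟩ := qStar_mem hΔ0 hΔ hr0
  have hqr : (qStar Δ r : ℝ) * r ≤ δ / DD := qStar_rFun_mul_le hΔ0 hΔ (by positivity)
  set q := qStar Δ r with hq
  have hst : ∀ i l, Measurable (innovStar ε ε' i l) := measurable_innovStar h.meas h.meas'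
  have hsq : ∀ i θ (j : ℕ), Integrable (fun ω => (p i θ (innov ε (i : ℕ) ω)
      - p i θ (innovStar ε ε' (i : ℕ) (i - j) ω)) ^ 2) μ := fun i θ j =>
    integrable_of_norm_le (K := (2 * T) ^ 2) ((((hp.meas i θ).comp (measurable_innov h.meas i)).sub
      ((hp.meas i θ).comp (hst _ _))).pow_const 2).aestronglyMeasurable fun ω => by
        rw [norm_pow]
        refine pow_le_pow_left₀ (norm_nonneg _) ((norm_sub_le _ _).trans ?_) 2
        have h1 := hp.bound i θ (innov ε (i : ℕ) ω)
        have h2 := hp.bound i θ (innovStar ε ε' (i : ℕ) (i - j) ω)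
        rw [Real.norm_eq_abs, Real.norm_eq_abs]
        linarith
  have main := h.integral_norm_sum_sub_le hn hq1 hy (M := 2 * truncLevel Δ DD DDinf n δ H)
    (by positivity) (fun i g => (pi_norm_le_iff_of_nonneg (by positivity)).2 fun a => hM i g a)
    (H := 2 * H) (by linarith) hA hΔ0 hΔ (x := x) hx0 (D₂ := 4 * DD) (Dinf := 4 * DDinf)
    (by positivity) (by positivity) hx2 ?_ ?_ (v := 16 * δ) (by positivity) ?_
  · refine main.trans ?_
    have hsH : 0 < Real.sqrt H := Real.sqrt_pos.2 (by linarith)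
    have hHH : Real.sqrt H * Real.sqrt H = H := Real.mul_self_sqrt (by linarith)
    have hs2 : Real.sqrt (2 * H) ≤ 2 * Real.sqrt H := by
      rw [Real.sqrt_mul (by norm_num)]
      have : Real.sqrt 2 ≤ 2 := by
        rw [Real.sqrt_le_left (by norm_num)]; norm_num
      exact mul_le_mul_of_nonneg_right this hsH.le
    have t1 : 8 * (2 * H) * q * (2 * truncLevel Δ DD DDinf n δ H)
        ≤ 32 * (Real.sqrt n * (DDinf / DD) * (δ * Real.sqrt H)) := by
      have e1 : 8 * (2 * H) * q * (2 * truncLevel Δ DD DDinf n δ H)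
          = 32 * (Real.sqrt n * Real.sqrt H * DDinf * (q * r)) := by
        unfold truncLevel
        rw [← hr]
        nth_rewrite 1 [← hHH]
        field_simp
        norm_num
      have e2 : Real.sqrt n * (DDinf / DD) * (δ * Real.sqrt H)
          = Real.sqrt n * Real.sqrt H * DDinf * (δ / DD) := by ring
      rw [e1, e2]
      gcongr
    have t2 : Real.sqrt (2 * H) * Real.sqrt n
          * (18 * (16 * δ) + 6 * (4 * DDinf) * betaFun Δ q)
        ≤ 2 * Real.sqrt H * Real.sqrt n * (18 * (16 * δ) + 6 * (4 * DDinf) * (δ / DD)) := by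
      have := betaFun_nonneg hΔ0 q
      have h3 : betaFun Δ q ≤ δ / DD := hqβ.trans hqr
      gcongr
    have e3 : 2 * Real.sqrt H * Real.sqrt n * (18 * (16 * δ) + 6 * (4 * DDinf) * (δ / DD))
        = 576 * (Real.sqrt n * (δ * Real.sqrt H))
          + 48 * (Real.sqrt n * (DDinf / DD) * (δ * Real.sqrt H)) := by
      field_simp
      ring
    have t4 : 0 ≤ Real.sqrt n * (DDinf / DD) * (δ * Real.sqrt H) := by positivity
    have e5 : 576 * (Real.sqrt n * (1 + DDinf / DD) * (δ * Real.sqrt H))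
        = 576 * (Real.sqrt n * (δ * Real.sqrt H))
          + 576 * (Real.sqrt n * (DDinf / DD) * (δ * Real.sqrt H)) := by ring
    linarith
  · intro a j hj
    obtain ⟨θ, hθ⟩ := hLip a
    have hpt : ∀ i : ℕ, ∀ g g', (y i g a - y i g' a) ^ 2
        ≤ 4 * ∑ s, (p i (θ s) g - p i (θ s) g') ^ 2 := by
      intro i g g'
      rw [← sq_abs]
      refine (pow_le_pow_left₀ (abs_nonneg _) (hθ i g g') 2).trans ?_
      refine (sq_sum_le_card_mul_sum_sq).trans (le_of_eq ?_)
      simp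
    calc _ ≤ ∑ i ∈ Finset.Icc 1 n, ∫ ω, 4 * ∑ s, (p i (θ s) (innov ε i ω)
            - p i (θ s) (innovStar ε ε' i (i - j) ω)) ^ 2 ∂μ :=
          Finset.sum_le_sum fun i _ => integral_mono_of_nonneg
            (Filter.Eventually.of_forall fun ω => sq_nonneg _)
            ((integrable_finsetSum _ fun s _ => hsq i (θ s) j).const_mul 4)
            (Filter.Eventually.of_forall fun ω => hpt i _ _)
      _ = 4 * ∑ s, ∑ i ∈ Finset.Icc 1 n, ∫ ω, (p i (θ s) (innov ε i ω)
            - p i (θ s) (innovStar ε ε' i (i - j) ω)) ^ 2 ∂μ := by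
          rw [Finset.sum_comm, Finset.mul_sum]
          refine Finset.sum_congr rfl fun i _ => ?_
          rw [integral_const_mul, integral_finsetSum _ fun s _ => hsq i (θ s) j]
      _ ≤ 4 * ∑ _s : Fin 4, (n * (DD * Δ j) ^ 2 : ℝ) := by
          gcongr with s
          exact hp.dep (θ s) j hj
      _ = n * (4 * DD * Δ j) ^ 2 := by
          simp only [Finset.sum_const, Finset.card_univ, Fintype.card_fin, nsmul_eq_mul]
          push_cast; ring
  · intro j hj
    have hyd : ∀ i : ℕ, Measurable fun ω => ‖y i (innov ε i ω)
        - y i (innovStar ε ε' i (i - j) ω)‖ ^ 2 := fun i =>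
      (((hy i).comp (measurable_innov h.meas i)).sub ((hy i).comp (hst _ _))).norm.pow_const 2
    have hpt : ∀ i : ℕ, ∀ g g', ‖y i g - y i g'‖ₑ ≤ 4 * ⨆ θ, ‖p i θ g - p i θ g'‖ₑ := by
      intro i g g'
      have hle : ∀ a, ‖y i g a - y i g' a‖ₑ ≤ 4 * ⨆ θ, ‖p i θ g - p i θ g'‖ₑ := by
        intro a
        obtain ⟨θ, hθ⟩ := hLip a
        calc ‖y i g a - y i g' a‖ₑ ≤ ENNReal.ofReal (∑ s, |p i (θ s) g - p i (θ s) g'|) := by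
              rw [Real.enorm_eq_ofReal_abs]; exact ENNReal.ofReal_le_ofReal (hθ i g g')
          _ = ∑ s, ‖p i (θ s) g - p i (θ s) g'‖ₑ := by
              rw [ENNReal.ofReal_sum_of_nonneg fun _ _ => abs_nonneg _]
              simp only [Real.enorm_eq_ofReal_abs]
          _ ≤ ∑ _s : Fin 4, ⨆ θ, ‖p i θ g - p i θ g'‖ₑ :=
              Finset.sum_le_sum fun s _ => le_iSup (fun θ => ‖p i θ g - p i θ g'‖ₑ) (θ s)
          _ = _ := by simp
      rcases isEmpty_or_nonempty A with hA0 | hA0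
      · rw [Subsingleton.elim (y i g - y i g') 0, enorm_zero]; exact zero_le
      · obtain ⟨a, ha⟩ := Finite.exists_max (fun a => ‖(y i g - y i g') a‖)
        have : ‖y i g - y i g'‖ ≤ ‖(y i g - y i g') a‖ :=
          (pi_norm_le_iff_of_nonneg (norm_nonneg _)).2 ha
        exact (enorm_le_iff_norm_le.2 this).trans (hle a)
    have hone : ∀ i : ℕ, ENNReal.ofReal (∫ ω, ‖y i (innov ε i ω)
          - y i (innovStar ε ε' i (i - j) ω)‖ ^ 2 ∂μ)
        ≤ 16 * ∫⁻ ω, (⨆ θ, ‖p i θ (innov ε i ω) - p i θ (innovStar ε ε' i (i - j) ω)‖ₑ) ^ 2 ∂μ := by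
      intro i
      rw [ofReal_integral_eq_lintegral_ofReal]
      · rw [← lintegral_const_mul' _ _ (by norm_num)]
        refine lintegral_mono fun ω => ?_
        rw [ENNReal.ofReal_pow (norm_nonneg _), ofReal_norm]
        refine (pow_le_pow_left₀ zero_le (hpt i _ _) 2).trans (le_of_eq ?_)
        rw [mul_pow]; norm_num
      · refine integrable_of_norm_le (K := (4 * truncLevel Δ DD DDinf n δ H) ^ 2)
          (hyd i).aestronglyMeasurable fun ω => ?_
        rw [norm_pow, norm_norm]
        refine pow_le_pow_left₀ (norm_nonneg _) ?_ 2
        refine (pi_norm_le_iff_of_nonneg (by positivity)).2 fun a => (norm_sub_le _ _).trans ?_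
        have h1 := hM i (innov ε i ω) a
        have h2 := hM i (innovStar ε ε' i (i - j) ω) a
        rw [Real.norm_eq_abs, Real.norm_eq_abs]
        linarith
      · exact Filter.Eventually.of_forall fun ω => by positivity
    have hRHS : 0 ≤ n * (4 * DDinf * Δ j) ^ 2 := by positivity
    rw [← ENNReal.ofReal_le_ofReal_iff hRHS,
      ENNReal.ofReal_sum_of_nonneg fun i _ => integral_nonneg fun ω => by positivity]
    refine (Finset.sum_le_sum fun i _ => hone i).trans ?_
    rw [← Finset.mul_sum]
    refine (mul_le_mul_right (hp.dep_sup j hj) 16).trans (le_of_eq ?_)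
    rw [show (16 : ℝ≥0∞) = ENNReal.ofReal 16 by norm_num, ← ENNReal.ofReal_mul (by norm_num)]
    congr 1
    ring
  · intro a
    have hDΔ : ∀ j, 0 ≤ DD * Δ j := fun j => mul_nonneg hDD.le (hΔ0 j)
    have hs := summable_min_mul hΔ0 hΔ hDD.le (hx0 a)
    have h1 : ∑ j ∈ Finset.Ico 1 q, min (x a) (DD * Δ j) ≤ ∑' k : ℕ, min (x a) (DD * Δ (k + 1)) := by
      rw [Finset.sum_Ico_eq_sum_range]
      refine le_trans (le_of_eq ?_) (hs.sum_le_tsum (Finset.range (q - 1))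
        fun k _ => le_min (hx0 a) (hDΔ _))
      exact Finset.sum_congr rfl fun k _ => by rw [add_comm]
    have h2 : ∑ j ∈ Finset.Ico 1 q, min (x a) (4 * DD * Δ j)
        ≤ 4 * ∑ j ∈ Finset.Ico 1 q, min (x a) (DD * Δ j) := by
      rw [Finset.mul_sum]
      refine Finset.sum_le_sum fun j _ => ?_
      rw [mul_min_of_nonneg _ _ (by norm_num), mul_assoc]
      exact min_le_min (by linarith [hx0 a]) le_rfl
    have h3 := hxv a
    unfold vNorm at h3
    linarith [hx0 a]

end LevelBound

/-! ### Centred sums -/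

section CentredSum

variable {Ω : Type*} [MeasurableSpace Ω] {μ : Measure Ω} [IsProbabilityMeasure μ] {m : ℕ}
  {ε : ℤ → Ω → Fin m → ℝ} {n : ℕ}

theorem integrable_comp_innov (hε : ∀ i, Measurable (ε i)) (i : ℤ) {q : Past m → ℝ}
    (hq : Measurable q) {K : ℝ} (hK : ∀ g, |q g| ≤ K) :
    Integrable (fun ω => q (innov ε i ω)) μ :=
  integrable_of_norm_le (hq.comp (measurable_innov hε i)).aestronglyMeasurable fun _ => hK _

theorem integrable_centredSum (hε : ∀ i, Measurable (ε i)) {A : Type*} [Fintype A]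
    {y : ℕ → Past m → A → ℝ} (hy : ∀ i, Measurable (y i)) {K : ℝ} (hK0 : 0 ≤ K)
    (hK : ∀ i g a, |y i g a| ≤ K) :
    Integrable (centredSum μ ε n y) μ :=
  integrable_finsetSum _ fun i _ => (integrable_of_norm_le
    ((hy i).comp (measurable_innov hε i)).aestronglyMeasurable
      fun _ => (pi_norm_le_iff_of_nonneg hK0).2 (hK i _)).sub (integrable_const _)

theorem abs_centredSum_le_norm (hε : ∀ i, Measurable (ε i)) {A : Type*} [Fintype A]
    {y : ℕ → Past m → A → ℝ} (hy : ∀ i, Measurable (y i)) {K : ℝ} (hK : ∀ i g a, |y i g a| ≤ K)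
    (a : A) (ω : Ω) :
    |centredSum μ ε n (fun i g => y i g a) ω| ≤ ‖centredSum μ ε n y ω‖ := by
  have e : centredSum μ ε n (fun i g => y i g a) ω = centredSum μ ε n y ω a := by
    unfold centredSum
    rw [Finset.sum_apply]
    refine Finset.sum_congr rfl fun i _ => ?_
    have e0 : (∫ ω', y i (innov ε i ω') ∂μ) a = ∫ ω', y i (innov ε i ω') a ∂μ :=
      eval_integral (fun a => integrable_comp_innov (q := fun g => y i g a) hε i
        ((measurable_pi_apply a).comp (hy i)) fun g => hK i g a) a
    rw [Pi.sub_apply, e0]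
  rw [e]
  exact norm_le_pi_norm (centredSum μ ε n y ω) a

omit [IsProbabilityMeasure μ] in
theorem centredSum_add {q q' : ℕ → Past m → ℝ}
    (hq : ∀ i : ℕ, Integrable (fun ω => q i (innov ε i ω)) μ)
    (hq' : ∀ i : ℕ, Integrable (fun ω => q' i (innov ε i ω)) μ) (ω : Ω) :
    centredSum μ ε n (fun i g => q i g + q' i g) ω
      = centredSum μ ε n q ω + centredSum μ ε n q' ω := by
  unfold centredSum
  rw [← Finset.sum_add_distrib]
  refine Finset.sum_congr rfl fun i _ => ?_
  rw [integral_add (hq i) (hq' i)]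
  ring

omit [IsProbabilityMeasure μ] in
/-- A process dominated by another one has a centred sum dominated by that of the other one, up to
its mean. -/
theorem abs_centredSum_le_of_abs_le {q Y : ℕ → Past m → ℝ}
    (hY : ∀ i : ℕ, Integrable (fun ω => Y i (innov ε i ω)) μ)
    (hae : ∀ᵐ ω ∂μ, ∀ i ∈ Finset.Icc 1 n, |q i (innov ε i ω)| ≤ Y i (innov ε i ω)) {ω : Ω}
    (hω : ∀ i ∈ Finset.Icc 1 n, |q i (innov ε i ω)| ≤ Y i (innov ε i ω)) :
    |centredSum μ ε n q ω| ≤ |centredSum μ ε n Y ω|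
      + 2 * ∑ i ∈ Finset.Icc 1 n, ∫ ω', Y i (innov ε i ω') ∂μ := by
  have h1 : |centredSum μ ε n q ω| ≤ ∑ i ∈ Finset.Icc 1 n,
      (Y i (innov ε i ω) + ∫ ω', Y i (innov ε i ω') ∂μ) := by
    refine (Finset.abs_sum_le_sum_abs _ _).trans (Finset.sum_le_sum fun i hi => ?_)
    refine (abs_sub _ _).trans (add_le_add (hω i hi) ?_)
    refine (abs_integral_le_integral_abs).trans ?_
    refine integral_mono_of_nonneg (Filter.Eventually.of_forall fun _ => abs_nonneg _) (hY i) ?_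
    filter_upwards [hae] with ω' h using h i hi
  have h2 : ∑ i ∈ Finset.Icc 1 n, (Y i (innov ε i ω) + ∫ ω', Y i (innov ε i ω') ∂μ)
      = centredSum μ ε n Y ω + 2 * ∑ i ∈ Finset.Icc 1 n, ∫ ω', Y i (innov ε i ω') ∂μ := by
    unfold centredSum
    rw [Finset.sum_add_distrib, Finset.sum_sub_distrib]
    ring
  linarith [le_abs_self (centredSum μ ε n Y ω)]

end CentredSum

/-! ### Chaining along brackets -/

section Chaining

variable {Ω : Type*} [MeasurableSpace Ω] {μ : Measure Ω} [IsProbabilityMeasure μ] {m : ℕ}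
  {ε ε' : ℤ → Ω → Fin m → ℝ} {n : ℕ} {Θ : Type*} [Preorder Θ] {Δ : ℕ → ℝ} {DD DDinf T : ℝ}
  {p : ℕ → Θ → Past m → ℝ}

open Classical in
/-- The pairs of a bracket in `B` and a bracket in `B'` which have a common element. -/
noncomputable def meetingPairs (B B' : Finset (Θ × Θ)) : Finset ((Θ × Θ) × (Θ × Θ)) :=
  (B ×ˢ B').filter fun b => ∃ θ, (b.1.1 ≤ θ ∧ θ ≤ b.1.2) ∧ (b.2.1 ≤ θ ∧ θ ≤ b.2.2)

theorem log_card_meetingPairs_le {B B' : Finset (Θ × Θ)} {H : ℝ} (hH : 0 ≤ H)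
    (hB : Real.log B.card ≤ H) (hB' : Real.log B'.card ≤ H) :
    Real.log (Fintype.card (meetingPairs B B')) ≤ 2 * H := by
  rw [Fintype.card_coe]
  have h1 : (meetingPairs B B').card ≤ B.card * B'.card := by
    classical
    rw [← Finset.card_product]
    exact Finset.card_filter_le _ _
  rcases Nat.eq_zero_or_pos (meetingPairs B B').card with h0 | h0
  · rw [h0]; simp; linarith
  have h2 : ((meetingPairs B B').card : ℝ) ≤ B.card * B'.card := by exact_mod_cast h1
  have h3 : 0 < B.card * B'.card := h0.trans_le h1
  have h4 : (B.card : ℝ) ≠ 0 := by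
    have := Nat.pos_of_mul_pos_right h3
    positivity
  have h5 : (B'.card : ℝ) ≠ 0 := by
    have := Nat.pos_of_mul_pos_left h3
    positivity
  calc Real.log (meetingPairs B B').card ≤ Real.log (B.card * B'.card) :=
        Real.log_le_log (by exact_mod_cast h0) h2
    _ ≤ 2 * H := by rw [Real.log_mul h4 h5]; linarith

/-- One link of the chain: the truncated differences of the lower ends of two brackets. -/
def link (p : ℕ → Θ → Past m → ℝ) (c : ℝ) {S : Finset ((Θ × Θ) × (Θ × Θ))} (i : ℕ) (g : Past m)
    (b : S) : ℝ :=
  clip c (p i b.1.2.1 g - p i b.1.1.1 g)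

/-- The bound for the error which truncation causes in one link of the chain. -/
def linkErr (p : ℕ → Θ → Past m → ℝ) (a c : ℝ) {S : Finset ((Θ × Θ) × (Θ × Θ))} (i : ℕ)
    (g : Past m) (b : S) : ℝ :=
  min (excess a (p i b.1.2.2 g - p i b.1.2.1 g) + excess c (p i b.1.2.1 g - p i b.1.1.1 g))
    (2 * (a + c))

/-- The truncated sizes of the brackets at the end of the chain. -/
def width (p : ℕ → Θ → Past m → ℝ) (a : ℝ) {S : Finset (Θ × Θ)} (i : ℕ) (g : Past m) (b : S) : ℝ :=
  clip a (p i b.1.2 g - p i b.1.1 g)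

omit [Preorder Θ] in
theorem abs_linkErr_le {a c : ℝ} (ha : 0 ≤ a) (hc : 0 ≤ c) {S : Finset ((Θ × Θ) × (Θ × Θ))}
    (i : ℕ) (g : Past m) (b : S) : |linkErr p a c i g b| ≤ 2 * (a + c) := by
  rw [linkErr, abs_of_nonneg]
  · exact min_le_right _ _
  · exact le_min (add_nonneg (excess_nonneg _ _) (excess_nonneg _ _)) (by linarith)

variable (hp : DependentClass μ ε ε' n Δ DD DDinf T p)

include hp

omit [IsProbabilityMeasure μ] [Preorder Θ] in
theorem measurable_link (c : ℝ) (S : Finset ((Θ × Θ) × (Θ × Θ))) (i : ℕ) :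
    Measurable (link p c (S := S) i) :=
  measurable_pi_iff.2 fun _ => (measurable_clip c).comp ((hp.meas _ _).sub (hp.meas _ _))

omit [IsProbabilityMeasure μ] [Preorder Θ] in
theorem measurable_linkErr (a c : ℝ) (S : Finset ((Θ × Θ) × (Θ × Θ))) (i : ℕ) :
    Measurable (linkErr p a c (S := S) i) :=
  measurable_pi_iff.2 fun _ => (((measurable_excess a).comp ((hp.meas _ _).sub (hp.meas _ _))).add
    ((measurable_excess c).comp ((hp.meas _ _).sub (hp.meas _ _)))).min measurable_const

omit [IsProbabilityMeasure μ] [Preorder Θ] in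
theorem measurable_width (a : ℝ) (S : Finset (Θ × Θ)) (i : ℕ) :
    Measurable (width p a (S := S) i) :=
  measurable_pi_iff.2 fun _ => (measurable_clip a).comp ((hp.meas _ _).sub (hp.meas _ _))

omit [Preorder Θ] in
theorem integrable_sq_sub (h : IIDWithCopy μ ε ε') (i : ℕ) (θ θ' : Θ) :
    Integrable (fun ω => (p i θ (innov ε i ω) - p i θ' (innov ε i ω)) ^ 2) μ :=
  integrable_comp_innov (q := fun g => (p i θ g - p i θ' g) ^ 2) (K := (2 * T) ^ 2) h.meas i
    (((hp.meas i θ).sub (hp.meas i θ')).pow_const 2) fun g => by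
      rw [abs_pow]
      refine pow_le_pow_left₀ (abs_nonneg _) ((abs_sub _ _).trans ?_) 2
      linarith [hp.bound i θ g, hp.bound i θ' g]

omit hp in
/-- The difference of the lower ends of two brackets with a common element is at most the sum of the
sizes of the brackets. -/
theorem abs_sub_le_of_meeting {f : Θ → ℝ} (hf : Monotone f) {b : (Θ × Θ) × (Θ × Θ)}
    {B B' : Finset (Θ × Θ)} (hb : b ∈ meetingPairs B B') :
    |f b.2.1 - f b.1.1| ≤ (f b.1.2 - f b.1.1) + (f b.2.2 - f b.2.1) := by
  classical
  obtain ⟨θ, ⟨h1, h2⟩, h3, h4⟩ := (Finset.mem_filter.1 hb).2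
  have := hf h1
  have := hf h2
  have := hf h3
  have := hf h4
  rw [abs_le]
  constructor <;> linarith

theorem sum_integral_sq_le (h : IIDWithCopy μ ε ε')
    (hmono : ∀ᵐ ω ∂μ, ∀ i ∈ Finset.Icc 1 n, Monotone fun θ => p i θ (innov ε i ω))
    {B B' : Finset (Θ × Θ)} {b : (Θ × Θ) × (Θ × Θ)} (hb : b ∈ meetingPairs B B') {x x' : ℝ}
    (hx : ∑ i ∈ Finset.Icc 1 n, ∫ ω, (p i b.1.2 (innov ε i ω) - p i b.1.1 (innov ε i ω)) ^ 2 ∂μ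
      ≤ n * x ^ 2)
    (hx' : ∑ i ∈ Finset.Icc 1 n, ∫ ω, (p i b.2.2 (innov ε i ω) - p i b.2.1 (innov ε i ω)) ^ 2 ∂μ
      ≤ n * x' ^ 2) :
    ∑ i ∈ Finset.Icc 1 n, ∫ ω, (p i b.2.1 (innov ε i ω) - p i b.1.1 (innov ε i ω)) ^ 2 ∂μ
      ≤ n * (2 * x ^ 2 + 2 * x' ^ 2) := by
  calc _ ≤ ∑ i ∈ Finset.Icc 1 n, ∫ ω, (2 * (p i b.1.2 (innov ε i ω) - p i b.1.1 (innov ε i ω)) ^ 2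
          + 2 * (p i b.2.2 (innov ε i ω) - p i b.2.1 (innov ε i ω)) ^ 2) ∂μ := by
        refine Finset.sum_le_sum fun i hi => integral_mono_of_nonneg
          (Filter.Eventually.of_forall fun ω => sq_nonneg _)
          (((integrable_sq_sub hp h i _ _).const_mul 2).add
            ((integrable_sq_sub hp h i _ _).const_mul 2)) ?_
        filter_upwards [hmono] with ω hω
        have h1 := abs_sub_le_of_meeting (hω i hi) hb
        rw [← sq_abs]
        refine (pow_le_pow_left₀ (abs_nonneg _) h1 2).trans ?_
        nlinarith [sq_nonneg ((p i b.1.2 (innov ε i ω) - p i b.1.1 (innov ε i ω))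
          - (p i b.2.2 (innov ε i ω) - p i b.2.1 (innov ε i ω)))]
    _ = 2 * ∑ i ∈ Finset.Icc 1 n,
            ∫ ω, (p i b.1.2 (innov ε i ω) - p i b.1.1 (innov ε i ω)) ^ 2 ∂μ
          + 2 * ∑ i ∈ Finset.Icc 1 n,
            ∫ ω, (p i b.2.2 (innov ε i ω) - p i b.2.1 (innov ε i ω)) ^ 2 ∂μ := by
        rw [Finset.mul_sum, Finset.mul_sum, ← Finset.sum_add_distrib]
        refine Finset.sum_congr rfl fun i _ => ?_
        rw [integral_add ((integrable_sq_sub hp h i _ _).const_mul 2)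
          ((integrable_sq_sub hp h i _ _).const_mul 2), integral_const_mul, integral_const_mul]
    _ ≤ _ := by linarith

/-- The means of the errors caused by truncation. -/
theorem sum_integral_linkErr_le (h : IIDWithCopy μ ε ε')
    (hmono : ∀ᵐ ω ∂μ, ∀ i ∈ Finset.Icc 1 n, Monotone fun θ => p i θ (innov ε i ω))
    {B B' : Finset (Θ × Θ)} (b : meetingPairs B B') {x x' : ℝ}
    (hx : ∑ i ∈ Finset.Icc 1 n,
      ∫ ω, (p i b.1.1.2 (innov ε i ω) - p i b.1.1.1 (innov ε i ω)) ^ 2 ∂μ ≤ n * x ^ 2)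
    (hx' : ∑ i ∈ Finset.Icc 1 n,
      ∫ ω, (p i b.1.2.2 (innov ε i ω) - p i b.1.2.1 (innov ε i ω)) ^ 2 ∂μ ≤ n * x' ^ 2)
    {a c : ℝ} (ha : 0 < a) (hc : 0 < c) :
    ∑ i ∈ Finset.Icc 1 n, ∫ ω, linkErr p a c i (innov ε i ω) b ∂μ
      ≤ n * x' ^ 2 / a + n * (2 * x ^ 2 + 2 * x' ^ 2) / c := by
  have h1 := sum_integral_sq_le hp h hmono b.2 hx hx'
  calc _ ≤ ∑ i ∈ Finset.Icc 1 n,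
          ∫ ω, ((p i b.1.2.2 (innov ε i ω) - p i b.1.2.1 (innov ε i ω)) ^ 2 / a
            + (p i b.1.2.1 (innov ε i ω) - p i b.1.1.1 (innov ε i ω)) ^ 2 / c) ∂μ := by
        refine Finset.sum_le_sum fun i _ => integral_mono_of_nonneg
          (Filter.Eventually.of_forall fun ω => ?_)
          (((integrable_sq_sub hp h i _ _).div_const a).add
            ((integrable_sq_sub hp h i _ _).div_const c))
          (Filter.Eventually.of_forall fun ω => ?_)
        · exact le_min (add_nonneg (excess_nonneg _ _) (excess_nonneg _ _)) (by positivity)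
        · exact (min_le_left _ _).trans (add_le_add (excess_le_sq_div ha _) (excess_le_sq_div hc _))
    _ = (∑ i ∈ Finset.Icc 1 n,
            ∫ ω, (p i b.1.2.2 (innov ε i ω) - p i b.1.2.1 (innov ε i ω)) ^ 2 ∂μ) / a
          + (∑ i ∈ Finset.Icc 1 n,
            ∫ ω, (p i b.1.2.1 (innov ε i ω) - p i b.1.1.1 (innov ε i ω)) ^ 2 ∂μ) / c := by
        rw [Finset.sum_div, Finset.sum_div, ← Finset.sum_add_distrib]
        refine Finset.sum_congr rfl fun i _ => ?_
        rw [integral_add ((integrable_sq_sub hp h i _ _).div_const a)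
          ((integrable_sq_sub hp h i _ _).div_const c), integral_div, integral_div]
    _ ≤ _ := by gcongr

omit [Preorder Θ] in
theorem sum_integral_abs_sub_le (h : IIDWithCopy μ ε ε') {θ θ' : Θ} {x : ℝ} (hx0 : 0 ≤ x)
    (hx : ∑ i ∈ Finset.Icc 1 n, ∫ ω, (p i θ' (innov ε i ω) - p i θ (innov ε i ω)) ^ 2 ∂μ
      ≤ n * x ^ 2) :
    ∑ i ∈ Finset.Icc 1 n, ∫ ω, |p i θ' (innov ε i ω) - p i θ (innov ε i ω)| ∂μ ≤ n * x := by
  refine (pow_le_pow_iff_left₀ (Finset.sum_nonneg fun i _ => integral_nonneg fun ω => abs_nonneg _)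
    (by positivity) two_ne_zero).1 ?_
  calc _ ≤ ((Finset.Icc 1 n).card : ℝ) * ∑ i ∈ Finset.Icc 1 n,
          (∫ ω, |p i θ' (innov ε i ω) - p i θ (innov ε i ω)| ∂μ) ^ 2 := sq_sum_le_card_mul_sum_sq
    _ ≤ n * ∑ i ∈ Finset.Icc 1 n,
          ∫ ω, (p i θ' (innov ε i ω) - p i θ (innov ε i ω)) ^ 2 ∂μ := by
        rw [Nat.card_Icc, Nat.add_sub_cancel]
        gcongr with i
        have := sq_norm_integral_le (Q := μ) (K := 2 * T)
          (u := fun ω => |p i θ' (innov ε i ω) - p i θ (innov ε i ω)|)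
          (measurable_norm.comp (((hp.meas i θ').sub (hp.meas i θ)).comp
            (measurable_innov h.meas i))) fun ω => by
            rw [Real.norm_eq_abs, abs_abs]
            refine (abs_sub _ _).trans ?_
            linarith [hp.bound i θ (innov ε i ω), hp.bound i θ' (innov ε i ω)]
        simpa only [Real.norm_eq_abs, sq_abs, abs_abs] using this
    _ ≤ n * (n * x ^ 2) := by gcongr
    _ = (n * x) ^ 2 := by ring

end Chaining

section Chaining

variable {Ω : Type*} [MeasurableSpace Ω] {μ : Measure Ω} [IsProbabilityMeasure μ] {m : ℕ}
  {ε ε' : ℤ → Ω → Fin m → ℝ} {n : ℕ} {Θ : Type*} [Preorder Θ] {Δ : ℕ → ℝ} {DD DDinf T : ℝ}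
  {p : ℕ → Θ → Past m → ℝ}

/-- The pointwise form of one step of the chaining argument: passing from the bracket `b.1` to the
bracket `b.2` and to a smaller truncation level costs one link and an error bounded by `linkErr`. -/
theorem abs_clip_sub_link_le {a c : ℝ} (ha : 0 ≤ a) (hc : 0 ≤ c) {i : ℕ} {g : Past m}
    (hg : Monotone fun θ => p i θ g) {S : Finset ((Θ × Θ) × (Θ × Θ))} (b : S) {θ : Θ}
    (h1 : b.1.2.1 ≤ θ) (h2 : θ ≤ b.1.2.2) :
    |clip (a + c) (p i θ g - p i b.1.1.1 g) - clip a (p i θ g - p i b.1.2.1 g)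
      - link p c i g b| ≤ linkErr p a c i g b := by
  have h3 := hg h1
  have h4 := hg h2
  simp only at h3 h4
  have e : p i θ g - p i b.1.1.1 g
      = (p i θ g - p i b.1.2.1 g) + (p i b.1.2.1 g - p i b.1.1.1 g) := by ring
  rw [e]
  refine (abs_clip_add_sub_le ha hc _ _).trans (min_le_min (add_le_add ?_ le_rfl) le_rfl)
  refine excess_le_excess ?_
  rw [abs_of_nonneg (by linarith), abs_of_nonneg (by linarith)]
  linarith

theorem abs_clip_sub_le_width {a : ℝ} (ha : 0 ≤ a) {i : ℕ} {g : Past m}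
    (hg : Monotone fun θ => p i θ g) {S : Finset (Θ × Θ)} (b : S) {θ : Θ}
    (h1 : b.1.1 ≤ θ) (h2 : θ ≤ b.1.2) : |clip a (p i θ g - p i b.1.1 g)| ≤ width p a i g b := by
  have h3 := hg h1
  have h4 := hg h2
  simp only at h3 h4
  have h5 : 0 ≤ clip a (p i θ g - p i b.1.1 g) := by
    have := clip_mono a (sub_nonneg.2 h3)
    rwa [clip_of_abs_le (x := 0) (by simpa using ha)] at this
  rw [abs_of_nonneg h5]
  exact clip_mono a (by linarith)

variable (h : IIDWithCopy μ ε ε') (hn : 1 ≤ n) (hp : DependentClass μ ε ε' n Δ DD DDinf T p)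
  (hmono : ∀ᵐ ω ∂μ, ∀ i ∈ Finset.Icc 1 n, Monotone fun θ => p i θ (innov ε i ω))
  (hanti : Antitone Δ) (hΔ0 : ∀ k, 0 ≤ Δ k) (hΔ : Summable Δ) (hDD : 0 < DD) (hDDinf : 0 < DDinf)

include h hn hp hmono hΔ0 hΔ hDD hDDinf

/-- The maximal inequality for one link of the chain. -/
theorem integral_norm_centredSum_link_le {B B' : Finset (Θ × Θ)} {δ H c : ℝ} (hδ : 0 < δ)
    (hH : 1 ≤ H) (hB : Real.log B.card ≤ H) (hB' : Real.log B'.card ≤ H)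
    (hx : ∀ b ∈ B, ∃ x : ℝ, 0 ≤ x ∧ vNorm Δ DD x ≤ δ ∧ ∑ i ∈ Finset.Icc 1 n,
      ∫ ω, (p i b.2 (innov ε i ω) - p i b.1 (innov ε i ω)) ^ 2 ∂μ ≤ n * x ^ 2)
    (hx' : ∀ b ∈ B', ∃ x : ℝ, 0 ≤ x ∧ vNorm Δ DD x ≤ δ / 2 ∧ ∑ i ∈ Finset.Icc 1 n,
      ∫ ω, (p i b.2 (innov ε i ω) - p i b.1 (innov ε i ω)) ^ 2 ∂μ ≤ n * x ^ 2)
    (hc : 0 ≤ c) (hcM : c ≤ truncLevel Δ DD DDinf n δ H) :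
    ∫ ω, ‖centredSum μ ε n (link p c (S := meetingPairs B B')) ω‖ ∂μ
      ≤ 576 * (Real.sqrt n * (1 + DDinf / DD) * (δ * Real.sqrt H)) := by
  classical
  refine h.integral_norm_centredSum_le hn hp hΔ0 hΔ hDD hDDinf (measurable_link hp c _) hδ hH
    (log_card_meetingPairs_le (by linarith) hB hB') (fun i g b => ?_) (fun b => ?_) fun b => ?_
  · have := abs_clip_le hc (p i b.1.2.1 g - p i b.1.1.1 g)
    unfold link
    linarith
  · refine ⟨![b.1.2.1, b.1.1.1, b.1.1.1, b.1.1.1], fun i g g' => ?_⟩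
    refine (abs_clip_sub_clip_le _ _ _).trans ?_
    rw [Fin.sum_univ_four]
    simp only [Matrix.cons_val]
    have e : p i b.1.2.1 g - p i b.1.1.1 g - (p i b.1.2.1 g' - p i b.1.1.1 g')
        = (p i b.1.2.1 g - p i b.1.2.1 g') - (p i b.1.1.1 g - p i b.1.1.1 g') := by ring
    rw [e]
    refine (abs_sub _ _).trans ?_
    linarith [abs_nonneg (p i b.1.1.1 g - p i b.1.1.1 g')]
  · have hb := Finset.mem_product.1 (Finset.mem_of_mem_filter _ b.2)
    obtain ⟨x, hx0, hxv, hx2⟩ := hx _ hb.1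
    obtain ⟨x', hx0', hxv', hx2'⟩ := hx' _ hb.2
    refine ⟨2 * (x + x'), by positivity, ?_, ?_⟩
    · have h1 := vNorm_mul_le hΔ0 hΔ hDD.le (c := 2) (add_nonneg hx0 hx0') (by norm_num)
      have h2 := vNorm_add_le hΔ0 hΔ hDD.le hx0 hx0'
      linarith
    · calc _ ≤ ∑ i ∈ Finset.Icc 1 n, ∫ ω, (p i b.1.2.1 (innov ε i ω)
              - p i b.1.1.1 (innov ε i ω)) ^ 2 ∂μ := by
            refine Finset.sum_le_sum fun i _ => integral_mono_of_nonneg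
              (Filter.Eventually.of_forall fun ω => sq_nonneg _) (integrable_sq_sub hp h i _ _)
              (Filter.Eventually.of_forall fun ω => sq_le_sq.2 (abs_clip_le_abs hc _))
        _ ≤ n * (2 * x ^ 2 + 2 * x' ^ 2) := sum_integral_sq_le hp h hmono b.2 hx2 hx2'
        _ ≤ _ := by
          refine mul_le_mul_of_nonneg_left ?_ (Nat.cast_nonneg n)
          nlinarith [mul_nonneg hx0 hx0', sq_nonneg x, sq_nonneg x']

/-- The maximal inequality for the bounds of the errors made in one link of the chain. -/
theorem integral_norm_centredSum_linkErr_le {B B' : Finset (Θ × Θ)} {δ H a c : ℝ} (hδ : 0 < δ)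
    (hH : 1 ≤ H) (hB : Real.log B.card ≤ H) (hB' : Real.log B'.card ≤ H)
    (hx : ∀ b ∈ B, ∃ x : ℝ, 0 ≤ x ∧ vNorm Δ DD x ≤ δ ∧ ∑ i ∈ Finset.Icc 1 n,
      ∫ ω, (p i b.2 (innov ε i ω) - p i b.1 (innov ε i ω)) ^ 2 ∂μ ≤ n * x ^ 2)
    (hx' : ∀ b ∈ B', ∃ x : ℝ, 0 ≤ x ∧ vNorm Δ DD x ≤ δ / 2 ∧ ∑ i ∈ Finset.Icc 1 n,
      ∫ ω, (p i b.2 (innov ε i ω) - p i b.1 (innov ε i ω)) ^ 2 ∂μ ≤ n * x ^ 2)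
    (ha : 0 ≤ a) (hc : 0 ≤ c) (hcM : a + c = truncLevel Δ DD DDinf n δ H) :
    ∫ ω, ‖centredSum μ ε n (linkErr p a c (S := meetingPairs B B')) ω‖ ∂μ
      ≤ 576 * (Real.sqrt n * (1 + DDinf / DD) * (δ * Real.sqrt H)) := by
  classical
  refine h.integral_norm_centredSum_le hn hp hΔ0 hΔ hDD hDDinf (measurable_linkErr hp a c _) hδ hH
    (log_card_meetingPairs_le (by linarith) hB hB') (fun i g b => ?_) (fun b => ?_) fun b => ?_
  · rw [← hcM]
    exact abs_linkErr_le ha hc i g b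
  · refine ⟨![b.1.2.2, b.1.2.1, b.1.2.1, b.1.1.1], fun i g g' => ?_⟩
    unfold linkErr
    refine (abs_min_sub_min_le_max _ _ _ _).trans ?_
    rw [sub_self, abs_zero, max_eq_left (abs_nonneg _), Fin.sum_univ_four]
    simp only [Matrix.cons_val]
    have h1 := abs_excess_sub_excess_le a (p i b.1.2.2 g - p i b.1.2.1 g)
      (p i b.1.2.2 g' - p i b.1.2.1 g')
    have h2 := abs_excess_sub_excess_le c (p i b.1.2.1 g - p i b.1.1.1 g)
      (p i b.1.2.1 g' - p i b.1.1.1 g')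
    have e1 : p i b.1.2.2 g - p i b.1.2.1 g - (p i b.1.2.2 g' - p i b.1.2.1 g')
        = (p i b.1.2.2 g - p i b.1.2.2 g') - (p i b.1.2.1 g - p i b.1.2.1 g') := by ring
    have e2 : p i b.1.2.1 g - p i b.1.1.1 g - (p i b.1.2.1 g' - p i b.1.1.1 g')
        = (p i b.1.2.1 g - p i b.1.2.1 g') - (p i b.1.1.1 g - p i b.1.1.1 g') := by ring
    rw [e1] at h1
    rw [e2] at h2
    have h3 := h1.trans (abs_sub _ _)
    have h4 := h2.trans (abs_sub _ _)
    rw [add_sub_add_comm]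
    refine (abs_add_le _ _).trans ?_
    linarith
  · have hb := Finset.mem_product.1 (Finset.mem_of_mem_filter _ b.2)
    obtain ⟨x, hx0, hxv, hx2⟩ := hx _ hb.1
    obtain ⟨x', hx0', hxv', hx2'⟩ := hx' _ hb.2
    refine ⟨2 * x + 4 * x', by positivity, ?_, ?_⟩
    · have h1 := vNorm_mul_le hΔ0 hΔ hDD.le (c := 2) hx0 (by norm_num)
      have h2 := vNorm_mul_le hΔ0 hΔ hDD.le (c := 4) hx0' (by norm_num)
      have h3 := vNorm_add_le hΔ0 hΔ hDD.le (x := 2 * x) (y := 4 * x') (by positivity)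
        (by positivity)
      linarith
    · have hsq := sum_integral_sq_le hp h hmono b.2 hx2 hx2'
      calc _ ≤ ∑ i ∈ Finset.Icc 1 n, ∫ ω, (2 * (p i b.1.2.2 (innov ε i ω)
              - p i b.1.2.1 (innov ε i ω)) ^ 2 + 2 * (p i b.1.2.1 (innov ε i ω)
              - p i b.1.1.1 (innov ε i ω)) ^ 2) ∂μ := by
            refine Finset.sum_le_sum fun i _ => integral_mono_of_nonneg
              (Filter.Eventually.of_forall fun ω => sq_nonneg _)
              (((integrable_sq_sub hp h i _ _).const_mul 2).add
                ((integrable_sq_sub hp h i _ _).const_mul 2))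
              (Filter.Eventually.of_forall fun ω => ?_)
            set y := p i b.1.2.2 (innov ε i ω) - p i b.1.2.1 (innov ε i ω)
            set z := p i b.1.2.1 (innov ε i ω) - p i b.1.1.1 (innov ε i ω)
            have h1 : |linkErr p a c i (innov ε i ω) b| ≤ |y| + |z| := by
              have h0 : 0 ≤ linkErr p a c i (innov ε i ω) b :=
                le_min (add_nonneg (excess_nonneg _ _) (excess_nonneg _ _)) (by linarith)
              rw [abs_of_nonneg h0]
              exact (min_le_left _ _).trans (add_le_add (excess_le_abs ha _) (excess_le_abs hc _))
            show linkErr p a c i (innov ε i ω) b ^ 2 ≤ 2 * y ^ 2 + 2 * z ^ 2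
            rw [← sq_abs, ← sq_abs y, ← sq_abs z]
            refine (pow_le_pow_left₀ (abs_nonneg _) h1 2).trans ?_
            nlinarith [sq_nonneg (|y| - |z|)]
        _ = 2 * ∑ i ∈ Finset.Icc 1 n,
                ∫ ω, (p i b.1.2.2 (innov ε i ω) - p i b.1.2.1 (innov ε i ω)) ^ 2 ∂μ
              + 2 * ∑ i ∈ Finset.Icc 1 n,
                ∫ ω, (p i b.1.2.1 (innov ε i ω) - p i b.1.1.1 (innov ε i ω)) ^ 2 ∂μ := by
            rw [Finset.mul_sum, Finset.mul_sum, ← Finset.sum_add_distrib]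
            refine Finset.sum_congr rfl fun i _ => ?_
            rw [integral_add ((integrable_sq_sub hp h i _ _).const_mul 2)
              ((integrable_sq_sub hp h i _ _).const_mul 2), integral_const_mul, integral_const_mul]
        _ ≤ n * (2 * x' ^ 2 + 2 * (2 * x ^ 2 + 2 * x' ^ 2)) := by linarith
        _ ≤ _ := by
          refine mul_le_mul_of_nonneg_left ?_ (Nat.cast_nonneg n)
          nlinarith [mul_nonneg hx0 hx0', sq_nonneg x, sq_nonneg x']

include hanti in
/-- One step of the chaining argument: the passage from brackets of size `δ` to brackets of size
`δ / 2`, simultaneously for all elements of the class. -/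
theorem exists_chain_step {B B' : Finset (Θ × Θ)} {δ H H' : ℝ} (hδ : 0 < δ)
    (hH : 1 ≤ H) (hHH : H ≤ H') (hB : Real.log B.card ≤ H) (hB' : Real.log B'.card ≤ H)
    (hx : ∀ b ∈ B, ∃ x : ℝ, 0 ≤ x ∧ vNorm Δ DD x ≤ δ ∧ ∑ i ∈ Finset.Icc 1 n,
      ∫ ω, (p i b.2 (innov ε i ω) - p i b.1 (innov ε i ω)) ^ 2 ∂μ ≤ n * x ^ 2)
    (hx' : ∀ b ∈ B', ∃ x : ℝ, 0 ≤ x ∧ vNorm Δ DD x ≤ δ / 2 ∧ ∑ i ∈ Finset.Icc 1 n,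
      ∫ ω, (p i b.2 (innov ε i ω) - p i b.1 (innov ε i ω)) ^ 2 ∂μ ≤ n * x ^ 2) :
    ∃ Z : Ω → ℝ, Integrable Z μ ∧
      ∫ ω, Z ω ∂μ ≤ Real.sqrt n * (1 + DDinf / DD + DD / DDinf)
        * (1168 * (δ * Real.sqrt H) + 2 * (δ / 2 * Real.sqrt H')) ∧
      ∀ᵐ ω ∂μ, ∀ θ, ∀ b ∈ B, ∀ b' ∈ B', b.1 ≤ θ → θ ≤ b.2 → b'.1 ≤ θ → θ ≤ b'.2 →
        |centredSum μ ε n (fun i g => clip (truncLevel Δ DD DDinf n δ H)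
            (p i θ g - p i b.1 g)) ω|
          ≤ |centredSum μ ε n (fun i g => clip (truncLevel Δ DD DDinf n (δ / 2) H')
            (p i θ g - p i b'.1 g)) ω| + Z ω := by
  classical
  set M := truncLevel Δ DD DDinf n δ H with hM
  set a := truncLevel Δ DD DDinf n (δ / 2) H' with ha
  have ha0 : 0 < a := truncLevel_pos hΔ0 hΔ hDD hDDinf hn (half_pos hδ) (hH.trans hHH)
  have h2a : 2 * a ≤ M := two_mul_truncLevel_half_le hΔ0 hΔ hDD hDDinf hδ hH hHH
  set c := M - a with hc
  have hc0 : 0 < c := by linarith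
  have hac : a + c = M := by rw [hc]; ring
  set S := meetingPairs B B'
  set C := Real.sqrt n * (DD / DDinf) * (δ / 2 * Real.sqrt H' + 8 * (δ * Real.sqrt H)) with hC
  -- the means of the error bounds
  have hmean : ∀ b : S, ∑ i ∈ Finset.Icc 1 n, ∫ ω, linkErr p a c i (innov ε i ω) b ∂μ ≤ C := by
    intro b
    have hb := Finset.mem_product.1 (Finset.mem_of_mem_filter _ b.2)
    obtain ⟨x, hx0, hxv, hx2⟩ := hx _ hb.1
    obtain ⟨x', hx0', hxv', hx2'⟩ := hx' _ hb.2
    have h1 := sum_integral_linkErr_le hp h hmono b hx2 hx2' ha0 hc0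
    have h2 := sq_div_truncLevel_le hanti hΔ0 hΔ hDD hDDinf hn hx0' (half_pos hδ)
      (hH.trans hHH) hxv'
    have h3 := sq_div_truncLevel_le hanti hΔ0 hΔ hDD hDDinf hn hx0 hδ hH hxv
    have h4 := sq_div_truncLevel_le hanti hΔ0 hΔ hDD hDDinf hn hx0' hδ hH
      (hxv'.trans (by linarith))
    rw [← ha] at h2
    rw [← hM] at h3 h4
    have h5 : n * (2 * x ^ 2 + 2 * x' ^ 2) / c ≤ 4 * (n * x ^ 2 / M) + 4 * (n * x' ^ 2 / M) := by
      calc n * (2 * x ^ 2 + 2 * x' ^ 2) / c ≤ n * (2 * x ^ 2 + 2 * x' ^ 2) / (M / 2) := by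
            gcongr
            · linarith
            · linarith
        _ = _ := by field_simp; ring
    calc _ ≤ _ := h1
      _ ≤ Real.sqrt n * (DD / DDinf) * (δ / 2 * Real.sqrt H')
          + 8 * (Real.sqrt n * (DD / DDinf) * (δ * Real.sqrt H)) := by linarith
      _ = C := by rw [hC]; ring
  have hlinkm := measurable_link hp c S
  have herrm := measurable_linkErr hp a c S
  have hlinkb : ∀ i g b, |link p c (S := S) i g b| ≤ c := fun i g b => abs_clip_le hc0.le _
  have herrb : ∀ i g b, |linkErr p a c (S := S) i g b| ≤ 2 * (a + c) :=
    fun i g b => abs_linkErr_le ha0.le hc0.le i g b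
  have hi1 := (integrable_centredSum (μ := μ) (n := n) h.meas hlinkm hc0.le hlinkb).norm
  have hi2 := (integrable_centredSum (μ := μ) (n := n) h.meas herrm (by linarith) herrb).norm
  refine ⟨fun ω => ‖centredSum μ ε n (link p c (S := S)) ω‖
    + ‖centredSum μ ε n (linkErr p a c (S := S)) ω‖ + 2 * C,
    (hi1.add hi2).add (integrable_const _), ?_, ?_⟩
  · have e : ∫ ω, (‖centredSum μ ε n (link p c (S := S)) ω‖
        + ‖centredSum μ ε n (linkErr p a c (S := S)) ω‖ + 2 * C) ∂μ
        = ∫ ω, ‖centredSum μ ε n (link p c (S := S)) ω‖ ∂μ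
          + ∫ ω, ‖centredSum μ ε n (linkErr p a c (S := S)) ω‖ ∂μ + 2 * C := by
      have hi3 : Integrable (fun ω => ‖centredSum μ ε n (link p c (S := S)) ω‖
        + ‖centredSum μ ε n (linkErr p a c (S := S)) ω‖) μ := hi1.add hi2
      rw [integral_add hi3 (integrable_const _), integral_add hi1 hi2]
      simp
    rw [e]
    have h1 := integral_norm_centredSum_link_le h hn hp hmono hΔ0 hΔ hDD hDDinf hδ hH hB hB' hx hx'
      hc0.le (by linarith)
    have h2 := integral_norm_centredSum_linkErr_le h hn hp hmono hΔ0 hΔ hDD hDDinf hδ hH hB hB' hx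
      hx' ha0.le hc0.le hac
    have h3 : 0 ≤ Real.sqrt n * (1 + DDinf / DD) * (δ / 2 * Real.sqrt H') := by positivity
    have h4 : 0 ≤ Real.sqrt n * (1 + DDinf / DD) * (δ * Real.sqrt H) := by positivity
    have h5 : 0 ≤ Real.sqrt n * (DD / DDinf) * (δ * Real.sqrt H) := by positivity
    have e2 : Real.sqrt n * (1 + DDinf / DD + DD / DDinf)
        * (1168 * (δ * Real.sqrt H) + 2 * (δ / 2 * Real.sqrt H'))
        = 1168 * (Real.sqrt n * (1 + DDinf / DD) * (δ * Real.sqrt H))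
          + 1168 * (Real.sqrt n * (DD / DDinf) * (δ * Real.sqrt H))
          + 2 * (Real.sqrt n * (1 + DDinf / DD) * (δ / 2 * Real.sqrt H'))
          + 2 * (Real.sqrt n * (DD / DDinf) * (δ / 2 * Real.sqrt H')) := by ring
    have e3 : 2 * C = 2 * (Real.sqrt n * (DD / DDinf) * (δ / 2 * Real.sqrt H'))
        + 16 * (Real.sqrt n * (DD / DDinf) * (δ * Real.sqrt H)) := by rw [hC]; ring
    rw [e2, e3]
    linarith
  · have hall : ∀ᵐ ω ∂μ, ∀ i ∈ Finset.Icc 1 n, Monotone fun θ => p i θ (innov ε i ω) := hmono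
    filter_upwards [hall] with ω hω θ b hb b' hb' hθ1 hθ2 hθ3 hθ4
    let s : S := ⟨(b, b'), Finset.mem_filter.2
      ⟨Finset.mem_product.2 ⟨hb, hb'⟩, θ, ⟨hθ1, hθ2⟩, hθ3, hθ4⟩⟩
    have hclipm : ∀ (M' : ℝ) (i : ℕ) (θ' : Θ), Measurable fun g => clip M' (p i θ g - p i θ' g) :=
      fun M' i θ' => (measurable_clip M').comp ((hp.meas i θ).sub (hp.meas i θ'))
    have hclipi : ∀ (M' : ℝ), 0 ≤ M' → ∀ (i : ℕ) (θ' : Θ), Integrable (fun ω =>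
        clip M' (p i θ (innov ε i ω) - p i θ' (innov ε i ω))) μ := fun M' hM' i θ' =>
      integrable_comp_innov (q := fun g => clip M' (p i θ g - p i θ' g)) h.meas i (hclipm M' i θ')
        fun g => abs_clip_le hM' _
    have hlinki : ∀ i : ℕ, Integrable (fun ω => link p c i (innov ε i ω) s) μ := fun i =>
      integrable_comp_innov (q := fun g => link p c i g s) h.meas i
        ((measurable_pi_apply s).comp (hlinkm i)) fun g => hlinkb i g s
    have herri : ∀ i : ℕ, Integrable (fun ω => linkErr p a c i (innov ε i ω) s) μ := fun i =>
      integrable_comp_innov (q := fun g => linkErr p a c i g s) h.meas i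
        ((measurable_pi_apply s).comp (herrm i)) fun g => herrb i g s
    -- the exact error made in this step
    let e : ℕ → Past m → ℝ := fun i g => clip M (p i θ g - p i b.1 g)
      - clip a (p i θ g - p i b'.1 g) - link p c i g s
    have hei : ∀ i : ℕ, Integrable (fun ω => e i (innov ε i ω)) μ := fun i =>
      ((hclipi M (by linarith) i b.1).sub (hclipi a ha0.le i b'.1)).sub (hlinki i)
    have hele : ∀ ω', (∀ i ∈ Finset.Icc 1 n, Monotone fun θ => p i θ (innov ε i ω')) →
        ∀ i ∈ Finset.Icc 1 n, |e i (innov ε i ω')| ≤ linkErr p a c i (innov ε i ω') s := by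
      intro ω' hω' i hi
      have := abs_clip_sub_link_le ha0.le hc0.le (hω' i hi) s hθ3 hθ4
      rwa [hac] at this
    have h1 := abs_centredSum_le_of_abs_le (μ := μ) (ε := ε) (n := n) (q := e)
      (Y := fun i g => linkErr p a c i g s) herri
      (by filter_upwards [hall] with ω' hω' using hele ω' hω') (hele ω hω)
    have h2 := abs_centredSum_le_norm (μ := μ) (n := n) h.meas herrm herrb s ω
    have h3 := abs_centredSum_le_norm (μ := μ) (n := n) h.meas hlinkm hlinkb s ω
    have h4 := hmean s
    have e1 : centredSum μ ε n (fun i g => clip M (p i θ g - p i b.1 g)) ω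
        = centredSum μ ε n (fun i g => clip a (p i θ g - p i b'.1 g)) ω
          + (centredSum μ ε n (fun i g => link p c i g s) ω + centredSum μ ε n e ω) := by
      rw [← centredSum_add hlinki hei, ← centredSum_add (hclipi a ha0.le · b'.1)
        fun i => (hlinki i).add (hei i)]
      congr 1
      funext i g
      simp only [e]
      ring
    rw [e1]
    refine (abs_add_le _ _).trans ?_
    have h5 := abs_add_le (centredSum μ ε n (fun i g => link p c i g s) ω) (centredSum μ ε n e ω)
    linarith

include hanti in
/-- The first `K` steps of the chaining argument, along a choice `br` of brackets. -/
theorem exists_chain (B : ℕ → Finset (Θ × Θ)) (br : ℕ → Θ → Θ × Θ)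
    (hbr : ∀ k θ, br k θ ∈ B k ∧ (br k θ).1 ≤ θ ∧ θ ≤ (br k θ).2) {σ : ℝ} (hσ : 0 < σ)
    (H : ℕ → ℝ) (hH : ∀ k, 1 ≤ H k) (hHm : Monotone H) (hB : ∀ k, Real.log (B k).card ≤ H k)
    (hB' : ∀ k, Real.log (B (k + 1)).card ≤ H k)
    (hx : ∀ k, ∀ b ∈ B k, ∃ x : ℝ, 0 ≤ x ∧ vNorm Δ DD x ≤ σ / 2 ^ k ∧ ∑ i ∈ Finset.Icc 1 n,
      ∫ ω, (p i b.2 (innov ε i ω) - p i b.1 (innov ε i ω)) ^ 2 ∂μ ≤ n * x ^ 2) (K : ℕ) :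
    ∃ Z : Ω → ℝ, Integrable Z μ ∧
      ∫ ω, Z ω ∂μ ≤ Real.sqrt n * (1 + DDinf / DD + DD / DDinf)
        * ∑ k ∈ Finset.range K, (1168 * (σ / 2 ^ k * Real.sqrt (H k))
          + 2 * (σ / 2 ^ (k + 1) * Real.sqrt (H (k + 1)))) ∧
      ∀ᵐ ω ∂μ, ∀ θ,
        |centredSum μ ε n (fun i g => clip (truncLevel Δ DD DDinf n σ (H 0))
            (p i θ g - p i (br 0 θ).1 g)) ω|
          ≤ |centredSum μ ε n (fun i g => clip (truncLevel Δ DD DDinf n (σ / 2 ^ K) (H K))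
            (p i θ g - p i (br K θ).1 g)) ω| + Z ω := by
  induction K with
  | zero =>
    refine ⟨fun _ => 0, integrable_zero _ _ _, by simp, Filter.Eventually.of_forall fun ω θ => ?_⟩
    simp
  | succ K ih =>
    obtain ⟨Z, hZ, hZ1, hZ2⟩ := ih
    have hhalf : σ / 2 ^ (K + 1) = σ / 2 ^ K / 2 := by rw [pow_succ]; field_simp
    obtain ⟨Z', hZ', hZ1', hZ2'⟩ := exists_chain_step h hn hp hmono hanti hΔ0 hΔ hDD hDDinf
      (B := B K) (B' := B (K + 1)) (δ := σ / 2 ^ K) (by positivity) (hH K) (hHm K.le_succ) (hB K)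
      (hB' K) (hx K) (by rw [← hhalf]; exact hx (K + 1))
    rw [← hhalf] at hZ1' hZ2'
    refine ⟨fun ω => Z ω + Z' ω, hZ.add hZ', ?_, ?_⟩
    · rw [integral_add hZ hZ', Finset.sum_range_succ, mul_add]
      exact add_le_add hZ1 hZ1'
    · filter_upwards [hZ2, hZ2'] with ω h1 h2 θ
      have h3 := h1 θ
      have h4 := h2 θ _ (hbr K θ).1 _ (hbr (K + 1) θ).1 (hbr K θ).2.1 (hbr K θ).2.2
        (hbr (K + 1) θ).2.1 (hbr (K + 1) θ).2.2
      linarith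

/-- The truncated remainders at the end of the chain. -/
theorem exists_chain_end {B : Finset (Θ × Θ)} {δ H : ℝ} (hδ : 0 < δ)
    (hH : 1 ≤ H) (hB : Real.log B.card ≤ H)
    (hx : ∀ b ∈ B, ∃ x : ℝ, 0 ≤ x ∧ vNorm Δ DD x ≤ δ ∧ ∑ i ∈ Finset.Icc 1 n,
      ∫ ω, (p i b.2 (innov ε i ω) - p i b.1 (innov ε i ω)) ^ 2 ∂μ ≤ n * x ^ 2) :
    ∃ Z : Ω → ℝ, Integrable Z μ ∧
      ∫ ω, Z ω ∂μ ≤ 576 * (Real.sqrt n * (1 + DDinf / DD) * (δ * Real.sqrt H)) + 2 * (n * δ) ∧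
      ∀ᵐ ω ∂μ, ∀ θ, ∀ b ∈ B, b.1 ≤ θ → θ ≤ b.2 →
        |centredSum μ ε n (fun i g => clip (truncLevel Δ DD DDinf n δ H)
            (p i θ g - p i b.1 g)) ω| ≤ Z ω := by
  set M := truncLevel Δ DD DDinf n δ H with hM
  have hM0 : 0 < M := truncLevel_pos hΔ0 hΔ hDD hDDinf hn hδ hH
  have hwm := measurable_width hp M B
  have hwb : ∀ i g b, |width p M (S := B) i g b| ≤ M := fun i g b => abs_clip_le hM0.le _
  have hwi : ∀ (i : ℕ) b, Integrable (fun ω => width p M (S := B) i (innov ε i ω) b) μ :=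
    fun i b => integrable_comp_innov (q := fun g => width p M i g b) h.meas i
      ((measurable_pi_apply b).comp (hwm i)) fun g => hwb i g b
  have hi := (integrable_centredSum (μ := μ) (n := n) h.meas hwm hM0.le hwb).norm
  have hmean : ∀ b : B, ∑ i ∈ Finset.Icc 1 n, ∫ ω, width p M i (innov ε i ω) b ∂μ ≤ n * δ := by
    intro b
    obtain ⟨x, hx0, hxv, hx2⟩ := hx _ b.2
    have h1 := sum_integral_abs_sub_le hp h hx0 hx2
    refine le_trans (Finset.sum_le_sum fun i _ => ?_) (h1.trans ?_)
    · refine integral_mono (hwi i b) ?_ fun ω => (le_abs_self _).trans (abs_clip_le_abs hM0.le _)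
      refine integrable_comp_innov (q := fun g => |p i b.1.2 g - p i b.1.1 g|) (K := 2 * T)
        h.meas i ((hp.meas i _).sub (hp.meas i _)).abs fun g => ?_
      rw [abs_abs]
      refine (abs_sub _ _).trans ?_
      linarith [hp.bound i b.1.2 g, hp.bound i b.1.1 g]
    · exact mul_le_mul_of_nonneg_left ((le_vNorm hΔ0 hDD.le hx0).trans hxv) (Nat.cast_nonneg n)
  refine ⟨fun ω => ‖centredSum μ ε n (width p M (S := B)) ω‖ + 2 * (n * δ),
    hi.add (integrable_const _), ?_, ?_⟩
  · rw [integral_add hi (integrable_const _)]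
    have := h.integral_norm_centredSum_le hn hp hΔ0 hΔ hDD hDDinf hwm hδ hH
      (by rw [Fintype.card_coe]; linarith) (fun i g b => (hwb i g b).trans (by linarith))
      (fun b => ?_) (fun b => ?_)
    · simpa using this
    · refine ⟨![b.1.2, b.1.1, b.1.1, b.1.1], fun i g g' => ?_⟩
      refine (abs_clip_sub_clip_le _ _ _).trans ?_
      rw [Fin.sum_univ_four]
      simp only [Matrix.cons_val]
      have e : p i b.1.2 g - p i b.1.1 g - (p i b.1.2 g' - p i b.1.1 g')
          = (p i b.1.2 g - p i b.1.2 g') - (p i b.1.1 g - p i b.1.1 g') := by ring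
      rw [e]
      refine (abs_sub _ _).trans ?_
      linarith [abs_nonneg (p i b.1.1 g - p i b.1.1 g')]
    · obtain ⟨x, hx0, hxv, hx2⟩ := hx _ b.2
      refine ⟨x, hx0, by linarith, le_trans (Finset.sum_le_sum fun i _ => ?_) hx2⟩
      exact integral_mono_of_nonneg (Filter.Eventually.of_forall fun ω => sq_nonneg _)
        (integrable_sq_sub hp h i _ _)
        (Filter.Eventually.of_forall fun ω => sq_le_sq.2 (abs_clip_le_abs hM0.le _))
  · filter_upwards [hmono] with ω hω θ b hb h1 h2
    have h3 := abs_centredSum_le_of_abs_le (μ := μ) (ε := ε) (n := n)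
      (q := fun i g => clip M (p i θ g - p i b.1 g)) (Y := fun i g => width p M i g ⟨b, hb⟩)
      (fun i => hwi i ⟨b, hb⟩)
      (by
        filter_upwards [hmono] with ω' hω' i hi
          using abs_clip_sub_le_width hM0.le (hω' i hi) ⟨b, hb⟩ h1 h2)
      fun i hi => abs_clip_sub_le_width hM0.le (hω i hi) ⟨b, hb⟩ h1 h2
    have h4 := abs_centredSum_le_norm (μ := μ) (n := n) h.meas hwm hwb ⟨b, hb⟩ ω
    have h5 := hmean ⟨b, hb⟩
    linarith

include hanti in
/-- The chaining bound for a class of bounded dependent processes which is covered, for each `k`, by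
finitely many brackets of size `σ / 2 ^ k`. -/
theorem exists_integrable_bound_centredSum (B : ℕ → Finset (Θ × Θ))
    (hcov : ∀ k θ, ∃ b ∈ B k, b.1 ≤ θ ∧ θ ≤ b.2) {σ : ℝ} (hσ : 0 < σ)
    (H : ℕ → ℝ) (hH : ∀ k, 1 ≤ H k) (hHm : Monotone H) (hB : ∀ k, Real.log (B k).card ≤ H k)
    (hB' : ∀ k, Real.log (B (k + 1)).card ≤ H k) (hT : 4 * T ≤ truncLevel Δ DD DDinf n σ (H 0))
    (hx : ∀ k, ∀ b ∈ B k, ∃ x : ℝ, 0 ≤ x ∧ vNorm Δ DD x ≤ σ / 2 ^ k ∧ ∑ i ∈ Finset.Icc 1 n,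
      ∫ ω, (p i b.2 (innov ε i ω) - p i b.1 (innov ε i ω)) ^ 2 ∂μ ≤ n * x ^ 2)
    (hx0 : ∀ θ, ∃ x : ℝ, 0 ≤ x ∧ vNorm Δ DD x ≤ σ ∧ ∑ i ∈ Finset.Icc 1 n,
      ∫ ω, (p i θ (innov ε i ω)) ^ 2 ∂μ ≤ n * x ^ 2) (K : ℕ) :
    ∃ Z : Ω → ℝ, Integrable Z μ ∧
      ∫ ω, Z ω ∂μ ≤ 2400 * (Real.sqrt n * (1 + DDinf / DD + DD / DDinf)
        * ∑ k ∈ Finset.range (K + 1), σ / 2 ^ k * Real.sqrt (H k)) + 2 * (n * (σ / 2 ^ K)) ∧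
      ∀ᵐ ω ∂μ, ∀ θ, |centredSum μ ε n (fun i g => p i θ g) ω| ≤ Z ω := by
  choose br hbrB hbr1 hbr2 using hcov
  obtain ⟨Z, hZ, hZ1, hZ2⟩ := exists_chain h hn hp hmono hanti hΔ0 hΔ hDD hDDinf B br
    (fun k θ => ⟨hbrB k θ, hbr1 k θ, hbr2 k θ⟩) hσ H hH hHm hB hB' hx K
  obtain ⟨Z', hZ', hZ1', hZ2'⟩ := exists_chain_end h hn hp hmono hΔ0 hΔ hDD hDDinf
    (δ := σ / 2 ^ K) (by positivity) (hH K) (hB K) (hx K)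
  let y : ℕ → Past m → B 0 → ℝ := fun i g b => p i b.1.1 g
  have hym : ∀ i, Measurable (y i) := fun i => measurable_pi_iff.2 fun b => hp.meas i _
  have hyb : ∀ i g b, |y i g b| ≤ |T| := fun i g b => (hp.bound i _ g).trans (le_abs_self T)
  have hM0 := truncLevel_pos hΔ0 hΔ hDD hDDinf hn hσ (hH 0)
  have hi := (integrable_centredSum (μ := μ) (n := n) h.meas hym (abs_nonneg T) hyb).norm
  have hfirst : ∫ ω, ‖centredSum μ ε n y ω‖ ∂μ
      ≤ 576 * (Real.sqrt n * (1 + DDinf / DD) * (σ * Real.sqrt (H 0))) := by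
    refine h.integral_norm_centredSum_le hn hp hΔ0 hΔ hDD hDDinf hym hσ (hH 0)
      (by rw [Fintype.card_coe]; linarith [hB 0, hH 0])
      (fun i g b => (hp.bound i _ g).trans (by linarith)) (fun b => ?_) (fun b => ?_)
    · refine ⟨fun _ => b.1.1, fun i g g' => ?_⟩
      rw [Fin.sum_univ_four]
      have := abs_nonneg (p i b.1.1 g - p i b.1.1 g')
      simp only [y]
      linarith
    · obtain ⟨x, hx0, hxv, hx2⟩ := hx0 b.1.1
      exact ⟨x, hx0, by linarith, hx2⟩
  refine ⟨fun ω => ‖centredSum μ ε n y ω‖ + (Z ω + Z' ω), hi.add (hZ.add hZ'), ?_, ?_⟩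
  · have hZZ : Integrable (fun ω => Z ω + Z' ω) μ := hZ.add hZ'
    rw [integral_add hi hZZ, integral_add hZ hZ']
    set s : ℕ → ℝ := fun k => σ / 2 ^ k * Real.sqrt (H k) with hs
    have hs0 : ∀ k, 0 ≤ s k := fun k => by rw [hs]; positivity
    set S := ∑ k ∈ Finset.range (K + 1), s k with hS
    have hS1 : s 0 ≤ S := Finset.single_le_sum (f := s) (fun k _ => hs0 k) (by simp)
    have hS2 : s K ≤ S := Finset.single_le_sum (f := s) (fun k _ => hs0 k) (by simp)
    have hS3 : ∑ k ∈ Finset.range K, (1168 * s k + 2 * s (k + 1)) ≤ 1170 * S := by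
      rw [Finset.sum_add_distrib, ← Finset.mul_sum, ← Finset.mul_sum]
      have h1 : ∑ k ∈ Finset.range K, s k ≤ S := by
        rw [hS, Finset.sum_range_succ]; linarith [hs0 K]
      have h2 : ∑ k ∈ Finset.range K, s (k + 1) ≤ S := by
        rw [hS, Finset.sum_range_succ']; linarith [hs0 0]
      linarith
    set G := Real.sqrt n * (1 + DDinf / DD + DD / DDinf) with hG
    have hG0 : 0 ≤ G := by positivity
    have hG1 : Real.sqrt n * (1 + DDinf / DD) ≤ G := by
      rw [hG]
      refine mul_le_mul_of_nonneg_left ?_ (Real.sqrt_nonneg _)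
      have : 0 ≤ DD / DDinf := by positivity
      linarith
    have b1 : ∫ ω, ‖centredSum μ ε n y ω‖ ∂μ ≤ 576 * (G * S) := by
      refine hfirst.trans ?_
      have e : σ * Real.sqrt (H 0) = s 0 := by simp [hs]
      rw [e]
      have := mul_le_mul hG1 hS1 (hs0 0) hG0
      linarith
    have b2 : ∫ ω, Z ω ∂μ ≤ 1170 * (G * S) := by
      refine hZ1.trans ?_
      have := mul_le_mul_of_nonneg_left hS3 hG0
      linarith
    have b3 : ∫ ω, Z' ω ∂μ ≤ 576 * (G * S) + 2 * (n * (σ / 2 ^ K)) := by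
      refine hZ1'.trans ?_
      have := mul_le_mul hG1 hS2 (hs0 K) hG0
      linarith
    have : 0 ≤ G * S := mul_nonneg hG0 (Finset.sum_nonneg fun k _ => hs0 k)
    linarith
  · filter_upwards [hZ2, hZ2'] with ω h1 h2 θ
    have h3 := h1 θ
    have h4 := h2 θ _ (hbrB K θ) (hbr1 K θ) (hbr2 K θ)
    have h5 := abs_centredSum_le_norm (μ := μ) (n := n) h.meas hym hyb ⟨br 0 θ, hbrB 0 θ⟩ ω
    have hpi : ∀ (θ : Θ) (i : ℕ), Integrable (fun ω => p i θ (innov ε i ω)) μ := fun θ i =>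
      integrable_comp_innov h.meas i (hp.meas i θ) (hp.bound i θ)
    have e1 : (fun i g => p i θ g) = fun i g => p i (br 0 θ).1 g
        + clip (truncLevel Δ DD DDinf n σ (H 0)) (p i θ g - p i (br 0 θ).1 g) := by
      funext i g
      rw [clip_of_abs_le]
      · ring
      · refine (abs_sub _ _).trans ?_
        linarith [hp.bound i θ g, hp.bound i (br 0 θ).1 g]
    rw [e1, centredSum_add (hpi _) fun i => integrable_comp_innov
      (q := fun g => clip (truncLevel Δ DD DDinf n σ (H 0)) (p i θ g - p i (br 0 θ).1 g)) h.meas i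
      ((measurable_clip _).comp ((hp.meas i _).sub (hp.meas i _))) fun g => abs_clip_le hM0.le _]
    refine (abs_add_le _ _).trans ?_
    simp only [y] at h5
    linarith

end Chaining

/-! ### Outer expectation, entropy and norms -/

section OuterExpectation

variable {Ω : Type*} [MeasurableSpace Ω] {μ : Measure Ω}

/-- The exceptional null set is absorbed by a measurable null set on which the majorant is set to
infinity. -/
theorem outerExp_le_lintegral {X Y : Ω → ℝ≥0∞} (hY : AEMeasurable Y μ) (h : ∀ᵐ ω ∂μ, X ω ≤ Y ω) :
    outerExp μ X ≤ ∫⁻ ω, Y ω ∂μ := by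
  have h1 : ∀ᵐ ω ∂μ, X ω ≤ hY.mk Y ω := by
    filter_upwards [h, hY.ae_eq_mk] with ω hω e
    rwa [← e]
  set N := toMeasurable μ {ω | ¬ X ω ≤ hY.mk Y ω} with hN
  have hN0 : μ N = 0 := by rw [hN, measure_toMeasurable]; exact h1
  have hNm : MeasurableSet N := measurableSet_toMeasurable _ _
  calc outerExp μ X ≤ ∫⁻ ω, (hY.mk Y ω + N.indicator (fun _ => ⊤) ω) ∂μ := by
        refine iInf₂_le_of_le _ (hY.measurable_mk.add (measurable_const.indicator hNm))
          (iInf_le _ fun ω => ?_)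
        by_cases hω : ω ∈ N
        · simp [hω]
        · have : X ω ≤ hY.mk Y ω := by
            by_contra hc
            exact hω (subset_toMeasurable _ _ hc)
          exact this.trans le_self_add
    _ = ∫⁻ ω, hY.mk Y ω ∂μ := by
        rw [lintegral_add_left hY.measurable_mk, lintegral_indicator hNm]
        simp [hN0]
    _ = ∫⁻ ω, Y ω ∂μ := (lintegral_congr_ae hY.ae_eq_mk).symm

end OuterExpectation

section Entropy

variable {d : ℕ} {𝓕 : Set (Fn d)} {V : Fn d → ℝ≥0∞}

theorem bracketNum_anti (𝓕 : Set (Fn d)) (V : Fn d → ℝ≥0∞) :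
    Antitone fun η => bracketNum η 𝓕 V := by
  intro η η' hη
  refine le_iInf₂ fun B hB => iInf₂_le_of_le B ⟨fun b hb => ?_, hB.2⟩ le_rfl
  obtain ⟨h1, h2, h3⟩ := hB.1 b hb
  exact ⟨h1, h2, h3.trans (ENNReal.ofReal_le_ofReal hη)⟩

theorem exists_bracket_cover {η : ℝ} (h : bracketNum η 𝓕 V ≠ ⊤) :
    ∃ B : Finset (𝓕 × 𝓕), (B.card : ℕ∞) ≤ bracketNum η 𝓕 V ∧
      (∀ b ∈ B, V ((b.2 : Fn d) - b.1) ≤ ENNReal.ofReal η) ∧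
      ∀ θ : 𝓕, ∃ b ∈ B, b.1 ≤ θ ∧ θ ≤ b.2 := by
  classical
  have h1 : bracketNum η 𝓕 V < bracketNum η 𝓕 V + 1 := by
    lift bracketNum η 𝓕 V to ℕ using h with N
    exact_mod_cast N.lt_succ_self
  nth_rewrite 1 [bracketNum] at h1
  obtain ⟨B, hB⟩ := iInf_lt_iff.1 h1
  obtain ⟨⟨hB1, hB2⟩, hcard⟩ := iInf_lt_iff.1 hB
  refine ⟨B.attach.image fun b => (⟨b.1.1, (hB1 _ b.2).1⟩, ⟨b.1.2, (hB1 _ b.2).2.1⟩), ?_, ?_, ?_⟩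
  · refine le_trans ?_ (Order.le_of_lt_add_one hcard)
    exact_mod_cast Finset.card_image_le.trans (by rw [Finset.card_attach])
  · intro b hb
    obtain ⟨b', -, rfl⟩ := Finset.mem_image.1 hb
    exact (hB1 _ b'.2).2.2
  · rintro ⟨f, hf⟩
    obtain ⟨b, hb, h2, h3⟩ := hB2 f hf
    exact ⟨_, Finset.mem_image.2 ⟨⟨b, hb⟩, Finset.mem_attach _ _, rfl⟩, h2, h3⟩

/-- The real number `max(1, log k)`; it agrees with `HFun` for finite `k`. -/
noncomputable def logCard (k : ℕ∞) : ℝ := max 1 (Real.log k.toNat)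

theorem one_le_logCard (k : ℕ∞) : 1 ≤ logCard k := le_max_left _ _

theorem HFun_eq_ofReal {k : ℕ∞} (hk : k ≠ ⊤) : HFun k = ENNReal.ofReal (logCard k) := by
  lift k to ℕ using hk
  rfl

theorem HFun_rpow_eq {k : ℕ∞} (hk : k ≠ ⊤) :
    HFun k ^ (1 / 2 : ℝ) = ENNReal.ofReal (Real.sqrt (logCard k)) := by
  rw [HFun_eq_ofReal hk, ENNReal.ofReal_rpow_of_nonneg (by linarith [one_le_logCard k])
    (by norm_num), Real.sqrt_eq_rpow]

theorem logCard_mono {k k' : ℕ∞} (hk' : k' ≠ ⊤) (h : k ≤ k') : logCard k ≤ logCard k' := by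
  have h1 : k.toNat ≤ k'.toNat := ENat.toNat_le_toNat h hk'
  refine max_le_max le_rfl ?_
  rcases Nat.eq_zero_or_pos k.toNat with h0 | h0
  · rw [h0, Nat.cast_zero, Real.log_zero]
    exact Real.log_natCast_nonneg _
  · exact Real.log_le_log (by exact_mod_cast h0) (by exact_mod_cast h1)

theorem log_le_logCard {a : ℕ} {k : ℕ∞} (hk : k ≠ ⊤) (h : (a : ℕ∞) ≤ k) :
    Real.log a ≤ logCard k :=
  (le_max_right _ _).trans (logCard_mono (k := a) hk h)

theorem one_le_HFun (k : ℕ∞) : 1 ≤ HFun k := by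
  by_cases hk : k = ⊤
  · rw [hk]; exact le_top
  · rw [HFun_eq_ofReal hk, ENNReal.one_le_ofReal]; exact one_le_logCard k

theorem HFun_mono : Monotone HFun := by
  intro k k' h
  by_cases hk' : k' = ⊤
  · rw [hk']; exact le_top
  · rw [HFun_eq_ofReal hk', HFun_eq_ofReal (ne_top_of_le_ne_top hk' h)]
    exact ENNReal.ofReal_le_ofReal (logCard_mono hk' h)

theorem antitone_sqrt_entropy (𝓕 : Set (Fn d)) (V : Fn d → ℝ≥0∞) :
    Antitone fun η => HFun (bracketNum η 𝓕 V) ^ (1 / 2 : ℝ) := fun _ _ h =>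
  ENNReal.rpow_le_rpow (HFun_mono (bracketNum_anti 𝓕 V h)) (by norm_num)

theorem bracketNum_ne_top {σ η : ℝ} (hη : 0 < η) (hησ : η ≤ σ)
    (hI : ∫⁻ η in Set.Ioc 0 σ, HFun (bracketNum η 𝓕 V) ^ (1 / 2 : ℝ) ≠ ⊤) :
    bracketNum η 𝓕 V ≠ ⊤ := by
  intro htop
  refine hI (top_le_iff.1 ?_)
  calc (⊤ : ℝ≥0∞) = ∫⁻ _ in Set.Ioc 0 η, (⊤ : ℝ≥0∞) := by
        rw [setLIntegral_const, Real.volume_Ioc, ENNReal.top_mul]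
        simpa using hη
    _ ≤ ∫⁻ x in Set.Ioc 0 η, HFun (bracketNum x 𝓕 V) ^ (1 / 2 : ℝ) := by
        refine setLIntegral_mono' measurableSet_Ioc fun x hx => ?_
        have h1 := bracketNum_anti 𝓕 V hx.2
        simp only [htop, top_le_iff] at h1
        rw [h1, show HFun ⊤ = ⊤ from rfl, ENNReal.top_rpow_of_pos (by norm_num)]
    _ ≤ _ := lintegral_mono_set (Set.Ioc_subset_Ioc_right hησ)

/-- A dyadic sum is bounded by an integral. -/
theorem sum_mul_le_lintegral {g : ℝ → ℝ≥0∞} (hg : Antitone g) {σ : ℝ} (hσ : 0 < σ) (K : ℕ) :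
    ∑ k ∈ Finset.range K, ENNReal.ofReal (σ / 2 ^ k) * g (σ / 2 ^ (k + 1))
      ≤ 4 * ∫⁻ η in Set.Ioc 0 σ, g η := by
  have key : ∑ k ∈ Finset.range K, ENNReal.ofReal (σ / 2 ^ k) * g (σ / 2 ^ (k + 1))
      ≤ 4 * ∫⁻ η in Set.Ioc (σ / 2 ^ (K + 1)) σ, g η := by
    induction K with
    | zero => simp
    | succ K ih =>
      have h1 : σ / 2 ^ (K + 1 + 1) ≤ σ / 2 ^ (K + 1) := by
        gcongr
        · norm_num
        · omega
      have h2 : σ / 2 ^ (K + 1) ≤ σ := div_le_self hσ.le (one_le_pow₀ (by norm_num))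
      have h3 : ENNReal.ofReal (σ / 2 ^ K) * g (σ / 2 ^ (K + 1))
          ≤ 4 * ∫⁻ η in Set.Ioc (σ / 2 ^ (K + 1 + 1)) (σ / 2 ^ (K + 1)), g η := by
        calc ENNReal.ofReal (σ / 2 ^ K) * g (σ / 2 ^ (K + 1))
            = 4 * ∫⁻ _ in Set.Ioc (σ / 2 ^ (K + 1 + 1)) (σ / 2 ^ (K + 1)),
                g (σ / 2 ^ (K + 1)) := by
              rw [setLIntegral_const, Real.volume_Ioc, mul_comm (g _), ← mul_assoc]
              congr 1
              rw [show (4 : ℝ≥0∞) = ENNReal.ofReal 4 by norm_num, ← ENNReal.ofReal_mul (by norm_num)]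
              congr 1
              rw [pow_succ, pow_succ]
              field_simp
              ring
          _ ≤ _ := by
              gcongr 4 * ?_
              exact setLIntegral_mono' measurableSet_Ioc fun x hx => hg hx.2
      rw [Finset.sum_range_succ, ← Set.Ioc_union_Ioc_eq_Ioc h1 h2,
        lintegral_union measurableSet_Ioc (Set.Ioc_disjoint_Ioc_of_le le_rfl), mul_add, add_comm]
      exact add_le_add h3 ih
  refine key.trans ?_
  gcongr 4 * ?_
  exact lintegral_mono_set (Set.Ioc_subset_Ioc_left (by positivity))

theorem ofReal_le_lintegral_sqrt_entropy (𝓕 : Set (Fn d)) (V : Fn d → ℝ≥0∞) (σ : ℝ) :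
    ENNReal.ofReal σ ≤ ∫⁻ η in Set.Ioc 0 σ, HFun (bracketNum η 𝓕 V) ^ (1 / 2 : ℝ) := by
  calc ENNReal.ofReal σ = ∫⁻ _ in Set.Ioc 0 σ, (1 : ℝ≥0∞) := by
        rw [setLIntegral_const, Real.volume_Ioc, sub_zero, one_mul]
    _ ≤ _ := setLIntegral_mono' measurableSet_Ioc fun x _ =>
        ENNReal.one_le_rpow (one_le_HFun _) (by norm_num)

theorem mFun_eq (Δ : ℕ → ℝ) (DD DDinf : ℝ) (n : ℕ) (δ : ℝ) {k : ℕ∞} (hk : k ≠ ⊤) :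
    mFun Δ DD DDinf n δ k = ENNReal.ofReal (truncLevel Δ DD DDinf n δ (logCard k)) := by
  have : 0 < Real.sqrt (logCard k) := Real.sqrt_pos.2 (by linarith [one_le_logCard k])
  rw [mFun, HFun_rpow_eq hk, truncLevel, ENNReal.ofReal_div_of_pos this]

end Entropy

section Norms

variable {Ω : Type*} [MeasurableSpace Ω] {μ : Measure Ω} {m d : ℕ}
  {J : ℤ → Past m → Fin d → ℝ} {ε ε' : ℤ → Ω → Fin m → ℝ} {n : ℕ}

theorem measurable_evalObs (hJ : ∀ i, Measurable (J i)) (hε : ∀ i, Measurable (ε i)) (i : ℕ)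
    {f : Fn d} (hf : Measurable f) : Measurable (evalObs J ε n i f) := by
  refine hf.comp (Measurable.prodMk (measurable_pi_iff.2 fun k => ?_) measurable_const)
  exact (hJ _).comp (measurable_innov hε _)

theorem sum_eLpNorm_rpow_eq (hn : 1 ≤ n) {ν : ℝ≥0} (hν : ν ≠ 0) (f : Fn d) :
    ∑ i ∈ Finset.Icc 1 n, eLpNorm (evalObs J ε n i f) (ν : ℝ≥0∞) μ ^ (ν : ℝ)
      = n * normN μ J ε n ν f ^ (ν : ℝ) := by
  have hn0 : (n : ℝ≥0∞) ≠ 0 := by exact_mod_cast (by omega : n ≠ 0)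
  rw [normN, ← ENNReal.rpow_mul, one_div_mul_cancel (by exact_mod_cast hν), ENNReal.rpow_one,
    ← mul_assoc, ENNReal.mul_inv_cancel hn0 (ENNReal.natCast_ne_top n), one_mul]

theorem sum_lintegral_enorm_eq (hn : 1 ≤ n) (f : Fn d) :
    ∑ i ∈ Finset.Icc 1 n, eLpNorm (evalObs J ε n i f) 1 μ = n * normN μ J ε n 1 f := by
  simpa using sum_eLpNorm_rpow_eq (μ := μ) (J := J) (ε := ε) hn one_ne_zero f

theorem sum_eLpNorm_sq_eq (hn : 1 ≤ n) (f : Fn d) :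
    ∑ i ∈ Finset.Icc 1 n, eLpNorm (evalObs J ε n i f) 2 μ ^ 2 = n * normN μ J ε n 2 f ^ 2 := by
  simpa using sum_eLpNorm_rpow_eq (μ := μ) (J := J) (ε := ε) hn two_ne_zero f

theorem sq_eLpNorm_two {r : Ω → ℝ} : eLpNorm r 2 μ ^ 2 = ∫⁻ ω, ‖r ω‖ₑ ^ 2 ∂μ := by
  rw [eLpNorm_eq_lintegral_rpow_enorm_toReal (by norm_num) (by norm_num), ← ENNReal.rpow_natCast,
    ← ENNReal.rpow_mul]
  simp

theorem ofReal_integral_sq_le (r : Ω → ℝ) :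
    ENNReal.ofReal (∫ ω, r ω ^ 2 ∂μ) ≤ ∫⁻ ω, ‖r ω‖ₑ ^ 2 ∂μ := by
  calc ENNReal.ofReal (∫ ω, r ω ^ 2 ∂μ) ≤ ‖∫ ω, r ω ^ 2 ∂μ‖ₑ := Real.ofReal_le_enorm _
    _ ≤ ∫⁻ ω, ‖r ω ^ 2‖ₑ ∂μ := enorm_integral_le_lintegral_enorm _
    _ = _ := by simp only [enorm_pow]

variable {𝓕 : Set (Fn d)} {w : ℕ → Fn d → Past m → ℝ} {D : Fn d → unitInterval → ℝ} {Δ : ℕ → ℝ}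
  {DD : ℝ}

theorem V_eq_ofReal (hΔ0 : ∀ k, 0 ≤ Δ k) (hΔ : Summable Δ) (hDD : 0 < DD) {f : Fn d}
    (hf : normN μ J ε n 2 f ≠ ⊤) :
    V μ J ε n DD Δ f = ENNReal.ofReal (vNorm Δ DD (normN μ J ε n 2 f).toReal) := by
  set x := (normN μ J ε n 2 f).toReal with hx
  have hx0 : 0 ≤ x := ENNReal.toReal_nonneg
  have e : normN μ J ε n 2 f = ENNReal.ofReal x := (ENNReal.ofReal_toReal hf).symm
  have h0 : ∀ k, 0 ≤ min x (DD * Δ (k + 1)) := fun k => le_min hx0 (mul_nonneg hDD.le (hΔ0 _))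
  rw [V, vNorm, ENNReal.ofReal_add hx0 (tsum_nonneg h0), e,
    ENNReal.ofReal_tsum_of_nonneg h0 (summable_min_mul hΔ0 hΔ hDD.le hx0)]
  simp only [ENNReal.ofReal_min]

/-- Second moments of processes dominated by `W_i(f)` in terms of `V(f)`. -/
theorem WCondition.exists_vNorm_le (hW : WCondition μ J ε ε' n 𝓕 w D Δ) (hn : 1 ≤ n)
    (hΔ0 : ∀ k, 0 ≤ Δ k) (hΔ : Summable Δ) (hDD : 0 < DD) {f : Fn d} (hf : Measurable f) {δ : ℝ}
    (hδ : 0 ≤ δ) (hV : V μ J ε n DD Δ f ≤ ENNReal.ofReal δ) {r : ℕ → Ω → ℝ}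
    (hr : ∀ i ∈ Finset.Icc 1 n, ∀ᵐ ω ∂μ, |r i ω| ≤ |WVar w ε i f ω|) :
    ∃ x : ℝ, 0 ≤ x ∧ vNorm Δ DD x ≤ δ ∧ ∑ i ∈ Finset.Icc 1 n, ∫ ω, r i ω ^ 2 ∂μ ≤ n * x ^ 2 := by
  have hfin : normN μ J ε n 2 f ≠ ⊤ :=
    ne_top_of_le_ne_top ENNReal.ofReal_ne_top (le_self_add.trans hV)
  rw [V_eq_ofReal hΔ0 hΔ hDD hfin, ENNReal.ofReal_le_ofReal_iff hδ] at hV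
  refine ⟨_, ENNReal.toReal_nonneg, hV, ?_⟩
  rw [← ENNReal.ofReal_le_ofReal_iff (by positivity),
    ENNReal.ofReal_sum_of_nonneg fun i _ => integral_nonneg fun ω => sq_nonneg _,
    ENNReal.ofReal_mul (Nat.cast_nonneg n), ENNReal.ofReal_pow ENNReal.toReal_nonneg,
    ENNReal.ofReal_toReal hfin, ENNReal.ofReal_natCast, ← sum_eLpNorm_sq_eq hn]
  refine Finset.sum_le_sum fun i hi => ?_
  have h2 := hW.norm_le i hi f hf 2 (by norm_num)
  calc ENNReal.ofReal (∫ ω, r i ω ^ 2 ∂μ) ≤ ∫⁻ ω, ‖r i ω‖ₑ ^ 2 ∂μ := ofReal_integral_sq_le _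
    _ ≤ ∫⁻ ω, ‖WVar w ε i f ω‖ₑ ^ 2 ∂μ := by
        refine lintegral_mono_ae ?_
        filter_upwards [hr i hi] with ω hω
        exact pow_le_pow_left₀ zero_le (enorm_le_iff_norm_le.2 hω) 2
    _ = eLpNorm (WVar w ε i f) 2 μ ^ 2 := sq_eLpNorm_two.symm
    _ ≤ _ := pow_le_pow_left₀ zero_le (by simpa using h2) 2

end Norms

/-! ### Truncation of the class -/

section Truncation

variable {Ω : Type*} [MeasurableSpace Ω] {μ : Measure Ω} {m d : ℕ}
  {J : ℤ → Past m → Fin d → ℝ} {ε ε' : ℤ → Ω → Fin m → ℝ} {n : ℕ} {𝓕 : Set (Fn d)}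
  {w : ℕ → Fn d → Past m → ℝ} {D : Fn d → unitInterval → ℝ} {Δ : ℕ → ℝ} {DD DDinf : ℝ}

theorem measurable_tailPart {F : Fn d} (hF : Measurable F) (t : ℝ≥0∞) :
    Measurable (tailPart F t) :=
  hF.indicator (measurableSet_lt measurable_const hF.ennreal_ofReal)

theorem tailPart_nonneg {F : Fn d} (hF : ∀ x, 0 ≤ F x) (t : ℝ≥0∞) (x) : 0 ≤ tailPart F t x :=
  Set.indicator_nonneg (fun _ _ => hF _) x

theorem tailPart_le {F : Fn d} (hF : ∀ x, 0 ≤ F x) (t : ℝ≥0∞) (x) : tailPart F t x ≤ F x :=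
  Set.indicator_le_self' (fun _ _ => hF _) x

theorem sub_tailPart_le {F : Fn d} {t : ℝ≥0∞} (ht : t ≠ ⊤) (x) :
    F x - tailPart F t x ≤ t.toReal := by
  unfold tailPart
  by_cases hx : x ∈ {x | t < ENNReal.ofReal (F x)}
  · rw [Set.indicator_of_mem hx, sub_self]; exact ENNReal.toReal_nonneg
  · rw [Set.indicator_of_notMem hx, sub_zero]
    exact (ENNReal.ofReal_le_iff_le_toReal ht).1 (not_lt.1 hx)

theorem integrable_evalObs_tailPart (hn : 1 ≤ n) (hJ : ∀ i, Measurable (J i))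
    (hε : ∀ i, Measurable (ε i)) {F : Fn d} (hF : Measurable F) {t : ℝ≥0∞}
    (hT : normN μ J ε n 1 (tailPart F t) ≠ ⊤) {i : ℕ} (hi : i ∈ Finset.Icc 1 n) :
    Integrable (evalObs J ε n i (tailPart F t)) μ := by
  rw [← memLp_one_iff_integrable]
  refine ⟨(measurable_evalObs hJ hε i (measurable_tailPart hF t)).aestronglyMeasurable, ?_⟩
  refine (Finset.single_le_sum (f := fun i => eLpNorm (evalObs J ε n i (tailPart F t)) 1 μ)
    (fun _ _ => zero_le) hi).trans_lt ?_
  rw [sum_lintegral_enorm_eq hn]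
  exact ENNReal.mul_lt_top (ENNReal.natCast_lt_top n) (lt_top_iff_ne_top.2 hT)

variable [IsProbabilityMeasure μ]

theorem integrable_evalObs_envelope (hn : 1 ≤ n) (hJ : ∀ i, Measurable (J i))
    (hε : ∀ i, Measurable (ε i)) {F : Fn d} (hF : Measurable F) (hF0 : ∀ x, 0 ≤ F x) {t : ℝ≥0∞}
    (ht : t ≠ ⊤) (hT : normN μ J ε n 1 (tailPart F t) ≠ ⊤) {i : ℕ} (hi : i ∈ Finset.Icc 1 n) :
    Integrable (evalObs J ε n i F) μ := by
  refine ((integrable_const t.toReal).add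
    (integrable_evalObs_tailPart hn hJ hε hF hT hi)).mono'
    (measurable_evalObs hJ hε i hF).aestronglyMeasurable (Filter.Eventually.of_forall fun ω => ?_)
  have := sub_tailPart_le (F := F) ht (obs J ε i ω, grid n i)
  simp only [Pi.add_apply, evalObs, Real.norm_eq_abs]
  rw [abs_of_nonneg (hF0 _)]
  linarith

/-- Almost surely and simultaneously for all elements of the class, `W_i` differs from its truncated
version by at most `W_i(F 1{F > t})`, and `W_i` is monotone and additive on the class. -/
theorem WCondition.ae_forall (hW : WCondition μ J ε ε' n 𝓕 w D Δ) (hn : 1 ≤ n)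
    (hJ : ∀ i, Measurable (J i)) (hε : ∀ i, Measurable (ε i)) (hm : ∀ f ∈ 𝓕, Measurable f)
    {F : Fn d} (hF : Measurable F) (hF0 : ∀ x, 0 ≤ F x) (hFf : ∀ f ∈ 𝓕, ∀ x, |f x| ≤ F x)
    {t : ℝ≥0∞} (ht : t ≠ ⊤) (hT : normN μ J ε n 1 (tailPart F t) ≠ ⊤) :
    ∀ᵐ ω ∂μ, ∀ i ∈ Finset.Icc 1 n,
      (∀ f ∈ 𝓕, |WVar w ε i f ω - clip t.toReal (WVar w ε i f ω)|
        ≤ |WVar w ε i (tailPart F t) ω|) ∧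
      ∀ l ∈ 𝓕, ∀ u ∈ 𝓕, (l ≤ u → WVar w ε i l ω ≤ WVar w ε i u ω) ∧
        WVar w ε i u ω - WVar w ε i l ω = WVar w ε i (u - l) ω := by
  rw [Finset.eventually_all]
  intro i hi
  have hFi := integrable_evalObs_envelope hn hJ hε hF hF0 ht hT hi
  have hG : Integrable (evalObs J ε n i (F + F)) μ := hFi.add hFi
  have hFt := measurable_tailPart hF t
  have hbound : ∀ᵐ ω ∂μ, ‖WVar w ε i (F - tailPart F t) ω‖ₑ ≤ t := by
    have h1 := hW.norm_le i hi (F - tailPart F t) (hF.sub hFt) ⊤ le_top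
    simp only [ENat.toENNReal_top, eLpNorm_exponent_top] at h1
    have h2 : eLpNormEssSup (evalObs J ε n i (F - tailPart F t)) μ ≤ t := by
      refine eLpNormEssSup_le_of_ae_enorm_bound (Filter.Eventually.of_forall fun ω => ?_)
      refine (Real.enorm_eq_ofReal_abs _).trans_le ((ENNReal.ofReal_le_iff_le_toReal ht).2 ?_)
      show |F _ - tailPart F t _| ≤ _
      rw [abs_of_nonneg (sub_nonneg.2 (tailPart_le hF0 t _))]
      exact sub_tailPart_le ht _
    filter_upwards [enorm_ae_le_eLpNormEssSup (WVar w ε i (F - tailPart F t)) μ] with ω hω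
    exact hω.trans (h1.trans h2)
  filter_upwards [hbound, hW.add i hi _ (hF.add hF) hG, hW.mono i hi _ (hF.add hF) hG]
    with ω hb hadd hmono
  have hGF : ∀ x, F x ≤ (F + F) x := fun x => le_add_of_nonneg_left (hF0 x)
  refine ⟨fun f hf => ?_, fun l hl u hu => ?_⟩
  · have h1 := hmono f F (hm f hf) hF (hFf f hf) hGF
    have h2 := hadd (F - tailPart F t) (tailPart F t) (hF.sub hFt) hFt
      (fun x => by
        rw [Pi.sub_apply, abs_of_nonneg (sub_nonneg.2 (tailPart_le hF0 t _))]
        exact (sub_le_self _ (tailPart_nonneg hF0 t x)).trans (hGF x))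
      (fun x => by
        rw [abs_of_nonneg (tailPart_nonneg hF0 t x)]
        exact (tailPart_le hF0 t x).trans (hGF x))
    rw [sub_add_cancel] at h2
    have h3 : WVar w ε i (F - tailPart F t) ω ≤ t.toReal := by
      refine (le_abs_self _).trans ?_
      rwa [← ENNReal.ofReal_le_iff_le_toReal ht, ← Real.enorm_eq_ofReal_abs]
    refine (abs_sub_clip_le ENNReal.toReal_nonneg _).trans (max_le ?_ (abs_nonneg _))
    linarith [le_abs_self (WVar w ε i (tailPart F t) ω)]
  · have hdG : ∀ x, |(u - l) x| ≤ (F + F) x := fun x =>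
      (abs_sub _ _).trans (add_le_add (hFf u hu x) (hFf l hl x))
    have hmd := (hm u hu).sub (hm l hl)
    have h2 := hadd (u - l) l hmd (hm l hl) hdG fun x => (hFf l hl x).trans (hGF x)
    rw [sub_add_cancel] at h2
    refine ⟨fun hlu => ?_, by rw [h2]; ring⟩
    have h1 := hmono (u - l) (u - l) hmd hmd (fun x => (abs_of_nonneg (sub_nonneg.2 (hlu x))).le)
      fun x => (le_abs_self _).trans (hdG x)
    linarith [abs_nonneg (WVar w ε i (u - l) ω)]

/-- The processes `W_i(f)` truncated at level `t`. -/
noncomputable def truncW (n : ℕ) (t : ℝ) (w : ℕ → Fn d → Past m → ℝ) (𝓕 : Set (Fn d))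
    (i : ℕ) (θ : 𝓕) (g : Past m) : ℝ :=
  if i ∈ Finset.Icc 1 n then clip t (w i θ g) else 0

omit [MeasurableSpace Ω] in
theorem truncW_innov {t : ℝ} {i : ℕ} (hi : i ∈ Finset.Icc 1 n) (θ : 𝓕) (ω : Ω) :
    truncW n t w 𝓕 i θ (innov ε i ω) = clip t (WVar w ε i θ ω) := if_pos hi

theorem abs_truncW_le {t : ℝ} (ht : 0 ≤ t) (i : ℕ) (θ : 𝓕) (g : Past m) :
    |truncW n t w 𝓕 i θ g| ≤ t := by
  unfold truncW
  split_ifs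
  · exact abs_clip_le ht _
  · simpa using ht

omit [IsProbabilityMeasure μ] in
theorem WCondition.dependentClass_truncW (hW : WCondition μ J ε ε' n 𝓕 w D Δ) (hn : 1 ≤ n)
    (hm : ∀ f ∈ 𝓕, Measurable f) (hΔ0 : ∀ k, 0 ≤ Δ k) (hDDinf : 0 < DDinf)
    (hD : ∀ f ∈ 𝓕, Real.sqrt ((n : ℝ)⁻¹ * ∑ i ∈ Finset.Icc 1 n, D f (grid n i) ^ 2) ≤ DD)
    (hDinf : ((n : ℝ≥0∞)⁻¹ * ∑ i ∈ Finset.Icc 1 n, DInf 𝓕 D (grid n i) ^ 2) ^ (1 / 2 : ℝ)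
      ≤ ENNReal.ofReal DDinf) {t : ℝ} (ht : 0 ≤ t) :
    DependentClass μ ε ε' n Δ DD DDinf t (truncW n t w 𝓕) where
  meas i θ := by
    by_cases hi : i ∈ Finset.Icc 1 n
    · have : truncW n t w 𝓕 i θ = fun g => clip t (w i θ g) := funext fun g => if_pos hi
      rw [this]
      exact (measurable_clip t).comp (hW.meas i hi θ (hm θ θ.2))
    · have : truncW n t w 𝓕 i θ = fun _ => 0 := funext fun g => if_neg hi
      rw [this]
      exact measurable_const
  bound := abs_truncW_le ht
  dep := by
    intro θ j hj
    have hn0 : (0 : ℝ) < n := by exact_mod_cast hn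
    have h1 : ∑ i ∈ Finset.Icc 1 n, D θ (grid n i) ^ 2 ≤ n * DD ^ 2 := by
      have h2 := hD θ θ.2
      have h3 : 0 ≤ DD := (Real.sqrt_nonneg _).trans h2
      rw [Real.sqrt_le_left h3, inv_mul_le_iff₀ hn0] at h2
      exact h2
    calc _ ≤ ∑ i ∈ Finset.Icc 1 n, D θ (grid n i) ^ 2 * Δ j ^ 2 := by
          refine Finset.sum_le_sum fun i hi => ?_
          rw [← ENNReal.ofReal_le_ofReal_iff (by positivity)]
          calc _ ≤ ∫⁻ ω, ‖truncW n t w 𝓕 i θ (innov ε i ω)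
                  - truncW n t w 𝓕 i θ (innovStar ε ε' i (i - j) ω)‖ₑ ^ 2 ∂μ :=
                ofReal_integral_sq_le _
            _ ≤ ∫⁻ ω, ‖WVar w ε i θ ω - WStar w ε ε' i j θ ω‖ₑ ^ 2 ∂μ := by
                refine lintegral_mono fun ω => pow_le_pow_left₀ zero_le ?_ 2
                simp only [truncW, if_pos hi]
                exact enorm_le_iff_norm_le.2 (abs_clip_sub_clip_le _ _ _)
            _ = eLpNorm (fun ω => WVar w ε i θ ω - WStar w ε ε' i j θ ω) 2 μ ^ 2 :=
                sq_eLpNorm_two.symm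
            _ ≤ ENNReal.ofReal (|D θ (grid n i)| * Δ j) ^ 2 :=
                pow_le_pow_left₀ zero_le (hW.dep i hi j hj θ θ.2) 2
            _ = _ := by
                rw [← ENNReal.ofReal_pow (mul_nonneg (abs_nonneg _) (hΔ0 j)), mul_pow, sq_abs]
      _ = (∑ i ∈ Finset.Icc 1 n, D θ (grid n i) ^ 2) * Δ j ^ 2 := by rw [Finset.sum_mul]
      _ ≤ n * DD ^ 2 * Δ j ^ 2 := by gcongr
      _ = _ := by ring
  dep_sup := by
    intro j hj
    have hn0 : (n : ℝ≥0∞) ≠ 0 := by exact_mod_cast (by omega : n ≠ 0)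
    have h1 : ∑ i ∈ Finset.Icc 1 n, DInf 𝓕 D (grid n i) ^ 2 ≤ n * ENNReal.ofReal DDinf ^ 2 := by
      have h2 := ENNReal.rpow_le_rpow hDinf (z := 2) (by norm_num)
      rw [← ENNReal.rpow_mul, one_div_mul_cancel (by norm_num), ENNReal.rpow_one,
        ENNReal.rpow_two] at h2
      calc _ = (n : ℝ≥0∞) * ((n : ℝ≥0∞)⁻¹ * ∑ i ∈ Finset.Icc 1 n, DInf 𝓕 D (grid n i) ^ 2) := by
            rw [← mul_assoc, ENNReal.mul_inv_cancel hn0 (ENNReal.natCast_ne_top n), one_mul]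
        _ ≤ _ := by gcongr
    calc _ ≤ ∑ i ∈ Finset.Icc 1 n, DInf 𝓕 D (grid n i) ^ 2 * ENNReal.ofReal (Δ j) ^ 2 := by
          refine Finset.sum_le_sum fun i hi => ?_
          have h3 := ENNReal.rpow_le_rpow (hW.dep_sup i hi j hj) (z := 2) (by norm_num)
          rw [← ENNReal.rpow_mul, one_div_mul_cancel (by norm_num), ENNReal.rpow_one,
            ENNReal.rpow_two, mul_pow] at h3
          refine le_trans (lintegral_mono fun ω => pow_le_pow_left₀ zero_le ?_ 2) h3
          refine iSup_le fun θ => le_iSup₂_of_le (θ : Fn d) θ.2 ?_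
          simp only [truncW, if_pos hi]
          exact enorm_le_iff_norm_le.2 (abs_clip_sub_clip_le _ _ _)
      _ = (∑ i ∈ Finset.Icc 1 n, DInf 𝓕 D (grid n i) ^ 2) * ENNReal.ofReal (Δ j) ^ 2 := by
          rw [Finset.sum_mul]
      _ ≤ n * ENNReal.ofReal DDinf ^ 2 * ENNReal.ofReal (Δ j) ^ 2 := by gcongr
      _ = _ := by
          rw [ENNReal.ofReal_mul (Nat.cast_nonneg n), ENNReal.ofReal_natCast,
            ENNReal.ofReal_pow (mul_nonneg hDDinf.le (hΔ0 j)), ENNReal.ofReal_mul hDDinf.le,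
            mul_pow, mul_assoc]

end Truncation

/-! ### The bound for the empirical process -/

section Conclusion

variable {Ω : Type*} [MeasurableSpace Ω] {μ : Measure Ω} [IsProbabilityMeasure μ] {m d : ℕ}
  {J : ℤ → Past m → Fin d → ℝ} {ε ε' : ℤ → Ω → Fin m → ℝ} {n : ℕ} {𝓕 : Set (Fn d)}
  {w : ℕ → Fn d → Past m → ℝ} {D : Fn d → unitInterval → ℝ} {Δ : ℕ → ℝ} {DD DDinf : ℝ}

/-- The chaining bound for the truncated processes, in terms of the entropy integral. -/
theorem WCondition.exists_integrable_bound_truncW (hW : WCondition μ J ε ε' n 𝓕 w D Δ)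
    (h : IIDWithCopy μ ε ε') (hn : 1 ≤ n)
    (hJ : ∀ i, Measurable (J i)) (hm : ∀ f ∈ 𝓕, Measurable f) (hanti : Antitone Δ)
    (hΔ0 : ∀ k, 0 ≤ Δ k) (hΔ : Summable Δ) (hDD : 0 < DD) (hDDinf : 0 < DDinf)
    (hD : ∀ f ∈ 𝓕, Real.sqrt ((n : ℝ)⁻¹ * ∑ i ∈ Finset.Icc 1 n, D f (grid n i) ^ 2) ≤ DD)
    (hDinf : ((n : ℝ≥0∞)⁻¹ * ∑ i ∈ Finset.Icc 1 n, DInf 𝓕 D (grid n i) ^ 2) ^ (1 / 2 : ℝ)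
      ≤ ENNReal.ofReal DDinf)
    {F : Fn d} (hF : Measurable F) (hF0 : ∀ x, 0 ≤ F x) (hFf : ∀ f ∈ 𝓕, ∀ x, |f x| ≤ F x)
    {σ : ℝ} (hσ : 0 < σ) (hV : ∀ f ∈ 𝓕, V μ J ε n DD Δ f ≤ ENNReal.ofReal σ) {t : ℝ≥0∞}
    (ht : t ≠ ⊤) (htm : t = mFun Δ DD DDinf n σ (bracketNum (σ / 2) 𝓕 (V μ J ε n DD Δ)) / 4)
    (hT : normN μ J ε n 1 (tailPart F t) ≠ ⊤) {I : ℝ}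
    (hI : ∫⁻ η in Set.Ioc 0 σ, HFun (bracketNum η 𝓕 (V μ J ε n DD Δ)) ^ (1 / 2 : ℝ)
      = ENNReal.ofReal I) (hI0 : 0 ≤ I) :
    ∃ Z : Ω → ℝ, Integrable Z μ ∧
      ∫ ω, Z ω ∂μ ≤ 9602 * (Real.sqrt n * ((1 + DDinf / DD + DD / DDinf) * I)) ∧
      ∀ᵐ ω ∂μ, ∀ θ : 𝓕,
        |centredSum μ ε n (fun i g => truncW n t.toReal w 𝓕 i θ g) ω| ≤ Z ω := by
  set N : ℝ → ℕ∞ := fun η => bracketNum η 𝓕 (V μ J ε n DD Δ) with hN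
  have hNfin : ∀ k : ℕ, N (σ / 2 ^ k) ≠ ⊤ := fun k =>
    bracketNum_ne_top (by positivity) (div_le_self hσ.le (one_le_pow₀ (by norm_num)))
      (by rw [hI]; exact ENNReal.ofReal_ne_top)
  have hNanti : Antitone N := bracketNum_anti 𝓕 (V μ J ε n DD Δ)
  have hdy : ∀ {k k' : ℕ}, k ≤ k' → σ / 2 ^ k' ≤ σ / 2 ^ k := fun hk =>
    div_le_div_of_nonneg_left hσ.le (by positivity) (pow_le_pow_right₀ (by norm_num) hk)
  choose B hBcard hBV hBcov using fun k => exists_bracket_cover (hNfin k)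
  set H : ℕ → ℝ := fun k => logCard (N (σ / 2 ^ (k + 1))) with hH
  have hae := hW.ae_forall hn hJ h.meas hm hF hF0 hFf ht hT
  have hp := hW.dependentClass_truncW hn hm hΔ0 hDDinf hD hDinf
    (t := t.toReal) ENNReal.toReal_nonneg
  have hmono : ∀ᵐ ω ∂μ, ∀ i ∈ Finset.Icc 1 n,
      Monotone fun θ : 𝓕 => truncW n t.toReal w 𝓕 i θ (innov ε i ω) := by
    filter_upwards [hae] with ω hω i hi θ θ' hθ
    simp only [truncW_innov hi]
    exact clip_mono _ (((hω i hi).2 θ θ.2 θ' θ'.2).1 hθ)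
  have htl : 4 * t.toReal = truncLevel Δ DD DDinf n σ (H 0) := by
    have h1 := hNfin 1
    rw [pow_one] at h1
    rw [htm, mFun_eq _ _ _ _ _ h1, ENNReal.toReal_div, ENNReal.toReal_ofReal]
    · simp only [hH, zero_add, pow_one]
      norm_num
      ring
    · exact (truncLevel_pos hΔ0 hΔ hDD hDDinf hn hσ (one_le_logCard _)).le
  -- the chain is long enough to make the remainder negligible
  obtain ⟨K, hK⟩ := pow_unbounded_of_one_lt (Real.sqrt n) (one_lt_two)
  obtain ⟨Z, hZ, hZ1, hZ2⟩ := exists_integrable_bound_centredSum h hn hp hmono hanti hΔ0 hΔ hDD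
    hDDinf B hBcov hσ H (fun k => one_le_logCard _)
    (fun k k' hk => logCard_mono (hNfin _) (hNanti (hdy (by omega))))
    (fun k => log_le_logCard (hNfin _) ((hBcard k).trans (hNanti (hdy k.le_succ))))
    (fun k => log_le_logCard (hNfin _) (hBcard (k + 1))) htl.le
    (fun k b hb => hW.exists_vNorm_le hn hΔ0 hΔ hDD ((hm _ b.2.2).sub (hm _ b.1.2))
      (by positivity) (hBV k b hb) fun i hi => by
        filter_upwards [hae] with ω hω
        rw [truncW_innov hi, truncW_innov hi,
          ← ((hω i hi).2 b.1 b.1.2 b.2 b.2.2).2]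
        exact abs_clip_sub_clip_le _ _ _)
    (fun θ => hW.exists_vNorm_le hn hΔ0 hΔ hDD (hm _ θ.2) hσ.le (hV _ θ.2)
      fun i hi => Filter.Eventually.of_forall fun ω => by
        rw [truncW_innov hi]
        exact abs_clip_le_abs ENNReal.toReal_nonneg _) K
  refine ⟨Z, hZ, hZ1.trans ?_, hZ2⟩
  have hsum : ∑ k ∈ Finset.range (K + 1), σ / 2 ^ k * Real.sqrt (H k) ≤ 4 * I := by
    have h1 := sum_mul_le_lintegral (antitone_sqrt_entropy 𝓕 (V μ J ε n DD Δ)) hσ (K + 1)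
    rw [hI] at h1
    rw [← ENNReal.ofReal_le_ofReal_iff (by positivity), ENNReal.ofReal_sum_of_nonneg
      fun k _ => by positivity, ENNReal.ofReal_mul (by norm_num)]
    refine le_trans (le_of_eq (Finset.sum_congr rfl fun k _ => ?_)) (h1.trans (by norm_num))
    rw [ENNReal.ofReal_mul (by positivity)]
    congr 1
    exact (HFun_rpow_eq (hNfin (k + 1))).symm
  have hσI : σ ≤ I := by
    rw [← ENNReal.ofReal_le_ofReal_iff hI0, ← hI]
    exact ofReal_le_lintegral_sqrt_entropy _ _ _
  have hn0 : (0 : ℝ) ≤ n := Nat.cast_nonneg n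
  set G := 1 + DDinf / DD + DD / DDinf with hG
  have hG1 : 1 ≤ G := by
    have h1 : 0 ≤ DDinf / DD := by positivity
    have h2 : 0 ≤ DD / DDinf := by positivity
    rw [hG]; linarith
  have hend : n * (σ / 2 ^ K) ≤ Real.sqrt n * (G * I) := by
    calc n * (σ / 2 ^ K) = Real.sqrt n * (Real.sqrt n * σ / 2 ^ K) := by
          nth_rewrite 1 [← Real.mul_self_sqrt hn0]; ring
      _ ≤ Real.sqrt n * σ := by
          refine mul_le_mul_of_nonneg_left ?_ (Real.sqrt_nonneg _)
          rw [div_le_iff₀ (by positivity), mul_comm]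
          exact mul_le_mul_of_nonneg_left hK.le hσ.le
      _ ≤ Real.sqrt n * (G * I) := by
          refine mul_le_mul_of_nonneg_left (hσI.trans ?_) (Real.sqrt_nonneg _)
          exact le_mul_of_one_le_left hI0 hG1
  have hmain := mul_le_mul_of_nonneg_left hsum
    (mul_nonneg (Real.sqrt_nonneg n) (zero_le_one.trans hG1))
  linarith

/-- The empirical process differs from the one formed with the truncated processes by at most the sum
of the variables `W_i(F 1{F > t})` and of their means. -/
theorem abs_GW_le {t : ℝ} (ht : 0 ≤ t) (hε : ∀ i, Measurable (ε i)) {f : 𝓕} {τ : ℕ → Ω → ℝ}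
    (hw : ∀ i ∈ Finset.Icc 1 n, Measurable (w i f))
    (hτ : ∀ i ∈ Finset.Icc 1 n, Integrable (τ i) μ)
    (hae : ∀ᵐ ω ∂μ, ∀ i ∈ Finset.Icc 1 n,
      |WVar w ε i f ω - clip t (WVar w ε i f ω)| ≤ τ i ω) {ω : Ω}
    (hω : ∀ i ∈ Finset.Icc 1 n, |WVar w ε i f ω - clip t (WVar w ε i f ω)| ≤ τ i ω) :
    |GW μ w ε n f ω| ≤ (Real.sqrt n)⁻¹ *
      (|centredSum μ ε n (fun i g => truncW n t w 𝓕 i f g) ω|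
        + ∑ i ∈ Finset.Icc 1 n, (τ i ω + ∫ ω', τ i ω' ∂μ)) := by
  have hinv : 0 ≤ (Real.sqrt n)⁻¹ := by positivity
  rw [GW, abs_mul, abs_of_nonneg hinv]
  refine mul_le_mul_of_nonneg_left ?_ hinv
  have hci : ∀ i ∈ Finset.Icc 1 n, Integrable (fun ω => clip t (WVar w ε i f ω)) μ := fun i hi =>
    integrable_comp_innov (q := fun g => clip t (w i f g)) hε i
      ((measurable_clip t).comp (hw i hi)) fun g => abs_clip_le ht _
  have hri : ∀ i ∈ Finset.Icc 1 n,
      Integrable (fun ω => WVar w ε i f ω - clip t (WVar w ε i f ω)) μ := fun i hi => by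
    have hWm : Measurable (WVar w ε i f) := (hw i hi).comp (measurable_innov hε i)
    refine (hτ i hi).mono' (hWm.sub ((measurable_clip t).comp hWm)).aestronglyMeasurable ?_
    filter_upwards [hae] with ω' h using h i hi
  have e : ∑ i ∈ Finset.Icc 1 n, (WVar w ε i f ω - ∫ ω', WVar w ε i f ω' ∂μ)
      = centredSum μ ε n (fun i g => truncW n t w 𝓕 i f g) ω
        + ∑ i ∈ Finset.Icc 1 n, ((WVar w ε i f ω - clip t (WVar w ε i f ω))
          - ∫ ω', (WVar w ε i f ω' - clip t (WVar w ε i f ω')) ∂μ) := by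
    rw [centredSum, ← Finset.sum_add_distrib]
    refine Finset.sum_congr rfl fun i hi => ?_
    have h1 : ∫ ω', WVar w ε i f ω' ∂μ = ∫ ω', clip t (WVar w ε i f ω') ∂μ
        + ∫ ω', (WVar w ε i f ω' - clip t (WVar w ε i f ω')) ∂μ := by
      rw [← integral_add (hci i hi) (hri i hi)]
      simp
    simp only [truncW_innov hi]
    rw [h1]
    ring
  rw [e]
  refine (abs_add_le _ _).trans (add_le_add le_rfl ?_)
  refine (Finset.abs_sum_le_sum_abs _ _).trans (Finset.sum_le_sum fun i hi => ?_)
  refine (abs_sub _ _).trans (add_le_add (hω i hi) ?_)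
  refine abs_integral_le_integral_abs.trans (integral_mono_ae (hri i hi).abs (hτ i hi) ?_)
  filter_upwards [hae] with ω' h using h i hi

/-- The maximal inequality with an explicit constant. If the entropy integral or the tail term is
infinite there is nothing to prove; otherwise all bracketing numbers involved are finite. -/
theorem WCondition.outerExp_iSup_GW_le (hW : WCondition μ J ε ε' n 𝓕 w D Δ)
    (h : IIDWithCopy μ ε ε') (hn : 1 ≤ n)
    (hJ : ∀ i, Measurable (J i)) (hm : ∀ f ∈ 𝓕, Measurable f) (hanti : Antitone Δ)
    (hΔ0 : ∀ k, 0 ≤ Δ k) (hΔ : Summable Δ) (hDD : 0 < DD) (hDDinf : 0 < DDinf)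
    (hD : ∀ f ∈ 𝓕, Real.sqrt ((n : ℝ)⁻¹ * ∑ i ∈ Finset.Icc 1 n, D f (grid n i) ^ 2) ≤ DD)
    (hDinf : ((n : ℝ≥0∞)⁻¹ * ∑ i ∈ Finset.Icc 1 n, DInf 𝓕 D (grid n i) ^ 2) ^ (1 / 2 : ℝ)
      ≤ ENNReal.ofReal DDinf)
    {F : Fn d} (hF : Measurable F) (hFf : ∀ f ∈ 𝓕, ∀ x, |f x| ≤ F x)
    {σ : ℝ} (hσ : 0 < σ) (hV : ∀ f ∈ 𝓕, V μ J ε n DD Δ f ≤ ENNReal.ofReal σ) :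
    outerExp μ (fun ω => ⨆ f ∈ 𝓕, ‖GW μ w ε n f ω‖ₑ) ≤
      ENNReal.ofReal 9602 * (ENNReal.ofReal (1 + DDinf / DD + DD / DDinf) *
        (∫⁻ η in Set.Ioc 0 σ, HFun (bracketNum η 𝓕 (V μ J ε n DD Δ)) ^ (1 / 2 : ℝ)) +
          ENNReal.ofReal (Real.sqrt n) * normN μ J ε n 1 (tailPart F
            (mFun Δ DD DDinf n σ (bracketNum (σ / 2) 𝓕 (V μ J ε n DD Δ)) / 4))) := by
  rcases 𝓕.eq_empty_or_nonempty with rfl | ⟨f₀, hf₀⟩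
  · refine (outerExp_le_lintegral (Y := fun _ => 0) aemeasurable_const
      (Filter.Eventually.of_forall fun ω => by simp)).trans ?_
    simp
  have hn0 : (0 : ℝ) < n := by exact_mod_cast hn
  have hsn : 0 < Real.sqrt n := Real.sqrt_pos.2 hn0
  have hG0 : 0 < 1 + DDinf / DD + DD / DDinf := by positivity
  set t : ℝ≥0∞ := mFun Δ DD DDinf n σ (bracketNum (σ / 2) 𝓕 (V μ J ε n DD Δ)) / 4 with htm
  by_cases hItop : ∫⁻ η in Set.Ioc 0 σ, HFun (bracketNum η 𝓕 (V μ J ε n DD Δ)) ^ (1 / 2 : ℝ) = ⊤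
  · rw [hItop, ENNReal.mul_top (by simpa using hG0), top_add, ENNReal.mul_top (by norm_num)]
    exact le_top
  by_cases hTtop : normN μ J ε n 1 (tailPart F t) = ⊤
  · rw [hTtop, ENNReal.mul_top (by simpa using hsn), add_top, ENNReal.mul_top (by norm_num)]
    exact le_top
  obtain ⟨I, hI0, hI⟩ : ∃ I : ℝ, 0 ≤ I ∧ ∫⁻ η in Set.Ioc 0 σ,
      HFun (bracketNum η 𝓕 (V μ J ε n DD Δ)) ^ (1 / 2 : ℝ) = ENNReal.ofReal I :=
    ⟨_, ENNReal.toReal_nonneg, (ENNReal.ofReal_toReal hItop).symm⟩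
  obtain ⟨T, hT0, hT⟩ : ∃ T : ℝ, 0 ≤ T ∧ normN μ J ε n 1 (tailPart F t) = ENNReal.ofReal T :=
    ⟨_, ENNReal.toReal_nonneg, (ENNReal.ofReal_toReal hTtop).symm⟩
  have ht : t ≠ ⊤ := by
    rw [htm, mFun_eq _ _ _ _ _ (bracketNum_ne_top (half_pos hσ) (half_le_self hσ.le) hItop)]
    exact ENNReal.div_ne_top ENNReal.ofReal_ne_top (by norm_num)
  have hF0 : ∀ x, 0 ≤ F x := fun x => (abs_nonneg _).trans (hFf f₀ hf₀ x)
  obtain ⟨Z, hZ, hZ1, hZ2⟩ := hW.exists_integrable_bound_truncW h hn hJ hm hanti hΔ0 hΔ hDD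
    hDDinf hD hDinf hF hF0 hFf hσ hV ht htm hTtop hI hI0
  have hae := hW.ae_forall hn hJ h.meas hm hF hF0 hFf ht hTtop
  set τ : ℕ → Ω → ℝ := fun i ω => |WVar w ε i (tailPart F t) ω| with hτ
  have hFt := measurable_tailPart hF t
  have hWm : ∀ i ∈ Finset.Icc 1 n, Measurable (WVar w ε i (tailPart F t)) := fun i hi =>
    (hW.meas i hi _ hFt).comp (measurable_innov h.meas i)
  have hτ1 : ∀ i ∈ Finset.Icc 1 n, ∫⁻ ω, ‖WVar w ε i (tailPart F t) ω‖ₑ ∂μ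
      ≤ eLpNorm (evalObs J ε n i (tailPart F t)) 1 μ := fun i hi => by
    have := hW.norm_le i hi _ hFt 1 le_rfl
    simp only [ENat.toENNReal_one] at this
    rwa [eLpNorm_one_eq_lintegral_enorm] at this
  have hτi : ∀ i ∈ Finset.Icc 1 n, Integrable (τ i) μ := fun i hi => by
    refine Integrable.abs ⟨(hWm i hi).aestronglyMeasurable, ?_⟩
    refine (hτ1 i hi).trans_lt ?_
    exact (memLp_one_iff_integrable.2
      (integrable_evalObs_tailPart hn hJ h.meas hF hTtop hi)).eLpNorm_lt_top
  have hτsum : ∑ i ∈ Finset.Icc 1 n, ∫ ω, τ i ω ∂μ ≤ n * T := by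
    rw [← ENNReal.ofReal_le_ofReal_iff (by positivity), ENNReal.ofReal_sum_of_nonneg
      fun i _ => integral_nonneg fun ω => abs_nonneg _, ENNReal.ofReal_mul hn0.le,
      ENNReal.ofReal_natCast, ← hT, ← sum_lintegral_enorm_eq hn]
    refine Finset.sum_le_sum fun i hi => le_trans (le_of_eq ?_) (hτ1 i hi)
    rw [ofReal_integral_eq_lintegral_ofReal (hτi i hi)
      (Filter.Eventually.of_forall fun ω => abs_nonneg _)]
    simp only [hτ, Real.enorm_eq_ofReal_abs]
  set Y : Ω → ℝ := fun ω => (Real.sqrt n)⁻¹ *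
    (Z ω + ∑ i ∈ Finset.Icc 1 n, (τ i ω + ∫ ω', τ i ω' ∂μ)) with hY
  have hτi2 : ∀ i ∈ Finset.Icc 1 n, Integrable (fun ω => τ i ω + ∫ ω', τ i ω' ∂μ) μ :=
    fun i hi => (hτi i hi).add (integrable_const _)
  have hsumi : Integrable (fun ω => ∑ i ∈ Finset.Icc 1 n, (τ i ω + ∫ ω', τ i ω' ∂μ)) μ :=
    integrable_finsetSum _ hτi2
  have hYi : Integrable Y μ := (hZ.add hsumi).const_mul _
  have hGY : ∀ᵐ ω ∂μ, ∀ f ∈ 𝓕, |GW μ w ε n f ω| ≤ Y ω := by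
    filter_upwards [hae, hZ2] with ω hω hZω f hf
    refine (abs_GW_le (f := ⟨f, hf⟩) (t := t.toReal) ENNReal.toReal_nonneg h.meas
      (fun i hi => hW.meas i hi f (hm f hf)) hτi
      (by filter_upwards [hae] with ω' h' i hi using (h' i hi).1 f hf)
      fun i hi => (hω i hi).1 f hf).trans ?_
    refine mul_le_mul_of_nonneg_left (add_le_add (hZω ⟨f, hf⟩) le_rfl) (by positivity)
  have hY0 : 0 ≤ᵐ[μ] Y := by
    filter_upwards [hGY] with ω hω using (abs_nonneg _).trans (hω f₀ hf₀)
  have hYint : ∫ ω, Y ω ∂μ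
      ≤ 9602 * ((1 + DDinf / DD + DD / DDinf) * I + Real.sqrt n * T) := by
    have e1 : ∫ ω, Y ω ∂μ = (Real.sqrt n)⁻¹ *
        (∫ ω, Z ω ∂μ + 2 * ∑ i ∈ Finset.Icc 1 n, ∫ ω, τ i ω ∂μ) := by
      rw [hY, integral_const_mul, integral_add hZ hsumi,
        integral_finsetSum _ hτi2, Finset.mul_sum]
      congr 2
      refine Finset.sum_congr rfl fun i hi => ?_
      rw [integral_add (hτi i hi) (integrable_const _)]
      simp
      ring
    have e2 : (n : ℝ) = Real.sqrt n * Real.sqrt n := (Real.mul_self_sqrt hn0.le).symm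
    rw [e1, inv_mul_le_iff₀ hsn]
    have h1 : 0 ≤ n * T := by positivity
    have h2 : Real.sqrt n * (9602 * ((1 + DDinf / DD + DD / DDinf) * I + Real.sqrt n * T))
        = 9602 * (Real.sqrt n * ((1 + DDinf / DD + DD / DDinf) * I))
          + 9602 * ((Real.sqrt n * Real.sqrt n) * T) := by ring
    rw [h2, ← e2]
    linarith
  calc outerExp μ (fun ω => ⨆ f ∈ 𝓕, ‖GW μ w ε n f ω‖ₑ)
      ≤ ∫⁻ ω, ENNReal.ofReal (Y ω) ∂μ := by
        refine outerExp_le_lintegral hYi.1.aemeasurable.ennreal_ofReal ?_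
        filter_upwards [hGY] with ω hω
        refine iSup₂_le fun f hf => ?_
        rw [Real.enorm_eq_ofReal_abs]
        exact ENNReal.ofReal_le_ofReal (hω f hf)
    _ = ENNReal.ofReal (∫ ω, Y ω ∂μ) := (ofReal_integral_eq_lintegral_ofReal hYi hY0).symm
    _ ≤ ENNReal.ofReal (9602 * ((1 + DDinf / DD + DD / DDinf) * I + Real.sqrt n * T)) :=
        ENNReal.ofReal_le_ofReal hYint
    _ = _ := by
        rw [hI, hT, ENNReal.ofReal_mul (by norm_num),
          ENNReal.ofReal_add (by positivity) (by positivity), ENNReal.ofReal_mul hG0.le,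
          ENNReal.ofReal_mul hsn.le]

end Conclusion

end EmpProc

theorem mainTheorem6 :
    ∃ c : ℝ, 0 < c ∧
      ∀ (Ω : Type*) [MeasurableSpace Ω] (μ : Measure Ω) [IsProbabilityMeasure μ]
        (m d n : ℕ) (_ : 1 ≤ n)
        (ε ε' : ℤ → Ω → Fin m → ℝ) (_ : EmpProc.IIDWithCopy μ ε ε')
        (J : ℤ → EmpProc.Past m → Fin d → ℝ) (_ : ∀ i, Measurable (J i))
        (Δ : ℕ → ℝ) (_ : Antitone Δ) (_ : ∀ k, 0 ≤ Δ k) (_ : Summable Δ)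
        (𝓕 : Set (EmpProc.Fn d)) (_ : ∀ f ∈ 𝓕, Measurable f)
        (D : EmpProc.Fn d → unitInterval → ℝ)
        (DD DDinf : ℝ) (_ : 0 < DD) (_ : 0 < DDinf)
        (_ : ∀ f ∈ 𝓕, Real.sqrt ((n : ℝ)⁻¹ *
          ∑ i ∈ Finset.Icc 1 n, D f (EmpProc.grid n i) ^ 2) ≤ DD)
        (_ : ((n : ℝ≥0∞)⁻¹ * ∑ i ∈ Finset.Icc 1 n,
          EmpProc.DInf 𝓕 D (EmpProc.grid n i) ^ 2) ^ (1 / 2 : ℝ) ≤ ENNReal.ofReal DDinf)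
        (w : ℕ → EmpProc.Fn d → EmpProc.Past m → ℝ)
        (_ : EmpProc.WCondition μ J ε ε' n 𝓕 w D Δ)
        (F : EmpProc.Fn d) (_ : Measurable F) (_ : ∀ f ∈ 𝓕, ∀ x, |f x| ≤ F x)
        (σ : ℝ) (_ : 0 < σ)
        (_ : ∀ f ∈ 𝓕, EmpProc.V μ J ε n DD Δ f ≤ ENNReal.ofReal σ),
        EmpProc.outerExp μ (fun ω => ⨆ f ∈ 𝓕, ‖EmpProc.GW μ w ε n f ω‖ₑ) ≤
          ENNReal.ofReal c *
            (ENNReal.ofReal (1 + DDinf / DD + DD / DDinf) *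
                (∫⁻ η in Set.Ioc 0 σ,
                  (EmpProc.HFun (EmpProc.bracketNum η 𝓕 (EmpProc.V μ J ε n DD Δ))) ^
                    (1 / 2 : ℝ)) +
              ENNReal.ofReal (Real.sqrt n) *
                EmpProc.normN μ J ε n 1 (EmpProc.tailPart F
                  (EmpProc.mFun Δ DD DDinf n σ
                    (EmpProc.bracketNum (σ / 2) 𝓕 (EmpProc.V μ J ε n DD Δ)) / 4))) := by
  refine ⟨9602, by norm_num, ?_⟩
  intro Ω _ μ _ m d n hn ε ε' h J hJ Δ hanti hΔ0 hΔ 𝓕 hm D DD DDinf hDD hDDinf hD hDinf w hW F hF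
    hFf σ hσ hV
  exact hW.outerExp_iSup_GW_le h hn hJ hm hanti hΔ0 hΔ hDD hDDinf hD hDinf hF hFf hσ hV
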